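/- Atoms are named by natural numbers. A CNF theory $T$ is a finite list of clauses, each a disjunction of literals in which no literal is repeated and no literal occurs together with its dual; it is a 2-CNF theory if every clause has at most 2 literals. A disjunctive logic program $P$ is a finite list of clauses $c_1\vee\dots\vee c_p\leftarrow a_1,\dots,a_r,\mathbf{not}(b_1),\dots,\mathbf{not}(b_s)$ with $p,r,s\ge 0$; it is a disjunctive 2-program if $p+r+s\le 2$ for every clause, and a (normal) 2-program if moreover $p=1$ for every clause. Let $\mathit{At}(\cdot)$ be the set of atoms that occur in the input, $n=|\mathit{At}(\cdot)|$, and let $m$ be the size of the input, i.e. the total number of atom occurrences. A minimal model of $T$ is a set $M\subseteq \mathit{At}(T)$ that satisfies $T$ while no proper subset of $M$ does. The reduct $P^M$ is obtained from $P$ by removing each clause with some $b_j\in M$ and deleting all $\mathbf{not}(b_j)$ from the others; $M$ is an answer set of $P$ if $M$ is a minimal model of $P^M$, and a stable model of a normal program $P$ if $M$ is the least model of $P^M$. **Theorem.** There are algorithms that compute, respectively, 1. all minimal models of a 2-CNF theory, 2. all stable models of a 2-program, 3. all answer sets of a disjunctive 2-program, and that run in time $O(m\,3^{n/3})=O(m\cdot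 1.4422..^n)$, where $1.4422..=3^{1/3}$. Here an algorithm is a program for a random access machine (variables and arrays of natural numbers, unit cost for each operation, where the only arithmetic operations are adding and subtracting 1). On every input of the respective kind it halts, having output each set of the required family at least once and nothing else. The time bound is $C\cdot m\cdot 3^{n/3}$ for a constant $C$ independent of the input, with $m$ replaced by $1$ if $m=0$. -/

import Mathlib

namespace MinModels

/-! ### CNF theories -/

/-- A literal over atoms named by natural numbers. -/
structure Literal where
  positive : Bool
  atom : ℕ

/-- The dual literal. -/
def Literal.dual (l : Literal) : Literal := ⟨!l.positive, l.atom⟩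

/-- `l` is true when exactly the atoms in `M` are true. -/
def Literal.Holds (l : Literal) (M : Finset ℕ) : Prop :=
  if l.positive then l.atom ∈ M else l.atom ∉ M

/-- A CNF theory: a list of clauses, each a list of literals (read as their disjunction). -/
abbrev Theory := List (List Literal)

/-- The set `At(T)` of atoms occurring in `T`. -/
def Theory.atoms (T : Theory) : Finset ℕ := (T.flatten.map Literal.atom).toFinset

/-- The size of `T`: the total number of atom occurrences. -/
def Theory.size (T : Theory) : ℕ := (T.map List.length).sum

/-- No clause repeats a literal or contains a literal together with its dual. -/
def Theory.WellFormed (T : Theory) : Prop :=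
  ∀ c ∈ T, c.Nodup ∧ ∀ l ∈ c, l.dual ∉ c

/-- A `t`-CNF theory: a (well-formed) theory whose clauses have at most `t` literals. -/
def Theory.IsCNF (t : ℕ) (T : Theory) : Prop :=
  T.WellFormed ∧ ∀ c ∈ T, c.length ≤ t

/-- `M ⊆ At(T)` satisfies every clause of `T`. -/
def Theory.IsModel (T : Theory) (M : Finset ℕ) : Prop :=
  M ⊆ T.atoms ∧ ∀ c ∈ T, ∃ l ∈ c, l.Holds M

/-- A model no proper subset of which is a model. -/
def Theory.IsMinimalModel (T : Theory) (M : Finset ℕ) : Prop :=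
  T.IsModel M ∧ ∀ N, N ⊂ M → ¬ T.IsModel N

/-! ### Logic programs -/

/-- The program clause `c₁ ∨ … ∨ c_p ← a₁, …, a_r, not b₁, …, not b_s`. -/
structure Rule where
  head : List ℕ
  pos : List ℕ
  neg : List ℕ

/-- The number of literals of a program clause. -/
def Rule.length (r : Rule) : ℕ := r.head.length + r.pos.length + r.neg.length

/-- A disjunctive logic program. -/
abbrev Program := List Rule

/-- The set `At(P)` of atoms occurring in `P`. -/
def Program.atoms (P : Program) : Finset ℕ :=
  (P.flatMap fun r => r.head ++ r.pos ++ r.neg).toFinset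

/-- The size of `P`: the total number of atom occurrences. -/
def Program.size (P : Program) : ℕ := (P.map Rule.length).sum

/-- A disjunctive `t`-program: all clauses have at most `t` literals. -/
def Program.IsDisjunctive (t : ℕ) (P : Program) : Prop := ∀ r ∈ P, r.length ≤ t

/-- A (normal) `t`-program: moreover, all heads are single atoms. -/
def Program.IsNormal (t : ℕ) (P : Program) : Prop :=
  ∀ r ∈ P, r.head.length = 1 ∧ r.length ≤ t

/-- The Gelfond–Lifschitz reduct `P^M`: drop the clauses with some `not b`, `b ∈ M`, and delete
the remaining negated atoms. -/
def Program.reduct (P : Program) (M : Finset ℕ) : Program :=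
  (P.filter fun r => ∀ b ∈ r.neg, b ∉ M).map fun r => ⟨r.head, r.pos, []⟩

/-- `N` satisfies every clause of `P`, read as a propositional implication. -/
def Program.IsModel (P : Program) (N : Finset ℕ) : Prop :=
  ∀ r ∈ P, (∀ a ∈ r.pos, a ∈ N) → (∀ b ∈ r.neg, b ∉ N) → ∃ c ∈ r.head, c ∈ N

/-- `M` is an answer set of `P`: a minimal model of the reduct `P^M`. -/
def Program.IsAnswerSet (P : Program) (M : Finset ℕ) : Prop :=
  (P.reduct M).IsModel M ∧ ∀ N, N ⊂ M → ¬ (P.reduct M).IsModel N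

/-- `M` is a stable model of the normal program `P`: the least model of the reduct `P^M`. -/
def Program.IsStableModel (P : Program) (M : Finset ℕ) : Prop :=
  IsLeast {N : Finset ℕ | (P.reduct M).IsModel N} M

/-! ### Algorithms: structured programs of a random access machine

A program uses finitely many natural-number variables and finitely many unbounded arrays with
constant-time indirect access. The only arithmetic is adding and subtracting one, so that after `t`
steps all numbers are at most (largest input number) + `O(t)`. Results go to a write-only output. -/

/-- Arithmetic expressions; `pred 0` is `0`, and `get A e` reads cell `e` of array `A`. -/
inductive Expr where
  | const (k : ℕ)
  | var (x : ℕ)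
  | succ (e : Expr)
  | pred (e : Expr)
  | get (A : ℕ) (e : Expr)

/-- Tests. -/
inductive Test where
  | eq (e f : Expr)
  | lt (e f : Expr)
  | not (b : Test)
  | and (b c : Test)

/-- Programs; `store A e f` writes the value of `f` to cell `e` of array `A`. -/
inductive Cmd where
  | skip
  | assign (x : ℕ) (e : Expr)
  | store (A : ℕ) (e f : Expr)
  | emit (e : Expr)
  | seq (p q : Cmd)
  | ite (b : Test) (p q : Cmd)
  | loop (b : Test) (p : Cmd)

/-- A memory state: the variables, the arrays, and the output written so far. -/
structure State where
  vars : ℕ → ℕ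
  arrays : ℕ → ℕ → ℕ
  output : List ℕ

def Expr.eval (s : State) : Expr → ℕ
  | const k => k
  | var x => s.vars x
  | succ e => e.eval s + 1
  | pred e => e.eval s - 1
  | get A e => s.arrays A (e.eval s)

/-- The cost of evaluation: every operation counts one. -/
def Expr.cost : Expr → ℕ
  | const _ => 1
  | var _ => 1
  | succ e => e.cost + 1
  | pred e => e.cost + 1
  | get _ e => e.cost + 1

def Test.eval (s : State) : Test → Prop
  | eq e f => e.eval s = f.eval s
  | lt e f => e.eval s < f.eval s
  | not b => ¬ b.eval s
  | and b c => b.eval s ∧ c.eval s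

def Test.cost : Test → ℕ
  | eq e f => e.cost + f.cost + 1
  | lt e f => e.cost + f.cost + 1
  | not b => b.cost + 1
  | and b c => b.cost + c.cost + 1

/-- `Exec p s t s'`: started in state `s`, program `p` halts in state `s'` after exactly `t`
elementary steps. -/
inductive Exec : Cmd → State → ℕ → State → Prop
  | skip (s : State) : Exec .skip s 1 s
  | assign (x : ℕ) (e : Expr) (s : State) :
      Exec (.assign x e) s (e.cost + 1) { s with vars := Function.update s.vars x (e.eval s) }
  | store (A : ℕ) (e f : Expr) (s : State) :
      Exec (.store A e f) s (e.cost + f.cost + 1)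
        { s with arrays := Function.update s.arrays A
                    (Function.update (s.arrays A) (e.eval s) (f.eval s)) }
  | emit (e : Expr) (s : State) :
      Exec (.emit e) s (e.cost + 1) { s with output := s.output ++ [e.eval s] }
  | seq {p q : Cmd} {s₁ s₂ s₃ : State} {t u : ℕ} :
      Exec p s₁ t s₂ → Exec q s₂ u s₃ → Exec (.seq p q) s₁ (t + u) s₃
  | ite_true {b : Test} {p q : Cmd} {s s' : State} {t : ℕ} :
      b.eval s → Exec p s t s' → Exec (.ite b p q) s (b.cost + t + 1) s'
  | ite_false {b : Test} {p q : Cmd} {s s' : State} {t : ℕ} :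
      ¬ b.eval s → Exec q s t s' → Exec (.ite b p q) s (b.cost + t + 1) s'
  | loop_false {b : Test} {p : Cmd} {s : State} :
      ¬ b.eval s → Exec (.loop b p) s (b.cost + 1) s
  | loop_true {b : Test} {p : Cmd} {s₁ s₂ s₃ : State} {t u : ℕ} :
      b.eval s₁ → Exec p s₁ t s₂ → Exec (.loop b p) s₂ u s₃ →
      Exec (.loop b p) s₁ (b.cost + t + u + 1) s₃

/-! ### Input and output conventions -/

/-- A list of words in memory: its length, then its entries. -/
def encodeList (l : List ℕ) : List ℕ := l.length :: l

def encodeLiteral (l : Literal) : List ℕ := [if l.positive then 1 else 0, l.atom]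

/-- The number of clauses; then, for each clause, its number of literals and its literals. -/
def encodeTheory (T : Theory) : List ℕ :=
  T.length :: T.flatMap fun c => c.length :: c.flatMap encodeLiteral

/-- The number of clauses; then, for each clause, its head, positive body and negative body. -/
def encodeProgram (P : Program) : List ℕ :=
  P.length :: P.flatMap fun r => encodeList r.head ++ encodeList r.pos ++ encodeList r.neg

/-- The initial state: the input occupies array `0`, everything else is zero. -/
def State.init (input : List ℕ) : State where
  vars := fun _ => 0
  arrays := fun A i => if A = 0 then input.getD i 0 else 0
  output := []

/-- On the given input, `p` halts after exactly `t` steps, having output precisely the members of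
the family `F`, one after the other, each as a duplicate-free list of its atoms. -/
def Computes (p : Cmd) (input : List ℕ) (F : Finset ℕ → Prop) (t : ℕ) : Prop :=
  ∃ (s : State) (out : List (List ℕ)), Exec p (State.init input) t s ∧
    s.output = out.flatMap encodeList ∧ (∀ l ∈ out, l.Nodup) ∧
    ∀ M : Finset ℕ, F M ↔ ∃ l ∈ out, l.toFinset = M

end MinModels

/-!
The three problems have a common form. A positive literal of a theory is a head atom `(3, a)`, a
negative one a body atom `(1, a)`, and `not b` in a program clause is `(2, b)`. The minimal models
of a theory, the answer sets of a program, and the stable models of a normal program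
(`isStableModel_iff`) are then the answer sets `IsAns` of a list of clauses, which are here pairs of
literals. One program for the machine, `solver`, computes them in all three cases.

*From minimality to support.* The clauses `c ← a` form a graph of implications. Every model of a
reduct contains with an atom all atoms of its strongly connected component, so the components can be
collapsed to representatives. Afterwards the implications are acyclic, and a set is an answer set if
and only if it satisfies all clauses and each of its atoms is *supported*: it is the head of a
clause whose other literal is false, or of a fact (`Represents.good_of_isAns`,
`Represents.isAns_of_good`). An unsupported component could be removed; conversely, in a smaller
model of the reduct a missing atom that is minimal in the order of the implications would still be
supported, and hence could not be missing.

*Branching.* The search extends partial valuations of the representatives. An undecided atom that is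
already supported must be true. If there is none, let `x` be an undecided *source*: no undecided
atom implies it. Then either `x` is false, or its support comes from a false undecided neighbour `y`
of `x`, where `u` is a neighbour of `z` if there is a clause with head atom `z` and other literal
`u` or `not u` (`Data.Good.exists_false`). In the branch of `y`, all atoms that imply `y` are false,
in particular some source `z`, and with `z` false all neighbours of `z` are true. If `x` is the
source with the fewest undecided neighbours, and `d` counts these and `x` itself, there are `d`
branches, and each of them decides at least `d` atoms. As in the bound of Moon and Moser for maximal
independent sets, `d ≤ 3 ^ (d / 3)` (`natCast_le_root_pow`) limits the search tree over `u`
undecided atoms to `3 ^ (u / 3)` leaves.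

*Time.* A node with `u` undecided atoms is processed in `O(m (u + 1) ^ 2)` steps (`nodeC_spec`). The
factor `(u + 1) ^ 2` disappears in the sum over the tree: with `root = 3 ^ (1 / 3)`, the time for
the tree is at most a constant times `m * root ^ u * weight u` (`search_tree`), where `weight u` is
a partial sum of the convergent series of the `(v + 1) ^ 2 / root ^ v`. Reading the input stops at
an empty clause, so that its time is bounded in terms of the number of atom occurrences.

The programs are verified by means of the total-correctness triples `Run`, which carry a time bound;
the rule for counting loops is `forC_spec`, and `Frame` records what a program leaves alone.
-/

namespace MinModels

/-! ### Reasoning about programs of the machine -/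

/-- The variables that a program may assign. -/
def Cmd.wv : Cmd → List ℕ
  | .skip => []
  | .assign x _ => [x]
  | .store _ _ _ => []
  | .emit _ => []
  | .seq p q => p.wv ++ q.wv
  | .ite _ p q => p.wv ++ q.wv
  | .loop _ p => p.wv

/-- The arrays that a program may write. -/
def Cmd.wa : Cmd → List ℕ
  | .skip => []
  | .assign _ _ => []
  | .store A _ _ => [A]
  | .emit _ => []
  | .seq p q => p.wa ++ q.wa
  | .ite _ p q => p.wa ++ q.wa
  | .loop _ p => p.wa

/-- Whether a program never writes to the output. -/
def Cmd.silent : Cmd → Bool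
  | .skip => true
  | .assign _ _ => true
  | .store _ _ _ => true
  | .emit _ => false
  | .seq p q => p.silent && q.silent
  | .ite _ p q => p.silent && q.silent
  | .loop _ p => p.silent

/-- What running `p` from `s` to `s'` leaves alone: everything that `p` never mentions as a
target. -/
structure Frame (p : Cmd) (s s' : State) : Prop where
  var : ∀ x, x ∉ p.wv → s'.vars x = s.vars x
  arr : ∀ A, A ∉ p.wa → s'.arrays A = s.arrays A
  out : p.silent = true → s'.output = s.output

theorem Exec.frame {p : Cmd} {s s' : State} {t : ℕ} (h : Exec p s t s') : Frame p s s' := by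
  induction h with
  | skip s => exact ⟨fun _ _ => rfl, fun _ _ => rfl, fun _ => rfl⟩
  | assign x e s =>
    refine ⟨fun y hy => ?_, fun _ _ => rfl, fun _ => rfl⟩
    exact Function.update_of_ne (by simpa [Cmd.wv] using hy) _ _
  | store A e f s =>
    refine ⟨fun _ _ => rfl, fun B hB => ?_, fun _ => rfl⟩
    exact Function.update_of_ne (by simpa [Cmd.wa] using hB) _ _
  | emit e s => exact ⟨fun _ _ => rfl, fun _ _ => rfl, fun h => by simp [Cmd.silent] at h⟩
  | seq _ _ ih₁ ih₂ =>
    refine ⟨fun y hy => ?_, fun B hB => ?_, fun h => ?_⟩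
    · simp only [Cmd.wv, List.mem_append, not_or] at hy
      rw [ih₂.var y hy.2, ih₁.var y hy.1]
    · simp only [Cmd.wa, List.mem_append, not_or] at hB
      rw [ih₂.arr B hB.2, ih₁.arr B hB.1]
    · simp only [Cmd.silent, Bool.and_eq_true] at h
      rw [ih₂.out h.2, ih₁.out h.1]
  | ite_true _ _ ih =>
    refine ⟨fun y hy => ?_, fun B hB => ?_, fun h => ?_⟩
    · simp only [Cmd.wv, List.mem_append, not_or] at hy
      exact ih.var y hy.1
    · simp only [Cmd.wa, List.mem_append, not_or] at hB
      exact ih.arr B hB.1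
    · simp only [Cmd.silent, Bool.and_eq_true] at h
      exact ih.out h.1
  | ite_false _ _ ih =>
    refine ⟨fun y hy => ?_, fun B hB => ?_, fun h => ?_⟩
    · simp only [Cmd.wv, List.mem_append, not_or] at hy
      exact ih.var y hy.2
    · simp only [Cmd.wa, List.mem_append, not_or] at hB
      exact ih.arr B hB.2
    · simp only [Cmd.silent, Bool.and_eq_true] at h
      exact ih.out h.2
  | loop_false _ => exact ⟨fun _ _ => rfl, fun _ _ => rfl, fun _ => rfl⟩
  | loop_true _ _ _ ih₁ ih₂ =>
    refine ⟨fun y hy => ?_, fun B hB => ?_, fun h => ?_⟩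
    · rw [ih₂.var y hy, ih₁.var y hy]
    · rw [ih₂.arr B hB, ih₁.arr B hB]
    · rw [ih₂.out h, ih₁.out h]

/-- A total-correctness triple with a time bound: started in `s`, the program `p` halts within `T`
steps in a state satisfying `Q`. -/
def Run (p : Cmd) (s : State) (T : ℕ) (Q : State → Prop) : Prop :=
  ∃ t s', Exec p s t s' ∧ t ≤ T ∧ Q s'

theorem Run.mono {p : Cmd} {s : State} {T U : ℕ} {Q R : State → Prop} (h : Run p s T Q)
    (hT : T ≤ U) (hQ : ∀ s', Frame p s s' → Q s' → R s') : Run p s U R := by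
  obtain ⟨t, s', he, ht, hq⟩ := h
  exact ⟨t, s', he, ht.trans hT, hQ s' he.frame hq⟩

theorem Run.seq {p q : Cmd} {s : State} {T U : ℕ} {Q R : State → Prop} (h : Run p s T R)
    (h' : ∀ s', Frame p s s' → R s' → Run q s' U Q) : Run (.seq p q) s (T + U) Q := by
  obtain ⟨t, s', he, ht, hq⟩ := h
  obtain ⟨u, s'', he', hu, hq'⟩ := h' s' he.frame hq
  exact ⟨t + u, s'', .seq he he', by omega, hq'⟩

theorem Run.ite {b : Test} {p q : Cmd} {s : State} {T : ℕ} {Q : State → Prop}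
    (h : b.eval s → Run p s T Q) (h' : ¬ b.eval s → Run q s T Q) :
    Run (.ite b p q) s (b.cost + T + 1) Q := by
  by_cases hb : b.eval s
  · obtain ⟨t, s', he, ht, hq⟩ := h hb
    exact ⟨_, s', .ite_true hb he, by omega, hq⟩
  · obtain ⟨t, s', he, ht, hq⟩ := h' hb
    exact ⟨_, s', .ite_false hb he, by omega, hq⟩

/-- No loops inside. -/
def Cmd.straight : Cmd → Bool
  | .seq p q => p.straight && q.straight
  | .ite _ p q => p.straight && q.straight
  | .loop _ _ => false
  | _ => true

open Classical in
/-- The effect of a loop-free program (loops are ignored). -/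
noncomputable def Cmd.run : Cmd → State → State
  | .skip, s => s
  | .assign x e, s => { s with vars := Function.update s.vars x (e.eval s) }
  | .store A e f, s =>
    { s with
      arrays := Function.update s.arrays A
        (Function.update (s.arrays A) (e.eval s) (f.eval s)) }
  | .emit e, s => { s with output := s.output ++ [e.eval s] }
  | .seq p q, s => q.run (p.run s)
  | .ite b p q, s => if b.eval s then p.run s else q.run s
  | .loop _ _, s => s

/-- A bound for the running time of a loop-free program. -/
def Cmd.maxCost : Cmd → ℕ
  | .skip => 1
  | .assign _ e => e.cost + 1
  | .store _ e f => e.cost + f.cost + 1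
  | .emit e => e.cost + 1
  | .seq p q => p.maxCost + q.maxCost
  | .ite b p q => b.cost + (p.maxCost + q.maxCost) + 1
  | .loop _ _ => 0

theorem Cmd.run_spec (p : Cmd) (hp : p.straight = true) (s : State) :
    Run p s p.maxCost (fun s' => s' = p.run s) := by
  induction p generalizing s with
  | skip => exact ⟨_, _, .skip s, le_rfl, rfl⟩
  | assign x e => exact ⟨_, _, .assign x e s, le_rfl, rfl⟩
  | store A e f => exact ⟨_, _, .store A e f s, le_rfl, rfl⟩
  | emit e => exact ⟨_, _, .emit e s, le_rfl, rfl⟩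
  | seq p q ihp ihq =>
    simp only [Cmd.straight, Bool.and_eq_true] at hp
    refine (ihp hp.1 s).seq fun s' _ hs' => ?_
    subst hs'
    exact ihq hp.2 _
  | ite b p q ihp ihq =>
    simp only [Cmd.straight, Bool.and_eq_true] at hp
    refine Run.ite (fun hb => ?_) (fun hb => ?_)
    · exact (ihp hp.1 s).mono (by omega) fun s' _ hs' => by simp [Cmd.run, hb, hs']
    · exact (ihq hp.2 s).mono (by omega) fun s' _ hs' => by simp [Cmd.run, hb, hs']
  | loop b p => simp [Cmd.straight] at hp

theorem Run.straight {p : Cmd} {s : State} {Q : State → Prop} (hp : p.straight = true)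
    (h : Q (p.run s)) : Run p s p.maxCost Q :=
  (p.run_spec hp s).mono le_rfl fun _ _ hs => hs ▸ h

/-- The state `s` with variable `x` set to `k`. -/
def State.setVar (s : State) (x k : ℕ) : State := { s with vars := Function.update s.vars x k }

@[simp] theorem State.setVar_self (s : State) (x k : ℕ) : (s.setVar x k).vars x = k := by
  simp [State.setVar]

theorem State.setVar_ne (s : State) {x y : ℕ} (k : ℕ) (h : y ≠ x) :
    (s.setVar x k).vars y = s.vars y := by
  simp [State.setVar, h]

@[simp] theorem State.setVar_arrays (s : State) (x k : ℕ) :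
    (s.setVar x k).arrays = s.arrays := rfl

@[simp] theorem State.setVar_output (s : State) (x k : ℕ) :
    (s.setVar x k).output = s.output := rfl

/-- `for i := 0 to b - 1 do body`, where `b` is a variable. -/
def forC (i b : ℕ) (body : Cmd) : Cmd :=
  .seq (.assign i (.const 0))
    (.loop (.lt (.var i) (.var b)) (.seq body (.assign i (.succ (.var i)))))

/-- The rule for counting loops: an invariant `I k` that holds before round `k`, and a time bound
`c k` for round `k`. -/
theorem forC_spec {i b : ℕ} {body : Cmd} {s : State} (I : ℕ → State → Prop) (c : ℕ → ℕ)
    (hi : i ∉ body.wv) (hb : b ∉ body.wv) (hib : b ≠ i) (h0 : I 0 (s.setVar i 0))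
    (hI : ∀ k s', k < s.vars b → s'.vars i = k → Frame (forC i b body) s s' → I k s' →
      Run body s' (c k) (fun s'' => I (k + 1) (s''.setVar i (k + 1)))) :
    Run (forC i b body) s (6 + ∑ k ∈ Finset.range (s.vars b), (c k + 7)) (I (s.vars b)) := by
  have key : ∀ d k s', k + d = s.vars b → s'.vars i = k → Frame (forC i b body) s s' → I k s' →
      Run (.loop (.lt (.var i) (.var b)) (.seq body (.assign i (.succ (.var i))))) s'
        (4 + ∑ k ∈ Finset.Ico k (s.vars b), (c k + 7)) (I (s.vars b)) := by
    intro d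
    induction d with
    | zero =>
      intro k s' hk hs' hf hIk
      have hbs : s'.vars b = s.vars b := hf.var b (by simp [forC, Cmd.wv, hb, hib])
      refine ⟨_, s', .loop_false ?_, ?_, ?_⟩
      · simp [Test.eval, Expr.eval, hbs, hs']; omega
      · simp [Test.cost, Expr.cost]
      · simpa [← hk] using hIk
    | succ d ih =>
      intro k s' hk hs' hf hIk
      have hbs : s'.vars b = s.vars b := hf.var b (by simp [forC, Cmd.wv, hb, hib])
      obtain ⟨t, s₁, he, ht, hI₁⟩ := hI k s' (by omega) hs' hf hIk
      have hi₁ : s₁.vars i = k := by rw [he.frame.var i hi, hs']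
      have he₂ : Exec (.assign i (.succ (.var i))) s₁ 3 (s₁.setVar i (k + 1)) := by
        have := Exec.assign i (.succ (.var i)) s₁
        simpa [Expr.eval, hi₁, Expr.cost, State.setVar] using this
      have hf₂ : Frame (forC i b body) s (s₁.setVar i (k + 1)) := by
        have h1 := he.frame
        have h2 := he₂.frame
        refine ⟨fun x hx => ?_, fun A hA => ?_, fun ho => ?_⟩
        · have hx' : x ∉ body.wv ∧ x ≠ i := by
            simp only [forC, Cmd.wv, List.mem_append, List.mem_singleton, not_or] at hx
            exact ⟨hx.2.1, hx.1⟩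
          rw [h2.var x (by simpa [Cmd.wv] using hx'.2), h1.var x hx'.1, hf.var x hx]
        · have hA' : A ∉ body.wa := by
            simpa [forC, Cmd.wa] using hA
          rw [h2.arr A (by simp [Cmd.wa]), h1.arr A hA', hf.arr A hA]
        · have ho' : body.silent = true := by simpa [forC, Cmd.silent] using ho
          rw [h2.out rfl, h1.out ho', hf.out ho]
      obtain ⟨u, s₃, he₃, hu, hI₃⟩ :=
        ih (k + 1) _ (by omega) (State.setVar_self _ _ _) hf₂ hI₁
      refine ⟨_, s₃, .loop_true ?_ (.seq he he₂) he₃, ?_, hI₃⟩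
      · simp [Test.eval, Expr.eval, hbs, hs']; omega
      · rw [Finset.sum_eq_sum_Ico_succ_bot (by omega)]
        simp only [Test.cost, Expr.cost]
        omega
  have h1 : Run (.assign i (.const 0)) s 2 (fun s' => s' = s.setVar i 0) :=
    ⟨_, _, .assign i (.const 0) s, by simp [Expr.cost], by simp [State.setVar, Expr.eval]⟩
  refine (h1.seq (U := 4 + ∑ k ∈ Finset.range (s.vars b), (c k + 7)) fun s' hf hs' => ?_).mono
    (by omega) fun _ _ h => h
  subst hs'
  have := key (s.vars b) 0 (s.setVar i 0) (by omega) (by simp) ?_ h0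
  · rwa [Nat.Ico_zero_eq_range] at this
  · refine ⟨fun x hx => ?_, fun A hA => rfl, fun _ => rfl⟩
    refine State.setVar_ne _ _ ?_
    simp only [forC, Cmd.wv, List.mem_append, List.mem_singleton, not_or] at hx
    exact hx.1

/-- The rule for counting loops with a loop-free body. -/
theorem forC_straight {i b : ℕ} {body : Cmd} {s : State} (I : ℕ → State → Prop)
    (hp : body.straight = true)
    (hi : i ∉ body.wv) (hb : b ∉ body.wv) (hib : b ≠ i) (h0 : I 0 (s.setVar i 0))
    (hI : ∀ k s', k < s.vars b → s'.vars i = k → Frame (forC i b body) s s' → I k s' →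
      I (k + 1) ((body.run s').setVar i (k + 1))) :
    Run (forC i b body) s ((body.maxCost + 7) * (s.vars b + 1)) (I (s.vars b)) := by
  refine (forC_spec I (fun _ => body.maxCost) hi hb hib h0 fun k s' hk hs' hf h =>
    Run.straight hp (hI k s' hk hs' hf h)).mono ?_ fun _ _ h => h
  rw [Finset.sum_const, Finset.card_range, smul_eq_mul]
  nlinarith

/-- The rule for counting loops whose body is guarded by a test that holds in the rounds of `F`
only. -/
theorem forC_guard {i b : ℕ} {g : Test} {p : Cmd} {s : State} (I : ℕ → State → Prop)
    (F : Finset ℕ) (X : ℕ) (hi : i ∉ p.wv) (hb : b ∉ p.wv) (hib : b ≠ i) (h0 : I 0 (s.setVar i 0))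
    (hyes : ∀ k s', k < s.vars b → s'.vars i = k → Frame (forC i b (.ite g p .skip)) s s' →
      I k s' → g.eval s' → k ∈ F ∧ Run p s' X (fun s'' => I (k + 1) (s''.setVar i (k + 1))))
    (hno : ∀ k s', k < s.vars b → s'.vars i = k → Frame (forC i b (.ite g p .skip)) s s' →
      I k s' → ¬ g.eval s' → I (k + 1) (s'.setVar i (k + 1))) :
    Run (forC i b (.ite g p .skip)) s ((g.cost + 9) * (s.vars b + 1) + F.card * X)
      (I (s.vars b)) := by
  refine (forC_spec I (fun k => g.cost + 2 + if k ∈ F then X else 0) (by simpa [Cmd.wv] using hi)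
    (by simpa [Cmd.wv] using hb) hib h0 fun k s' hk hs' hf hIk => ?_).mono ?_ fun _ _ h => h
  · by_cases hg : g.eval s'
    · obtain ⟨hF, t, s'', he, ht, hI⟩ := hyes k s' hk hs' hf hIk hg
      exact ⟨_, s'', .ite_true hg he, by simp [hF]; omega, hI⟩
    · exact ⟨_, s', .ite_false hg (.skip s'), by omega, hno k s' hk hs' hf hIk hg⟩
  · have : ∑ k ∈ Finset.range (s.vars b), (if k ∈ F then X else 0) ≤ F.card * X := by
      rw [← Finset.sum_filter, Finset.sum_const, smul_eq_mul]
      exact Nat.mul_le_mul_right _ (Finset.card_le_card fun k hk => (Finset.mem_filter.1 hk).2)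
    have h2 : ∑ k ∈ Finset.range (s.vars b), (g.cost + 2 + (if k ∈ F then X else 0) + 7) =
        s.vars b * (g.cost + 9) + ∑ k ∈ Finset.range (s.vars b), (if k ∈ F then X else 0) := by
      rw [← Finset.card_range (s.vars b), ← smul_eq_mul, ← Finset.sum_const, Finset.card_range,
        ← Finset.sum_add_distrib]
      exact Finset.sum_congr rfl fun k _ => by ring
    rw [h2]
    nlinarith

/-- The disjunction of two tests. -/
def Test.or (a b : Test) : Test := .not (.and (.not a) (.not b))

theorem Test.eval_or (s : State) (a b : Test) :
    (Test.or a b).eval s ↔ a.eval s ∨ b.eval s := by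
  simp only [Test.or, Test.eval]; tauto

end MinModels

namespace MinModels

/-! ### A common form of theories and programs -/

/-- The truth of a literal `(k, a)` of a program clause in the reduct with respect to `M`, evaluated
at `N`: kind `3` stands for the head atom `a`, kind `1` for the body literal `a` and kind `2` for
the body literal `not a`. -/
def LitIn (M N : Finset ℕ) (l : ℕ × ℕ) : Prop :=
  l.1 = 3 ∧ l.2 ∈ N ∨ l.1 = 1 ∧ l.2 ∉ N ∨ l.1 = 2 ∧ l.2 ∈ M

/-- `N` satisfies the reduct of the list `L` of clauses with respect to `M`. -/
def Red (L : List (List (ℕ × ℕ))) (M N : Finset ℕ) : Prop := ∀ c ∈ L, ∃ l ∈ c, LitIn M N l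

/-- The answer sets of a list of clauses. -/
def IsAns (L : List (List (ℕ × ℕ))) (M : Finset ℕ) : Prop :=
  Red L M M ∧ ∀ N, N ⊂ M → ¬ Red L M N

/-- The ordered pairs of literals that form a clause of `L`; a clause with a single literal `l`
counts as `(l, l)`. -/
def Pairs (L : List (List (ℕ × ℕ))) (l l' : ℕ × ℕ) : Prop :=
  ∃ c ∈ L, c = [l] ∧ l = l' ∨ c = [l, l'] ∨ c = [l', l]

/-- The atoms of a list of clauses. -/
def clauseAtoms (L : List (List (ℕ × ℕ))) : Finset ℕ := (L.flatten.map Prod.snd).toFinset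

/-- All clauses have one or two literals, of the three kinds. -/
def IsTwo (L : List (List (ℕ × ℕ))) : Prop :=
  ∀ c ∈ L, c ≠ [] ∧ c.length ≤ 2 ∧ ∀ l ∈ c, l.1 = 1 ∨ l.1 = 2 ∨ l.1 = 3

theorem Pairs.symm {L : List (List (ℕ × ℕ))} {l l' : ℕ × ℕ} (h : Pairs L l l') : Pairs L l' l := by
  obtain ⟨c, hc, ⟨h, rfl⟩ | h | h⟩ := h
  · exact ⟨c, hc, .inl ⟨h, rfl⟩⟩
  · exact ⟨c, hc, .inr (.inr h)⟩
  · exact ⟨c, hc, .inr (.inl h)⟩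

theorem Pairs.kind {L : List (List (ℕ × ℕ))} (hL : IsTwo L) {l l' : ℕ × ℕ} (h : Pairs L l l') :
    l.1 = 1 ∨ l.1 = 2 ∨ l.1 = 3 := by
  obtain ⟨c, hc, ⟨h, rfl⟩ | h | h⟩ := h <;> exact (hL c hc).2.2 l (by simp [h])

theorem Pairs.atom {L : List (List (ℕ × ℕ))} {l l' : ℕ × ℕ} (h : Pairs L l l') :
    l.2 ∈ clauseAtoms L := by
  obtain ⟨c, hc, h⟩ := h
  have : l ∈ c := by rcases h with ⟨h, rfl⟩ | h | h <;> simp [h]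
  simp only [clauseAtoms, List.mem_toFinset, List.mem_map, List.mem_flatten]
  exact ⟨l, ⟨c, hc, this⟩, rfl⟩

theorem red_iff {L : List (List (ℕ × ℕ))} (hL : IsTwo L) (M N : Finset ℕ) :
    Red L M N ↔ ∀ l l', Pairs L l l' → LitIn M N l ∨ LitIn M N l' := by
  constructor
  · rintro h l l' ⟨c, hc, h'⟩
    obtain ⟨l₀, hl₀, hin⟩ := h c hc
    rcases h' with ⟨rfl, rfl⟩ | rfl | rfl <;> simp at hl₀ <;> aesop
  · intro h c hc
    obtain ⟨hne, hlen, -⟩ := hL c hc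
    match c, hne, hlen with
    | [l], _, _ => simpa using h l l ⟨_, hc, .inl ⟨rfl, rfl⟩⟩
    | [l, l'], _, _ => simpa using h l l' ⟨_, hc, .inr (.inl rfl)⟩

theorem LitIn.congr {M N M' N' : Finset ℕ} {l : ℕ × ℕ} (hM : l.2 ∈ M ↔ l.2 ∈ M')
    (hN : l.2 ∈ N ↔ l.2 ∈ N') (h : LitIn M N l) : LitIn M' N' l := by
  unfold LitIn at *; rw [← hM, ← hN]; exact h

/-- Answer sets consist of atoms that occur. -/
theorem IsAns.subset {L : List (List (ℕ × ℕ))} {M : Finset ℕ} (h : IsAns L M) :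
    M ⊆ clauseAtoms L := by
  by_contra hM
  refine h.2 (M ∩ clauseAtoms L)
    ⟨Finset.inter_subset_left, fun h => hM (h.trans Finset.inter_subset_right)⟩ fun c hc => ?_
  obtain ⟨l, hl, hin⟩ := h.1 c hc
  have : l.2 ∈ clauseAtoms L := by
    simp only [clauseAtoms, List.mem_toFinset, List.mem_map, List.mem_flatten]
    exact ⟨l, ⟨c, hc, hl⟩, rfl⟩
  exact ⟨l, hl, hin.congr Iff.rfl (by simp [this])⟩

/-- The implications `c ← a` lead from `a` to `b`. -/
def Reach (L : List (List (ℕ × ℕ))) : ℕ → ℕ → Prop :=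
  Relation.ReflTransGen fun a c => Pairs L (3, c) (1, a)

theorem Reach.mem {L : List (List (ℕ × ℕ))} (hL : IsTwo L) {M N : Finset ℕ} (hN : Red L M N)
    {a b : ℕ} (h : Reach L a b) (ha : a ∈ N) : b ∈ N := by
  induction h with
  | refl => exact ha
  | tail _ h ih =>
    have := (red_iff hL M N).1 hN _ _ h
    simpa [LitIn, ih] using this

open Classical in
/-- The number of atoms from which the implications lead to `z`. -/
noncomputable def reachRank (L : List (List (ℕ × ℕ))) (z : ℕ) : ℕ :=
  ((clauseAtoms L).filter fun a => Reach L a z).card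

theorem reachRank_lt {L : List (List (ℕ × ℕ))} {a z : ℕ} (hz : z ∈ clauseAtoms L)
    (h : Reach L a z) (h' : ¬ Reach L z a) : reachRank L a < reachRank L z := by
  classical
  refine Finset.card_lt_card ⟨fun b hb => ?_, fun hs => h' ?_⟩
  · simp only [Finset.mem_filter] at hb ⊢
    exact ⟨hb.1, hb.2.trans h⟩
  · have := hs (Finset.mem_filter.2 ⟨hz, .refl⟩)
    exact (Finset.mem_filter.1 this).2

theorem reachRank_le {L : List (List (ℕ × ℕ))} {a z : ℕ} (h : Reach L a z) :
    reachRank L a ≤ reachRank L z := by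
  classical
  refine Finset.card_le_card fun b hb => ?_
  simp only [Finset.mem_filter] at hb ⊢
  exact ⟨hb.1, hb.2.trans h⟩

/-! ### Supported valuations -/

/-- The instance as it lies in memory: atoms `name i` for `i < n`, and pairs of literals
`(k1 j, x1 j)`, `(k2 j, x2 j)` for `j < q`. -/
structure Data where
  n : ℕ
  q : ℕ
  name : ℕ → ℕ
  k1 : ℕ → ℕ
  x1 : ℕ → ℕ
  k2 : ℕ → ℕ
  x2 : ℕ → ℕ

/-- A literal of kind `k` is false if its atom has value `v`. The values are `0` (undecided), `1`
(true) and `2` (false). -/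
def litFalse (k v : ℕ) : Prop := k = 1 ∧ v = 1 ∨ k ≠ 1 ∧ v = 2

namespace Data

/-- Some clause has both literals false. -/
def Viol (D : Data) (σ : ℕ → ℕ) : Prop :=
  ∃ j < D.q, litFalse (D.k1 j) (σ (D.x1 j)) ∧ litFalse (D.k2 j) (σ (D.x2 j))

/-- The pair `j` supports its first literal: this is a head atom, and either the other literal is
false, or the clause is a fact. -/
def SupAt (D : Data) (σ : ℕ → ℕ) (j : ℕ) : Prop :=
  D.k1 j = 3 ∧ (D.x1 j ≠ D.x2 j ∧ litFalse (D.k2 j) (σ (D.x2 j)) ∨ D.x1 j = D.x2 j ∧ D.k2 j = 3)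

/-- The atom `x` is supported. -/
def Sup (D : Data) (σ : ℕ → ℕ) (x : ℕ) : Prop := ∃ j < D.q, D.x1 j = x ∧ D.SupAt σ j

/-- A total valuation that satisfies all clauses and supports all its true atoms. -/
structure Good (D : Data) (τ : ℕ → ℕ) : Prop where
  total : ∀ i < D.n, τ (D.name i) = 1 ∨ τ (D.name i) = 2
  viol : ¬ D.Viol τ
  sup : ∀ i < D.n, τ (D.name i) = 1 → D.Sup τ (D.name i)

/-- `τ` extends the partial valuation `σ`. -/
def Ext (D : Data) (σ τ : ℕ → ℕ) : Prop :=
  ∀ i < D.n, σ (D.name i) ≠ 0 → τ (D.name i) = σ (D.name i)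

end Data

/-- The data `D` represent the clauses `L` with atoms replaced by representatives of the strongly
connected components of the graph of implications. -/
structure Represents (D : Data) (rep : ℕ → ℕ) (L : List (List (ℕ × ℕ))) : Prop where
  two : IsTwo L
  inj : ∀ i < D.n, ∀ j < D.n, D.name i = D.name j → i = j
  names : ∀ a, a ∈ clauseAtoms L ↔ ∃ i < D.n, D.name i = a
  pairs : ∀ l l', Pairs L l l' →
    ∃ j < D.q, D.k1 j = l.1 ∧ D.x1 j = rep l.2 ∧ D.k2 j = l'.1 ∧ D.x2 j = rep l'.2
  pairs' : ∀ j < D.q, ∃ l l', Pairs L l l' ∧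
    D.k1 j = l.1 ∧ D.x1 j = rep l.2 ∧ D.k2 j = l'.1 ∧ D.x2 j = rep l'.2
  rep_mem : ∀ a ∈ clauseAtoms L, rep a ∈ clauseAtoms L
  reach : ∀ a ∈ clauseAtoms L, Reach L a (rep a) ∧ Reach L (rep a) a
  rep_eq : ∀ a ∈ clauseAtoms L, ∀ b ∈ clauseAtoms L, Reach L a b → Reach L b a → rep a = rep b

namespace Represents

variable {D : Data} {rep : ℕ → ℕ} {L : List (List (ℕ × ℕ))}

theorem rep_rep (h : Represents D rep L) {a : ℕ} (ha : a ∈ clauseAtoms L) :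
    rep (rep a) = rep a :=
  (h.rep_eq a ha _ (h.rep_mem a ha) (h.reach a ha).1 (h.reach a ha).2).symm

theorem reach_of_rep_eq (h : Represents D rep L) {a b : ℕ} (ha : a ∈ clauseAtoms L)
    (hb : b ∈ clauseAtoms L) (hab : rep a = rep b) : Reach L a b :=
  (h.reach a ha).1.trans (hab ▸ (h.reach b hb).2)

/-- An answer set is a union of components, all of whose components are supported. -/
theorem good_of_isAns (h : Represents D rep L) {M : Finset ℕ} (hM : IsAns L M) :
    ∃ τ, D.Good τ ∧ (∀ a ∈ clauseAtoms L, rep a ≠ a → τ a = 2) ∧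
      ∀ a ∈ clauseAtoms L, (τ (rep a) = 1 ↔ a ∈ M) := by
  classical
  have hrepM : ∀ a ∈ clauseAtoms L, (rep a ∈ M ↔ a ∈ M) := fun a ha =>
    ⟨fun h' => (h.reach a ha).2.mem h.two hM.1 h', fun h' => (h.reach a ha).1.mem h.two hM.1 h'⟩
  set τ : ℕ → ℕ := fun a => if rep a = a ∧ a ∈ M then 1 else 2 with hτ
  have hτrep : ∀ a ∈ clauseAtoms L, τ (rep a) = if a ∈ M then 1 else 2 := by
    intro a ha
    simp only [hτ, h.rep_rep ha, true_and, hrepM a ha]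
  have hτ12 : ∀ a, τ a = 1 ∨ τ a = 2 := by
    intro a; simp only [hτ]; split_ifs <;> simp
  have hlf : ∀ l : ℕ × ℕ, l.2 ∈ clauseAtoms L → (l.1 = 1 ∨ l.1 = 2 ∨ l.1 = 3) →
      (litFalse l.1 (τ (rep l.2)) ↔ ¬ LitIn M M l) := by
    intro l hl hk
    rw [hτrep _ hl]
    by_cases hm : l.2 ∈ M <;> rcases hk with hk | hk | hk <;> simp [litFalse, LitIn, hm, hk]
  refine ⟨τ, ⟨fun i _ => hτ12 _, ?_, ?_⟩, ?_, ?_⟩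
  · rintro ⟨j, hj, h1, h2⟩
    obtain ⟨l, l', hp, e1, e2, e3, e4⟩ := h.pairs' j hj
    rw [e1, e2, hlf l hp.atom (hp.kind h.two)] at h1
    rw [e3, e4, hlf l' hp.symm.atom (hp.symm.kind h.two)] at h2
    have := (red_iff h.two M M).1 hM.1 l l' hp
    tauto
  · intro i hi h1
    set x := D.name i with hx
    obtain ⟨hxr, hxM⟩ : rep x = x ∧ x ∈ M := by
      by_contra hc
      simp [hτ, hc] at h1
    have hxA : x ∈ clauseAtoms L := (h.names x).2 ⟨i, hi, rfl⟩
    -- If `x` had no support, its whole component could be removed from `M`.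
    by_contra hns
    set N := M.filter fun a => rep a ≠ x with hN
    have hmN : ∀ a, a ∈ N ↔ a ∈ M ∧ rep a ≠ x := fun a => by simp [hN]
    have key : ∀ l l', Pairs L l l' → l.1 = 3 → rep l.2 = x → LitIn M N l' := by
      intro l l' hp hk hr
      obtain ⟨j, hj, e1, e2, e3, e4⟩ := h.pairs l l' hp
      have hns' : ¬ D.SupAt τ j := fun hs => hns ⟨j, hj, by rw [e2, hr], hs⟩
      simp only [Data.SupAt, e1, e2, e3, e4, hk, hr, true_and, not_or, not_and] at hns'
      by_cases hxl : x = rep l'.2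
      · have hl'M : l'.2 ∈ M := (hrepM _ hp.symm.atom).1 (hxl ▸ hxM)
        rcases hp.symm.kind h.two with hk' | hk' | hk'
        · simp [LitIn, hk', hmN, ← hxl]
        · simp [LitIn, hk', hl'M]
        · exact absurd hk' (hns'.2 hxl)
      · have := hns'.1 hxl
        rw [hlf l' hp.symm.atom (hp.symm.kind h.two), not_not] at this
        refine this.congr Iff.rfl ?_
        rw [hmN]
        exact ⟨fun h => ⟨h, fun h' => hxl h'.symm⟩, fun h => h.1⟩
    have one : ∀ l l', Pairs L l l' → LitIn M M l → LitIn M N l ∨ LitIn M N l' := by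
      intro l l' hp hl
      rcases hl with ⟨hk, hl⟩ | ⟨hk, hl⟩ | ⟨hk, hl⟩
      · by_cases hr : rep l.2 = x
        · exact .inr (key l l' hp hk hr)
        · exact .inl (.inl ⟨hk, (hmN _).2 ⟨hl, hr⟩⟩)
      · exact .inl (.inr (.inl ⟨hk, fun h => hl ((hmN _).1 h).1⟩))
      · exact .inl (.inr (.inr ⟨hk, hl⟩))
    refine hM.2 N ⟨Finset.filter_subset _ _, fun hs => ?_⟩ ((red_iff h.two M N).2 ?_)
    · exact ((hmN x).1 (hs hxM)).2 hxr
    · intro l l' hp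
      rcases (red_iff h.two M M).1 hM.1 l l' hp with hl | hl
      · exact one l l' hp hl
      · exact (one l' l hp.symm hl).symm
  · intro a _ ha
    simp [hτ, ha]
  · intro a ha
    rw [hτrep a ha]
    split_ifs with hm <;> simp [hm]

/-- A supported valuation gives an answer set: along the implications, which are acyclic between
components, every model of the reduct below it is the whole of it. -/
theorem isAns_of_good (h : Represents D rep L) {τ : ℕ → ℕ} (hτ : D.Good τ) {M : Finset ℕ}
    (hM : ∀ a, a ∈ M ↔ a ∈ clauseAtoms L ∧ τ (rep a) = 1) : IsAns L M := by
  have hτ12 : ∀ a ∈ clauseAtoms L, τ (rep a) = 1 ∨ τ (rep a) = 2 := by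
    intro a ha
    obtain ⟨i, hi, he⟩ := (h.names _).1 (h.rep_mem a ha)
    exact he ▸ hτ.total i hi
  have hlf : ∀ l : ℕ × ℕ, l.2 ∈ clauseAtoms L → (l.1 = 1 ∨ l.1 = 2 ∨ l.1 = 3) →
      (litFalse l.1 (τ (rep l.2)) ↔ ¬ LitIn M M l) := by
    intro l hl hk
    rcases hτ12 _ hl with hm | hm <;> rcases hk with hk | hk | hk <;>
      simp [litFalse, LitIn, hm, hk, hM, hl]
  have hMred : Red L M M := by
    refine (red_iff h.two M M).2 fun l l' hp => ?_
    by_contra hc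
    rw [not_or] at hc
    obtain ⟨j, hj, e1, e2, e3, e4⟩ := h.pairs l l' hp
    refine hτ.viol ⟨j, hj, ?_, ?_⟩
    · rw [e1, e2]; exact (hlf l hp.atom (hp.kind h.two)).2 hc.1
    · rw [e3, e4]; exact (hlf l' hp.symm.atom (hp.symm.kind h.two)).2 hc.2
  refine ⟨hMred, fun N hNM hN => ?_⟩
  obtain ⟨x, hx, hmin⟩ := Finset.exists_min_image (M \ N) (reachRank L)
    (Finset.sdiff_nonempty.2 hNM.2)
  rw [Finset.mem_sdiff] at hx
  obtain ⟨hxA, hxτ⟩ := (hM x).1 hx.1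
  obtain ⟨i, hi, he⟩ := (h.names _).1 (h.rep_mem x hxA)
  obtain ⟨j, hj, hjx, hs⟩ := hτ.sup i hi (by rw [he, hxτ])
  obtain ⟨l, l', hp, e1, e2, e3, e4⟩ := h.pairs' j hj
  rw [he, e2] at hjx
  have hlx : Reach L l.2 x := h.reach_of_rep_eq hp.atom hxA hjx
  have hlN : l.2 ∉ N := fun hl => hx.2 (hlx.mem h.two hN hl)
  simp only [Data.SupAt, e1, e2, e3, e4] at hs
  obtain ⟨hk, hs⟩ := hs
  have hl' : LitIn M N l' := by
    refine ((red_iff h.two M N).1 hN l l' hp).resolve_left fun hl => ?_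
    simp [LitIn, hk, hlN] at hl
  rcases hs with ⟨hne, hf⟩ | ⟨heq, hk'⟩
  · rw [hlf l' hp.symm.atom (hp.symm.kind h.two)] at hf
    rcases hl' with ⟨hk', hl'⟩ | ⟨hk', hl'⟩ | ⟨hk', hl'⟩
    · exact hf (.inl ⟨hk', hNM.1 hl'⟩)
    · have hl'M : l'.2 ∈ M := by
        by_contra hc
        exact hf (.inr (.inl ⟨hk', hc⟩))
      -- The implication leads to `x` from an atom of `M \ N` in another component.
      have hstep : Reach L l'.2 l.2 := by
        refine .single ?_
        rwa [← hk, ← hk']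
      have hlt : reachRank L l'.2 < reachRank L l.2 :=
        reachRank_lt hp.atom hstep fun hb =>
          hne (h.rep_eq _ hp.atom _ hp.symm.atom hb hstep)
      have := hmin l'.2 (Finset.mem_sdiff.2 ⟨hl'M, hl'⟩)
      have := reachRank_le hlx
      omega
    · exact hf (.inr (.inr ⟨hk', hl'⟩))
  · have hl'x : Reach L l'.2 x := h.reach_of_rep_eq hp.symm.atom hxA (heq ▸ hjx)
    refine hx.2 (hl'x.mem h.two hN ?_)
    simpa [LitIn, hk'] using hl'

end Represents

/-! ### The search tree -/

namespace Data

variable (D : Data)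

/-- The clause `z ← a` is present, for distinct atoms. -/
def Imp (a z : ℕ) : Prop :=
  ∃ j < D.q, D.k1 j = 3 ∧ D.x1 j = z ∧ D.k2 j = 1 ∧ D.x2 j = a ∧ a ≠ z

/-- The atom `z` occurs in the head of a clause with another literal `u` or `not u`, so that `u`
must be true if `z` is false. -/
def Nb (z u : ℕ) : Prop := ∃ j < D.q, D.k1 j = 3 ∧ D.x1 j = z ∧ D.k2 j ≠ 1 ∧ D.x2 j = u

/-- What the search needs to know about an instance: the names are distinct and include all atoms of
the clauses, and the implications are acyclic. -/
structure Ok : Prop where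
  inj : ∀ i < D.n, ∀ j < D.n, D.name i = D.name j → i = j
  mem1 : ∀ j < D.q, ∃ i < D.n, D.name i = D.x1 j
  mem2 : ∀ j < D.q, ∃ i < D.n, D.name i = D.x2 j
  rank : ∃ rk : ℕ → ℕ, ∀ a z, D.Imp a z → rk a < rk z

/-- The indices of the undecided atoms. -/
def free (σ : ℕ → ℕ) : Finset ℕ := (Finset.range D.n).filter fun i => σ (D.name i) = 0

open Classical in
/-- The extension of `σ` that makes `z` false and the neighbours of `z` true. -/
noncomputable def child (σ : ℕ → ℕ) (z : ℕ) : ℕ → ℕ := fun a =>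
  if a = z then 2 else if σ a = 0 ∧ D.Nb z a then 1 else σ a

/-- No undecided atom implies `z`. -/
def Source (σ : ℕ → ℕ) (z : ℕ) : Prop := ∀ a, σ a = 0 → ¬ D.Imp a z

/-- In every total valuation that satisfies the clauses, `z` is false if `y` is. -/
def Forces (z y : ℕ) : Prop := ∀ τ, D.Good τ → τ y = 2 → τ z = 2

variable {D}

/-- Falsity passes up the implications, which is why a branch at `y` may decide a source instead. -/
theorem Forces.imp (h : D.Ok) {a z y : ℕ} (hzy : D.Forces z y) (ha : D.Imp a z) :
    D.Forces a y := by
  intro τ hτ hy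
  obtain ⟨j, hj, h1, h2, h3, h4, -⟩ := ha
  obtain ⟨i, hi, he⟩ := h.mem2 j hj
  have hv : ¬ τ a = 1 := fun hv =>
    hτ.viol ⟨j, hj, by rw [h1, h2, hzy τ hτ hy]; simp [litFalse],
      by rw [h3, h4, hv]; simp [litFalse]⟩
  have := hτ.total i hi
  rw [he, h4] at this
  tauto

theorem litFalse.ext {σ τ : ℕ → ℕ} {k a : ℕ} (h : litFalse k (σ a)) (he : σ a ≠ 0 → τ a = σ a) :
    litFalse k (τ a) := by
  have : σ a ≠ 0 := by rcases h with ⟨-, h⟩ | ⟨-, h⟩ <;> simp [h]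
  rwa [he this]

theorem Ext.apply {σ τ : ℕ → ℕ} (he : D.Ext σ τ) {a : ℕ} (ha : ∃ i < D.n, D.name i = a)
    (h : σ a ≠ 0) : τ a = σ a := by
  obtain ⟨i, hi, rfl⟩ := ha
  exact he i hi h

/-- An atom that is supported by decided atoms is true. -/
theorem Good.true_of_sup (h : D.Ok) {σ τ : ℕ → ℕ} (hτ : D.Good τ) (he : D.Ext σ τ) {x : ℕ}
    (hs : D.Sup σ x) : τ x = 1 := by
  obtain ⟨j, hj, rfl, hk, hs⟩ := hs
  obtain ⟨i, hi, hix⟩ := h.mem1 j hj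
  have h12 := hτ.total i hi
  rw [hix] at h12
  refine h12.resolve_right fun h2 => hτ.viol ⟨j, hj, .inr ⟨by omega, h2⟩, ?_⟩
  rcases hs with ⟨-, hf⟩ | ⟨heq, hk'⟩
  · exact litFalse.ext hf fun h0 => he.apply (h.mem2 j hj) h0
  · exact .inr ⟨by omega, heq ▸ h2⟩

/-- An unsupported source `x` is false or has a false undecided neighbour. -/
theorem Good.exists_false (h : D.Ok) {σ τ : ℕ → ℕ} (hτ : D.Good τ) (he : D.Ext σ τ) {x : ℕ}
    (hx : ∃ i < D.n, D.name i = x) (hx0 : σ x = 0) (hsrc : D.Source σ x) (hns : ¬ D.Sup σ x) :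
    ∃ i < D.n, σ (D.name i) = 0 ∧ D.child σ x (D.name i) ≠ 0 ∧ τ (D.name i) = 2 := by
  obtain ⟨i, hi, hix⟩ := hx
  rcases hτ.total i hi with h1 | h2
  · obtain ⟨j, hj, hjx, hk, hs⟩ := hτ.sup i hi h1
    rw [hix] at hjx
    rcases hs with ⟨hne, hf⟩ | hs
    · obtain ⟨i', hi', hi'x⟩ := h.mem2 j hj
      have h20 : σ (D.x2 j) = 0 := by
        by_contra h20
        rw [he.apply (h.mem2 j hj) h20] at hf
        exact hns ⟨j, hj, hjx, hk, .inl ⟨hne, hf⟩⟩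
      rcases hf with ⟨hk2, -⟩ | ⟨hk2, hv⟩
      · exact absurd ⟨j, hj, hk, hjx, hk2, rfl, fun h => hne (hjx.trans h.symm)⟩ (hsrc _ h20)
      · refine ⟨i', hi', by rw [hi'x, h20], ?_, by rw [hi'x, hv]⟩
        have : D.Nb x (D.x2 j) := ⟨j, hj, hk, hjx, hk2, rfl⟩
        simp only [child, hi'x, h20, this]
        split_ifs <;> simp_all
    · exact absurd ⟨j, hj, hjx, hk, .inr hs⟩ hns
  · exact ⟨i, hi, by rw [hix, hx0], by simp [child, hix], h2⟩

theorem Good.ext_child {σ τ : ℕ → ℕ} (hτ : D.Good τ) (he : D.Ext σ τ) {z : ℕ}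
    (hz : τ z = 2) : D.Ext (D.child σ z) τ := by
  intro i hi h0
  unfold child at h0 ⊢
  split_ifs at h0 ⊢ with h1 h2
  · rw [h1, hz]
  · obtain ⟨j, hj, g1, g2, g3, g4⟩ := h2.2
    refine (hτ.total i hi).resolve_right fun hf => hτ.viol ⟨j, hj, ?_, ?_⟩
    · rw [g1, g2, hz]; simp [litFalse]
    · rw [g4]; exact .inr ⟨g3, hf⟩
  · exact he i hi h0

theorem mem_free {σ : ℕ → ℕ} {i : ℕ} : i ∈ D.free σ ↔ i < D.n ∧ σ (D.name i) = 0 := by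
  simp [free]

theorem child_eq_zero {σ : ℕ → ℕ} {z a : ℕ} (h : D.child σ z a = 0) : σ a = 0 := by
  unfold child at h
  split_ifs at h
  exact h

/-- The branches at `x` are as many as the atoms that `D.child σ x` decides. -/
theorem card_branches (σ : ℕ → ℕ) (x : ℕ) :
    ((D.free σ).filter fun i => D.child σ x (D.name i) ≠ 0).card + (D.free (D.child σ x)).card =
      (D.free σ).card := by
  rw [← Finset.card_filter_add_card_filter_not (s := D.free σ)
    (fun i => D.child σ x (D.name i) ≠ 0)]
  congr 2
  ext i
  simp only [mem_free, Finset.mem_filter, not_not]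
  exact ⟨fun h => ⟨⟨h.1, child_eq_zero h.2⟩, h.2⟩, fun h => ⟨h.1.1, h.2⟩⟩

end Data

/-- After the collapse of the components the implications are acyclic. -/
theorem Represents.ok {D : Data} {rep : ℕ → ℕ} {L : List (List (ℕ × ℕ))}
    (h : Represents D rep L) : D.Ok := by
  refine ⟨h.inj, fun j hj => ?_, fun j hj => ?_, reachRank L, fun a z => ?_⟩
  · obtain ⟨l, l', hp, e1, e2, e3, e4⟩ := h.pairs' j hj
    rw [e2]
    exact (h.names _).1 (h.rep_mem _ hp.atom)
  · obtain ⟨l, l', hp, e1, e2, e3, e4⟩ := h.pairs' j hj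
    rw [e4]
    exact (h.names _).1 (h.rep_mem _ hp.symm.atom)
  · rintro ⟨j, hj, g1, g2, g3, g4, hne⟩
    obtain ⟨l, l', hp, e1, e2, e3, e4⟩ := h.pairs' j hj
    have ha := hp.symm.atom
    have hz := hp.atom
    have hstep : Reach L l'.2 l.2 := by
      refine .single ?_
      rwa [← g1, ← g3, e1, e3]
    have hra : Reach L a l'.2 := by rw [← g4, e4]; exact (h.reach _ ha).2
    have hrz : Reach L l.2 z := by rw [← g2, e2]; exact (h.reach _ hz).1
    have hzA : z ∈ clauseAtoms L := by rw [← g2, e2]; exact h.rep_mem _ hz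
    refine reachRank_lt hzA (hra.trans (hstep.trans hrz)) fun hb => hne ?_
    rw [← g4, ← g2, e4, e2]
    refine h.rep_eq _ ha _ hz hstep ?_
    exact hrz.trans (hb.trans hra)

/-! ### Growth -/

theorem cube_le_three_pow (d : ℕ) : d ^ 3 ≤ 3 ^ d := by
  match d with
  | 0 => norm_num
  | 1 => norm_num
  | 2 => norm_num
  | d + 3 =>
    induction d with
    | zero => norm_num
    | succ d ih =>
      have h : 3 * (d + 3) ^ 3 =
          (d + 1 + 3) ^ 3 + (2 * d ^ 3 + 15 * d ^ 2 + 33 * d + 17) := by ring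
      calc (d + 1 + 3) ^ 3 ≤ 3 * (d + 3) ^ 3 := by omega
        _ ≤ 3 * 3 ^ (d + 3) := by omega
        _ = 3 ^ (d + 1 + 3) := by ring

/-- The cube root of three. -/
noncomputable def root : ℝ := (3 : ℝ) ^ ((1 : ℝ) / 3)

theorem root_pow_three : root ^ 3 = 3 := by
  rw [root, ← Real.rpow_natCast, ← Real.rpow_mul (by norm_num)]
  norm_num

theorem root_pos : 0 < root := Real.rpow_pos_of_pos (by norm_num) _

theorem rpow_div_three (n : ℕ) : (3 : ℝ) ^ ((n : ℝ) / 3) = root ^ n := by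
  rw [root, ← Real.rpow_natCast, ← Real.rpow_mul (by norm_num)]
  congr 1
  ring

theorem lt_root : (1.4422 : ℝ) < root := by
  refine lt_of_pow_lt_pow_left₀ 3 root_pos.le ?_
  rw [root_pow_three]; norm_num

theorem root_lt : root < (1.4423 : ℝ) := by
  refine lt_of_pow_lt_pow_left₀ 3 (by norm_num) ?_
  rw [root_pow_three]; norm_num

/-- The Moon–Moser inequality: `d` branches that each decide `d` atoms pay for themselves. -/
theorem natCast_le_root_pow (d : ℕ) : (d : ℝ) ≤ root ^ d := by
  refine le_of_pow_le_pow_left₀ (n := 3) (by norm_num) (pow_nonneg root_pos.le _) ?_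
  rw [← pow_mul, mul_comm d 3, pow_mul, root_pow_three]
  exact_mod_cast cube_le_three_pow d

/-- The sum of `(v + 1) ^ 2 / root ^ v` over `v ≤ u`. It is bounded, and its increments pay for the
work at the nodes of the search tree. -/
noncomputable def weight (u : ℕ) : ℝ := ∑ v ∈ Finset.range (u + 1), ((v : ℝ) + 1) ^ 2 / root ^ v

theorem exists_weight_le : ∃ S : ℝ, 0 < S ∧ ∀ u, weight u ≤ S := by
  have hr : ‖root⁻¹‖ < 1 := by
    rw [norm_inv, Real.norm_of_nonneg root_pos.le]
    exact inv_lt_one_of_one_lt₀ (lt_trans (by norm_num) lt_root)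
  have hs : Summable fun v : ℕ => ((v : ℝ) + 1) ^ 2 / root ^ v := by
    have h2 := summable_pow_mul_geometric_of_norm_lt_one 2 hr
    have h1 := summable_pow_mul_geometric_of_norm_lt_one 1 hr
    have h0 := summable_pow_mul_geometric_of_norm_lt_one 0 hr
    refine ((h2.add (h1.mul_left 2)).add h0).congr fun v => ?_
    rw [inv_pow]
    ring
  have hnn : ∀ v : ℕ, 0 ≤ ((v : ℝ) + 1) ^ 2 / root ^ v := fun v =>
    div_nonneg (by positivity) (pow_nonneg root_pos.le _)
  refine ⟨(∑' v : ℕ, ((v : ℝ) + 1) ^ 2 / root ^ v) + 1,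
    add_pos_of_nonneg_of_pos (tsum_nonneg hnn) one_pos, fun u => ?_⟩
  exact (hs.sum_le_tsum _ fun v _ => hnn v).trans (by linarith)

theorem weight_mono {u v : ℕ} (h : u ≤ v) : weight u ≤ weight v := by
  refine Finset.sum_le_sum_of_subset_of_nonneg (Finset.range_mono (by omega)) fun w _ _ => ?_
  exact div_nonneg (by positivity) (pow_nonneg root_pos.le _)

theorem weight_nonneg (u : ℕ) : 0 ≤ weight u :=
  Finset.sum_nonneg fun w _ => div_nonneg (by positivity) (pow_nonneg root_pos.le _)

theorem weight_succ (u : ℕ) :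
    root ^ (u + 1) * weight (u + 1) = root ^ (u + 1) * weight u + ((u : ℝ) + 2) ^ 2 := by
  have : root ^ (u + 1) ≠ 0 := pow_ne_zero _ root_pos.ne'
  rw [weight, Finset.sum_range_succ, ← weight, mul_add, mul_div_cancel₀ _ this]
  push_cast
  ring

theorem sq_le_root_pow (u : ℕ) : ((u : ℝ) + 1) ^ 2 ≤ root ^ u * weight u := by
  have hp : 0 < root ^ u := pow_pos root_pos _
  have : ((u : ℝ) + 1) ^ 2 / root ^ u ≤ weight u :=
    Finset.single_le_sum (f := fun v : ℕ => ((v : ℝ) + 1) ^ 2 / root ^ v)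
      (fun w _ => div_nonneg (by positivity) (pow_nonneg root_pos.le _))
      (Finset.mem_range.2 (Nat.lt_succ_self u))
  rwa [div_le_iff₀ hp, mul_comm] at this

end MinModels

/-! ### Memory layout -/

-- The numbers of atoms and of pairs of literals in memory.
notation "vN" => 0
notation "vQ" => 1
-- Loop counters: `vI` and `vT` run over the atoms, `vJ` runs over the pairs.
notation "vI" => 2
notation "vT" => 3
notation "vJ" => 4
-- An atom; a count; the best count so far and its atom; a supported atom; the undecided atoms.
notation "vZ" => 5
notation "vR" => 6
notation "vBr" => 7
notation "vBz" => 8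
notation "vF" => 9
notation "vU" => 10
-- The stack pointer; an auxiliary pointer; the number of valuations on the stack; a flag.
notation "vSp" => 11
notation "vW" => 12
notation "vCnt" => 13
notation "vBad" => 14
-- The reader: its position in the input; the number of literals read in the current clause; the
-- first and the last of them; the kind of the literal to be read; the size of a list and a loop
-- counter; the number of clauses, the number of clauses read, and a flag.
notation "vPos" => 15
notation "vLen" => 16
notation "rK1" => 17
notation "rX1" => 18
notation "rK2" => 19
notation "rX2" => 20
notation "vKind" => 21
notation "vSize" => 22
notation "vRead" => 23
notation "vAll" => 24
notation "vDone" => 25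
notation "vOk" => 26
-- The input; marks of the atoms seen; the list of atoms.
notation "aIn" => 0
notation "aSeen" => 1
notation "aName" => 2
-- The pairs of literals, each literal given by its kind and its atom.
notation "aK1" => 3
notation "aX1" => 4
notation "aK2" => 5
notation "aX2" => 6
-- All other arrays but the stack are indexed by atoms: marks for forward and backward search,
-- representatives, the current valuation, a valuation under construction, the marks that tell where
-- to branch, and marks of supported atoms.
notation "aF" => 7
notation "aB" => 8
notation "aRep" => 9
notation "aVal" => 10
notation "aStk" => 11
notation "aTmp" => 12
notation "aNb" => 13
notation "aSup" => 14

infixr:60 " ;; " => MinModels.Cmd.seq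

namespace MinModels

notation "jK1" => Expr.get aK1 (Expr.var vJ)
notation "jX1" => Expr.get aX1 (Expr.var vJ)
notation "jK2" => Expr.get aK2 (Expr.var vJ)
notation "jX2" => Expr.get aX2 (Expr.var vJ)
notation "tName" => Expr.get aName (Expr.var vT)
notation "iName" => Expr.get aName (Expr.var vI)
notation "inNext" => Expr.get aIn (Expr.var vPos)

/-- The memory holds the instance `D`. -/
structure Has (D : Data) (s : State) : Prop where
  n : s.vars vN = D.n
  q : s.vars vQ = D.q
  name : s.arrays aName = D.name
  k1 : s.arrays aK1 = D.k1
  x1 : s.arrays aX1 = D.x1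
  k2 : s.arrays aK2 = D.k2
  x2 : s.arrays aX2 = D.x2

theorem Has.frame {D : Data} {s s' : State} {p : Cmd} (h : Has D s) (hf : Frame p s s')
    (hv : ∀ x ∈ [vN, vQ], x ∉ p.wv) (ha : ∀ A ∈ [aName, aK1, aX1, aK2, aX2], A ∉ p.wa) :
    Has D s' := by
  constructor
  · rw [hf.var _ (hv _ (by simp)), h.n]
  · rw [hf.var _ (hv _ (by simp)), h.q]
  · rw [hf.arr _ (ha _ (by simp)), h.name]
  · rw [hf.arr _ (ha _ (by simp)), h.k1]
  · rw [hf.arr _ (ha _ (by simp)), h.x1]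
  · rw [hf.arr _ (ha _ (by simp)), h.k2]
  · rw [hf.arr _ (ha _ (by simp)), h.x2]

/-- The unit in which running times are measured. -/
def Data.m (D : Data) : ℕ := D.n + D.q + 1

theorem exists_lt_succ {P : ℕ → Prop} {k : ℕ} :
    (∃ j < k + 1, P j) ↔ (∃ j < k, P j) ∨ P k := by
  constructor
  · rintro ⟨j, hj, h⟩
    rcases Nat.lt_succ_iff_lt_or_eq.1 hj with hj | rfl
    · exact .inl ⟨j, hj, h⟩
    · exact .inr h
  · rintro (⟨j, hj, h⟩ | h)
    · exact ⟨j, by omega, h⟩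
    · exact ⟨k, by omega, h⟩

/-! ### Elementary loops over the names and the pairs -/

/-- Copies array `B` to array `A`, at the names. -/
def copyC (A B : ℕ) : Cmd := forC vT vN (.store A tName (.get B tName))

theorem copyC_spec (A B : ℕ) (hAB : B ≠ A) (hA : aName ≠ A) :
    ∃ C, ∀ (D : Data) (s : State), Has D s →
    Run (copyC A B) s (C * D.m)
      (fun s' => ∀ i < D.n, s'.arrays A (D.name i) = s.arrays B (D.name i)) := by
  refine ⟨_, fun D s hs => (forC_straight
    (I := fun k s' => ∀ i < k, s'.arrays A (D.name i) = s.arrays B (D.name i))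
    rfl (by simp [Cmd.wv]) (by simp [Cmd.wv]) (by decide) (by simp) ?_).mono
      (Nat.mul_le_mul_left _ (by simp only [hs.n, Data.m]; omega))
      fun s' _ h => by rwa [hs.n] at h⟩
  intro k s' hk hi hf hI i hik
  have e1 : s'.arrays aName = D.name := by
    rw [hf.arr aName (by simpa [forC, Cmd.wa] using hA), hs.name]
  have e2 : s'.arrays B = s.arrays B := hf.arr B (by simpa [forC, Cmd.wa] using hAB)
  simp only [Cmd.run, Expr.eval, State.setVar, Function.update_self, e1, e2, hi]
  by_cases h : D.name i = D.name k
  · rw [h, Function.update_self]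
  · rw [Function.update_of_ne h]
    exact hI i (lt_of_le_of_ne (by omega) fun h' => h (h' ▸ rfl))

/-- Sets `r` to the number of names at which the array `A` is zero. -/
def countC (A r : ℕ) : Cmd :=
  .assign r (.const 0) ;; forC vT vN
    (.ite (.eq (.get A tName) (.const 0)) (.assign r (.succ (.var r))) .skip)

theorem countC_spec (A r : ℕ) (h1 : r ≠ vN) (h2 : r ≠ vT) : ∃ C, ∀ (D : Data) (s : State), Has D s →
    Run (countC A r) s (C * D.m) (fun s' => s'.vars r = (D.free (s.arrays A)).card) := by
  set body : Cmd := .ite (.eq (.get A tName) (.const 0)) (.assign r (.succ (.var r))) .skip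
    with hbody
  refine ⟨2 + (body.maxCost + 7), fun D s hs => ?_⟩
  refine ((Run.straight (p := .assign r (.const 0)) (Q := fun s' => s'.vars r = 0) rfl
    (by simp [Cmd.run, Expr.eval])).seq fun s₁ hf₁ hr => ?_).mono
      (T := 2 + (body.maxCost + 7) * (D.n + 1))
      ?_ fun _ _ h => h
  rotate_left
  · simp only [Data.m]; nlinarith [Nat.zero_le body.maxCost]
  have e0 : s₁.vars vN = D.n := by rw [hf₁.var vN (by simpa [Cmd.wv] using h1.symm), hs.n]
  have e1 : s₁.arrays = s.arrays := funext fun B => hf₁.arr B (by simp [Cmd.wa])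
  have := forC_straight (i := vT) (b := vN) (body := body) (s := s₁)
    (I := fun k s' => s'.vars r = ((Finset.range k).filter fun i => s.arrays A (D.name i) = 0).card)
    rfl (by simpa [hbody, Cmd.wv] using h2.symm) (by simpa [hbody, Cmd.wv] using h1.symm)
    (by decide)
    (by simpa [State.setVar_ne _ _ h2] using hr) ?_
  · rw [e0] at this
    exact this
  · intro k s' hk hi hf hI
    have e2 : s'.arrays = s.arrays := by
      rw [← e1]; exact funext fun B => hf.arr B (by simp [forC, Cmd.wa, hbody])
    rw [State.setVar_ne _ _ h2, Finset.range_add_one, Finset.filter_insert]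
    by_cases hc : s.arrays A (D.name k) = 0
    · simp [hbody, Cmd.run, Test.eval, Expr.eval, e2, hi, hs.name, hc, hI]
    · simp [hbody, Cmd.run, Test.eval, Expr.eval, e2, hi, hs.name, hc, hI]

/-- Stores the child of the current valuation at `z` in the array `aTmp`. -/
def childC : Cmd :=
  copyC aTmp aVal ;; .store aTmp (.var vZ) (.const 2) ;; forC vJ vQ
    (.ite (.and (.and (.eq jK1 (.const 3)) (.eq jX1 (.var vZ)))
        (.and (.not (.eq jK2 (.const 1))) (.eq (.get aTmp jX2) (.const 0))))
      (.store aTmp jX2 (.const 1)) .skip)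

theorem ite_ite_or_right {p e c : Prop} {v : ℕ} [Decidable p] [Decidable (v = 0 ∧ e)]
    [Decidable (v = 0 ∧ (e ∨ c))] (h : ¬ p → v = 0 → ¬ e → ¬ c) :
    (if p then 2 else if v = 0 ∧ e then 1 else v) =
      if p then 2 else if v = 0 ∧ (e ∨ c) then 1 else v := by
  grind

open Classical in
theorem childC_spec : ∃ C, ∀ (D : Data) (s : State), D.Ok → Has D s →
    Run childC s (C * D.m) (fun s' => ∀ i < D.n,
      s'.arrays aTmp (D.name i) = D.child (s.arrays aVal) (s.vars vZ) (D.name i)) := by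
  obtain ⟨C₁, h₁⟩ := copyC_spec aTmp aVal (by decide) (by decide)
  set body : Cmd := (.ite (.and (.and (.eq jK1 (.const 3)) (.eq jX1 (.var vZ)))
        (.and (.not (.eq jK2 (.const 1))) (.eq (.get aTmp jX2) (.const 0))))
      (.store aTmp jX2 (.const 1)) .skip) with hbody
  refine ⟨C₁ + (3 + (body.maxCost + 7)), fun D s hD hs => ?_⟩
  refine ((h₁ D s hs).seq (U := 3 + (body.maxCost + 7) * (D.q + 1)) fun s₁ hf₁ hs₁ => ?_).mono ?_
    fun _ _ h => h
  rotate_left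
  · simp only [Data.m]; nlinarith [Nat.zero_le body.maxCost]
  have H₁ := hs.frame hf₁ (by decide) (by decide)
  have ez₁ : s₁.vars vZ = s.vars vZ := hf₁.var vZ (by decide)
  set σ := s.arrays aVal with hσ
  set z := s.vars vZ with hz
  refine (Run.straight (Q := fun s' => ∀ i < D.n,
    s'.arrays aTmp (D.name i) = if D.name i = z then 2 else σ (D.name i)) rfl ?_).seq
    fun s₂ hf₂ hs₂ => ?_
  · intro i hi
    simp [Cmd.run, Expr.eval, Function.update_apply, ez₁, hs₁ i hi]
  have H₂ := H₁.frame hf₂ (by decide) (by decide)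
  have ez₂ : s₂.vars vZ = z := by rw [hf₂.var vZ (by decide), ez₁]
  refine (forC_straight (I := fun k s' => ∀ i < D.n, s'.arrays aTmp (D.name i) =
      if D.name i = z then 2 else if σ (D.name i) = 0 ∧ (∃ j < k, D.k1 j = 3 ∧
        D.x1 j = z ∧ D.k2 j ≠ 1 ∧ D.x2 j = D.name i) then 1 else σ (D.name i))
    rfl (by decide) (by decide) (by decide) (by simpa using hs₂) ?_).mono (by rw [H₂.q])
    fun s' _ h => ?_
  · intro k s' hk hi hf hI i hin
    have H := H₂.frame hf (by decide) (by decide)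
    have ez : s'.vars vZ = z := by rw [hf.var vZ (by decide), ez₂]
    obtain ⟨i', hi', hx⟩ := hD.mem2 k (by rwa [H₂.q] at hk)
    have hI' := hI i' hi'
    have hIi := hI i hin
    simp only [hx] at hI'
    simp only [State.setVar_arrays, exists_lt_succ]
    by_cases hc : (D.k1 k = 3 ∧ D.x1 k = z) ∧ ¬ D.k2 k = 1 ∧ s'.arrays aTmp (D.x2 k) = 0
    · have : (body.run s').arrays aTmp = Function.update (s'.arrays aTmp) (D.x2 k) 1 := by
        simp [hbody, Cmd.run, Test.eval, Expr.eval, hi, ez, H.k1, H.x1, H.k2, H.x2, hc]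
      rw [← hbody, this]
      obtain ⟨⟨h1, h2⟩, h3, h4⟩ := hc
      by_cases hx2 : D.name i = D.x2 k
      · rw [hx2, Function.update_self]
        rw [h4] at hI'
        split_ifs at hI' with g1 g2
        simp [g1, ← hI', h1, h2, h3]
      · rw [Function.update_of_ne hx2, hIi]
        simp [Ne.symm hx2]
    · have : (body.run s').arrays aTmp = s'.arrays aTmp := by
        simp [hbody, Cmd.run, Test.eval, Expr.eval, hi, ez, H.k1, H.x1, H.k2, H.x2, hc]
      rw [← hbody, this, hIi]
      refine ite_ite_or_right fun g1 g2 g3 g4 => hc ⟨⟨g4.1, g4.2.1⟩, g4.2.2.1, ?_⟩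
      rw [g4.2.2.2, hIi, if_neg g1, if_neg fun h => g3 h.2, g2]
  · rw [H₂.q] at h
    intro i hi
    simp only [h i hi, Data.child, Data.Nb]
    congr

end MinModels

namespace MinModels

/-! ### Walking up the implications -/

/-- Replaces `z` by an undecided atom that implies it, as often as a scan of the pairs permits. -/
def walkScan : Cmd := forC vJ vQ
  (.ite (.and (.and (.eq jK1 (.const 3)) (.eq jX1 (.var vZ)))
      (.and (.and (.eq jK2 (.const 1)) (.not (.eq jX2 (.var vZ))))
        (.eq (.get aVal jX2) (.const 0))))
    (.assign vZ jX2) .skip)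

/-- The atom `z` is one of the names and undecided. -/
def Data.IsFree (D : Data) (σ : ℕ → ℕ) (z : ℕ) : Prop := (∃ i < D.n, D.name i = z) ∧ σ z = 0

theorem walkScan_spec : ∃ C, ∀ (D : Data) (s : State) (rk : ℕ → ℕ), D.Ok → Has D s →
    (∀ a z, D.Imp a z → rk a < rk z) → D.IsFree (s.arrays aVal) (s.vars vZ) →
    Run walkScan s (C * D.m) (fun s' => D.IsFree (s.arrays aVal) (s'.vars vZ) ∧
      (∀ y, D.Forces (s.vars vZ) y → D.Forces (s'.vars vZ) y) ∧
      (s'.vars vZ = s.vars vZ ∧ D.Source (s.arrays aVal) (s.vars vZ) ∨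
        rk (s'.vars vZ) < rk (s.vars vZ) ∧ ¬ D.Source (s.arrays aVal) (s.vars vZ))) := by
  refine ⟨_, fun D s rk hD hs hrk hz => (forC_straight
    (I := fun k s' => D.IsFree (s.arrays aVal) (s'.vars vZ) ∧
      (∀ y, D.Forces (s.vars vZ) y → D.Forces (s'.vars vZ) y) ∧
      (s'.vars vZ = s.vars vZ ∧ (∀ j < k, D.k1 j = 3 → D.x1 j = s.vars vZ → D.k2 j = 1 →
          D.x2 j ≠ s.vars vZ → s.arrays aVal (D.x2 j) ≠ 0) ∨
        rk (s'.vars vZ) < rk (s.vars vZ) ∧ ¬ D.Source (s.arrays aVal) (s.vars vZ)))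
    rfl (by decide) (by decide) (by decide) ?_ ?_).mono
      (Nat.mul_le_mul_left _ (by simp only [hs.q, Data.m]; omega)) ?_⟩
  · rw [State.setVar_ne _ _ (by decide)]
    exact ⟨hz, fun _ h => h, .inl ⟨rfl, fun j hj => by omega⟩⟩
  · rintro k s' hk hi hf ⟨hfree, hforce, hI⟩
    rw [hs.q] at hk
    have H := hs.frame hf (by decide) (by decide)
    have eV : s'.arrays aVal = s.arrays aVal := hf.arr _ (by decide)
    rw [State.setVar_ne _ _ (by decide)]
    by_cases hc : (D.k1 k = 3 ∧ D.x1 k = s'.vars vZ) ∧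
        (D.k2 k = 1 ∧ ¬ D.x2 k = s'.vars vZ) ∧ s.arrays aVal (D.x2 k) = 0
    · have : ∀ p, Cmd.run (.ite (.and (.and (.eq jK1 (.const 3)) (.eq jX1 (.var vZ)))
          (.and (.and (.eq jK2 (.const 1)) (.not (.eq jX2 (.var vZ))))
            (.eq (.get aVal jX2) (.const 0)))) (.assign vZ jX2) p) s' = s'.setVar vZ (D.x2 k) := by
        intro p
        simp [Cmd.run, Test.eval, Expr.eval, hi, H.k1, H.x1, H.k2, H.x2, hc, eV, State.setVar]
      rw [this, State.setVar_self]
      obtain ⟨⟨h1, h2⟩, ⟨h3, h4⟩, h5⟩ := hc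
      have himp : D.Imp (D.x2 k) (s'.vars vZ) := ⟨k, hk, h1, h2, h3, rfl, h4⟩
      refine ⟨⟨hD.mem2 k hk, h5⟩, fun y hy => (hforce y hy).imp hD himp, .inr ⟨?_, ?_⟩⟩
      · rcases hI with ⟨he, -⟩ | ⟨hlt, -⟩
        · exact he ▸ hrk _ _ himp
        · exact (hrk _ _ himp).trans hlt
      · rcases hI with ⟨he, -⟩ | ⟨-, hns⟩
        · exact fun hsrc => hsrc _ h5 (he ▸ himp)
        · exact hns
    · have : ∀ p, Cmd.run (.ite (.and (.and (.eq jK1 (.const 3)) (.eq jX1 (.var vZ)))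
          (.and (.and (.eq jK2 (.const 1)) (.not (.eq jX2 (.var vZ))))
            (.eq (.get aVal jX2) (.const 0)))) p .skip) s' = s' := by
        intro p
        simp [Cmd.run, Test.eval, Expr.eval, hi, H.k1, H.x1, H.k2, H.x2, hc, eV]
      rw [this]
      refine ⟨hfree, hforce, hI.imp_left fun ⟨he, hI⟩ => ⟨he, fun j hj h1 h2 h3 h4 h5 => ?_⟩⟩
      rcases Nat.lt_succ_iff_lt_or_eq.1 hj with hj | rfl
      · exact hI j hj h1 h2 h3 h4 h5
      · rw [he] at hc
        exact hc ⟨⟨h1, h2⟩, ⟨h3, h4⟩, h5⟩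
  · rintro s' - ⟨hfree, hforce, hI⟩
    refine ⟨hfree, hforce, hI.imp_left fun ⟨he, hI⟩ => ⟨he, ?_⟩⟩
    rintro a ha ⟨j, hj, h1, h2, h3, rfl, h5⟩
    rw [hs.q] at hI
    exact hI j hj h1 h2 h3 h5 ha

/-- Replaces the undecided atom `z` by a source from which the implications lead to it. Each scan
moves to an atom of smaller rank, so as many scans suffice as there are undecided atoms. -/
def walkC : Cmd := forC vT vN (.ite (.eq (.get aVal tName) (.const 0)) walkScan .skip)

theorem walkC_spec : ∃ C, ∀ (D : Data) (s : State), D.Ok → Has D s →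
    D.IsFree (s.arrays aVal) (s.vars vZ) →
    Run walkC s (C * D.m * ((D.free (s.arrays aVal)).card + 1)) (fun s' =>
      D.IsFree (s.arrays aVal) (s'.vars vZ) ∧ D.Forces (s'.vars vZ) (s.vars vZ) ∧
      D.Source (s.arrays aVal) (s'.vars vZ) ∧
      (D.Source (s.arrays aVal) (s.vars vZ) → s'.vars vZ = s.vars vZ)) := by
  classical
  obtain ⟨C, hC⟩ := walkScan_spec
  refine ⟨C + 15, fun D s hD hs hz => ?_⟩
  obtain ⟨rk, hrk⟩ := hD.rank
  set σ := s.arrays aVal with hσ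
  set below : ℕ → ℕ := fun z => ((D.free σ).filter fun i => rk (D.name i) < rk z).card with hbelow
  have hbelow_lt : ∀ z z', D.IsFree σ z' → rk z' < rk z → below z' < below z := by
    rintro z z' ⟨⟨i, hi, rfl⟩, h0⟩ hlt
    refine Finset.card_lt_card ⟨fun j hj => ?_, fun hsub => ?_⟩
    · rw [Finset.mem_filter] at hj ⊢
      exact ⟨hj.1, hj.2.trans hlt⟩
    · have := hsub (Finset.mem_filter.2 ⟨Data.mem_free.2 ⟨hi, h0⟩, hlt⟩)
      exact lt_irrefl _ (Finset.mem_filter.1 this).2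
  have hbelow_card : ∀ z, D.IsFree σ z → below z < (D.free σ).card := by
    rintro z ⟨⟨i, hi, rfl⟩, h0⟩
    refine Finset.card_lt_card ⟨Finset.filter_subset _ _, fun hsub => ?_⟩
    exact lt_irrefl _ (Finset.mem_filter.1 (hsub (Data.mem_free.2 ⟨hi, h0⟩))).2
  refine (forC_guard (I := fun k s' => D.IsFree σ (s'.vars vZ) ∧ D.Forces (s'.vars vZ) (s.vars vZ) ∧
      (D.Source σ (s.vars vZ) → s'.vars vZ = s.vars vZ) ∧
      (D.Source σ (s'.vars vZ) ∨
        below (s'.vars vZ) + ((D.free σ).filter fun i => i < k).card < (D.free σ).card))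
    (D.free σ) (C * D.m) (by decide) (by decide) (by decide) ?_ ?_ ?_).mono ?_ ?_
  · rw [State.setVar_ne _ _ (by decide)]
    exact ⟨hz, fun _ _ h => h, fun _ => rfl, .inr (by simpa using hbelow_card _ hz)⟩
  · rintro k s' hk hi hf ⟨hfree, hforce, hsrc, hI⟩ hg
    have H := hs.frame hf (by decide) (by decide)
    have eV : s'.arrays aVal = σ := hf.arr _ (by decide)
    rw [hs.n] at hk
    simp only [Test.eval, Expr.eval, H.name, eV, hi] at hg
    refine ⟨Data.mem_free.2 ⟨hk, hg⟩, (hC D s' rk hD H hrk (by rwa [eV])).mono le_rfl ?_⟩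
    rw [eV]
    rintro s'' - ⟨hfree', hforce', hI'⟩
    rw [State.setVar_ne _ _ (by decide)]
    refine ⟨hfree', hforce' _ hforce, fun h => ?_, ?_⟩
    · have h' := hsrc h
      rcases hI' with ⟨he, -⟩ | ⟨-, hns⟩
      · rw [he, h']
      · exact absurd (h' ▸ h) hns
    · rcases hI' with ⟨he, h⟩ | ⟨hlt, hns⟩
      · exact .inl (he ▸ h)
      · refine .inr ?_
        have h1 := hI.resolve_left hns
        have h2 := hbelow_lt _ _ hfree' hlt
        have h3 : ((D.free σ).filter fun i => i < k + 1).card ≤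
            ((D.free σ).filter fun i => i < k).card + 1 := by
          refine (Finset.card_le_card (t := insert k ((D.free σ).filter fun i => i < k)) ?_).trans
            (Finset.card_insert_le _ _)
          intro i hi
          rw [Finset.mem_filter] at hi
          rw [Finset.mem_insert, Finset.mem_filter]
          rcases Nat.lt_succ_iff_lt_or_eq.1 hi.2 with h | h
          · exact .inr ⟨hi.1, h⟩
          · exact .inl h
        omega
  · rintro k s' hk hi hf ⟨hfree, hforce, hsrc, hI⟩ hg
    have H := hs.frame hf (by decide) (by decide)
    have eV : s'.arrays aVal = σ := hf.arr _ (by decide)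
    simp only [Test.eval, Expr.eval, H.name, eV, hi] at hg
    rw [State.setVar_ne _ _ (by decide)]
    refine ⟨hfree, hforce, hsrc, hI.imp_right fun h => ?_⟩
    have : ((D.free σ).filter fun i => i < k + 1) = (D.free σ).filter fun i => i < k := by
      refine Finset.filter_congr fun i hi => ⟨fun h => ?_, fun h => by omega⟩
      refine lt_of_le_of_ne (by omega) fun h' => hg ?_
      exact h' ▸ (Data.mem_free.1 hi).2
    rwa [this]
  · simp only [hs.n, Test.cost, Expr.cost]
    have : D.n + 1 ≤ D.m := by simp [Data.m]
    nlinarith [Nat.zero_le ((D.free σ).card * D.m)]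
  · rintro s' - ⟨hfree, hforce, hsrc, hI⟩
    refine ⟨hfree, hforce, hI.resolve_right fun h => ?_, hsrc⟩
    have : ((D.free σ).filter fun i => i < s.vars vN) = D.free σ := by
      refine Finset.filter_true_of_mem fun i hi => ?_
      rw [hs.n]
      exact (Data.mem_free.1 hi).1
    rw [this] at h
    omega

end MinModels

namespace MinModels

/-! ### Supported atoms and violated clauses -/

/-- The literal of kind `k` with atom `x` is false. -/
def litFalseT (k x : Expr) : Test :=
  .or (.and (.eq k (.const 1)) (.eq (.get aVal x) (.const 1)))
    (.and (.not (.eq k (.const 1))) (.eq (.get aVal x) (.const 2)))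

theorem litFalseT_eval (s : State) (k x : Expr) :
    (litFalseT k x).eval s ↔ litFalse (k.eval s) (s.arrays aVal (x.eval s)) := by
  simp [litFalseT, Test.eval_or, Test.eval, Expr.eval, litFalse]

/-- The pair `j` supports its first literal. -/
def supT : Test :=
  .and (.eq jK1 (.const 3)) (.or (.and (.not (.eq jX1 jX2)) (litFalseT jK2 jX2))
    (.and (.eq jX1 jX2) (.eq jK2 (.const 3))))

theorem supT_eval {D : Data} {s : State} (hs : Has D s) :
    supT.eval s ↔ D.SupAt (s.arrays aVal) (s.vars vJ) := by
  simp [supT, Test.eval_or, Test.eval, Expr.eval, litFalseT_eval, Data.SupAt, hs.k1, hs.k2, hs.x1,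
    hs.x2]

/-- Marks the supported atoms in the array `aSup`. -/
def supC : Cmd :=
  forC vT vN (.store aSup tName (.const 0)) ;;
    forC vJ vQ (.ite supT (.store aSup jX1 (.const 1)) .skip)

theorem supC_spec : ∃ C, ∀ (D : Data) (s : State), Has D s →
    Run supC s (C * D.m) (fun s' => ∀ i < D.n,
      (s'.arrays aSup (D.name i) ≠ 0 ↔ D.Sup (s.arrays aVal) (D.name i))) := by
  set body₁ : Cmd := .store aSup tName (.const 0) with hb₁
  set body₂ : Cmd := .ite supT (.store aSup jX1 (.const 1)) .skip with hb₂
  refine ⟨(body₁.maxCost + 7) + (body₂.maxCost + 7), fun D s hs => ?_⟩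
  refine ((forC_straight (I := fun k s' => ∀ i < k, s'.arrays aSup (D.name i) = 0)
    rfl (by decide) (by decide) (by decide) (by simp) ?_).seq
      (U := (body₂.maxCost + 7) * (D.q + 1)) fun s₁ hf₁ hs₁ => ?_).mono ?_ fun _ _ h => h
  · intro k s' hk hi hf hI i hik
    have H := hs.frame hf (by decide) (by decide)
    simp only [Cmd.run, Expr.eval, State.setVar, Function.update_self, H.name, hi]
    by_cases h : D.name i = D.name k
    · rw [h, Function.update_self]
    · rw [Function.update_of_ne h]
      exact hI i (lt_of_le_of_ne (by omega) fun h' => h (h' ▸ rfl))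
  · rw [hs.n] at hs₁
    have H₁ := hs.frame hf₁ (by decide) (by decide)
    have eV₁ : s₁.arrays aVal = s.arrays aVal := hf₁.arr _ (by decide)
    refine (forC_straight (I := fun k s' => ∀ i < D.n, (s'.arrays aSup (D.name i) ≠ 0 ↔
      ∃ j < k, D.x1 j = D.name i ∧ D.SupAt (s.arrays aVal) j))
      rfl (by decide) (by decide) (by decide) (fun i hi => by simp [hs₁ i hi]) ?_).mono
        (by rw [H₁.q]) fun s' _ h => ?_
    · intro k s' hk hj hf hI i hi
      have H := H₁.frame hf (by decide) (by decide)
      have eV : s'.arrays aVal = s.arrays aVal := by rw [hf.arr _ (by decide), eV₁]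
      have hT := supT_eval H
      rw [hj, eV] at hT
      rw [State.setVar_arrays, exists_lt_succ]
      by_cases hc : D.SupAt (s.arrays aVal) k
      · have : (body₂.run s').arrays aSup = Function.update (s'.arrays aSup) (D.x1 k) 1 := by
          simp [hb₂, Cmd.run, hT.2 hc, Expr.eval, H.x1, hj]
        rw [this, Function.update_apply]
        split_ifs with h
        · simp [h, hc]
        · rw [hI i hi]
          simp [Ne.symm h]
      · have : (body₂.run s').arrays aSup = s'.arrays aSup := by
          simp [hb₂, Cmd.run, hT, hc]
        rw [this, hI i hi]
        simp [hc]
    · rw [H₁.q] at h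
      exact h
  · rw [hs.n]
    simp only [Data.m]
    nlinarith [Nat.zero_le body₁.maxCost, Nat.zero_le body₂.maxCost]

/-- Sets the variable `vBad` to a positive number unless the current valuation is good. -/
def checkC : Cmd :=
  .assign vBad (.const 0) ;;
  forC vJ vQ
    (.ite (.and (litFalseT jK1 jX1) (litFalseT jK2 jX2)) (.assign vBad (.const 1)) .skip) ;;
  forC vT vN (.ite (.and (.eq (.get aVal tName) (.const 1)) (.eq (.get aSup tName) (.const 0)))
    (.assign vBad (.const 1)) .skip)

theorem checkC_spec : ∃ C, ∀ (D : Data) (s : State), Has D s →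
    Run checkC s (C * D.m) (fun s' => s'.vars vBad = 0 ↔ ¬ D.Viol (s.arrays aVal) ∧
      ∀ i < D.n, s.arrays aVal (D.name i) = 1 → s.arrays aSup (D.name i) ≠ 0) := by
  set body₁ : Cmd := (.ite (.and (litFalseT jK1 jX1) (litFalseT jK2 jX2))
    (.assign vBad (.const 1)) .skip) with hb₁
  set body₂ : Cmd := (.ite (.and (.eq (.get aVal tName) (.const 1))
    (.eq (.get aSup tName) (.const 0))) (.assign vBad (.const 1)) .skip) with hb₂
  refine ⟨2 + (body₁.maxCost + 7) + (body₂.maxCost + 7), fun D s hs => ?_⟩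
  set σ := s.arrays aVal with hσ
  refine ((Run.straight (Q := fun s' => s'.vars vBad = 0) rfl (by simp [Cmd.run, Expr.eval])).seq
    (U := (body₁.maxCost + 7) * (D.q + 1) + (body₂.maxCost + 7) * (D.n + 1))
    fun s₁ hf₁ hs₁ => ?_).mono ?_ fun _ _ h => h
  rotate_left
  · simp only [Data.m, Cmd.maxCost, Expr.cost]
    nlinarith [Nat.zero_le body₁.maxCost, Nat.zero_le body₂.maxCost]
  have H₁ := hs.frame hf₁ (by decide) (by decide)
  have eA₁ : s₁.arrays = s.arrays := funext fun B => hf₁.arr B (by simp [Cmd.wa])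
  refine ((forC_straight (I := fun k s' => s'.vars vBad = 0 ↔
      ¬ ∃ j < k, litFalse (D.k1 j) (σ (D.x1 j)) ∧ litFalse (D.k2 j) (σ (D.x2 j)))
    rfl (by decide) (by decide) (by decide) (by simp [State.setVar_ne, hs₁]) ?_).mono
      (by rw [H₁.q]) fun s' _ h => h).seq fun s₂ hf₂ hs₂ => ?_
  · intro k s' hk hj hf hI
    have H := H₁.frame hf (by decide) (by decide)
    have eV : s'.arrays aVal = σ := by rw [hf.arr _ (by decide), eA₁]
    rw [State.setVar_ne _ _ (by decide), exists_lt_succ]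
    by_cases hc : litFalse (D.k1 k) (σ (D.x1 k)) ∧ litFalse (D.k2 k) (σ (D.x2 k))
    · simp [Cmd.run, Test.eval, litFalseT_eval, Expr.eval, H.k1, H.k2, H.x1, H.x2, hj, eV, hc]
    · have : body₁.run s' = s' := by
        simp only [hb₁, Cmd.run, Test.eval, litFalseT_eval, Expr.eval, H.k1, H.k2, H.x1, H.x2, hj,
          eV, hc, if_false]
      rw [this, hI]
      simp only [hc, or_false]
  have H₂ := H₁.frame hf₂ (by decide) (by decide)
  have eA₂ : s₂.arrays = s.arrays := by
    rw [← eA₁]; exact funext fun B => hf₂.arr B (by simp [forC, Cmd.wa])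
  rw [H₁.q] at hs₂
  refine (forC_straight (I := fun k s' => s'.vars vBad = 0 ↔ ¬ D.Viol σ ∧
      ∀ i < k, σ (D.name i) = 1 → s.arrays aSup (D.name i) ≠ 0)
    rfl (by decide) (by decide) (by decide) ?_ ?_).mono (by rw [H₂.n]) fun s' _ h => ?_
  · rw [State.setVar_ne _ _ (by decide), hs₂]
    simp [Data.Viol]
  · intro k s' hk hj hf hI
    have H := H₂.frame hf (by decide) (by decide)
    have eA : s'.arrays = s.arrays := by
      rw [← eA₂]; exact funext fun B => hf.arr B (by simp [forC, Cmd.wa])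
    rw [State.setVar_ne _ _ (by decide)]
    by_cases hc : σ (D.name k) = 1 ∧ s.arrays aSup (D.name k) = 0
    · have : (body₂.run s').vars vBad = 1 := by
        simp [hb₂, Cmd.run, Test.eval, Expr.eval, hs.name, hj, eA, ← hσ, hc]
      rw [this]
      simp only [one_ne_zero, false_iff, not_and, not_forall]
      exact fun _ => ⟨k, by omega, hc.1, by simp [hc.2]⟩
    · have : body₂.run s' = s' := by
        simp [hb₂, Cmd.run, Test.eval, Expr.eval, hs.name, hj, eA, ← hσ, hc]
      rw [this, hI]
      refine and_congr_right fun _ => ⟨fun h i hi h1 => ?_, fun h i hi => h i (by omega)⟩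
      rcases Nat.lt_succ_iff_lt_or_eq.1 hi with hi | rfl
      · exact h i hi h1
      · exact fun h0 => hc ⟨h1, h0⟩
  · rw [H₂.n] at h
    exact h

/-! ### Output -/

/-- The atom `tName` belongs to the set that the current valuation describes. -/
def memT : Test := .eq (.get aVal (.get aRep tName)) (.const 1)

/-- Writes the set that the current valuation describes. -/
def emitC : Cmd :=
  .assign vR (.const 0) ;; forC vT vN (.ite memT (.assign vR (.succ (.var vR))) .skip) ;;
  .emit (.var vR) ;; forC vT vN (.ite memT (.emit tName) .skip)

/-- The list of the atoms that the valuation `σ` of the representatives makes true. -/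
def Data.outList (D : Data) (rep σ : ℕ → ℕ) (k : ℕ) : List ℕ :=
  ((List.range k).map D.name).filter fun a => σ (rep a) = 1

theorem Data.outList_succ (D : Data) (rep σ : ℕ → ℕ) (k : ℕ) : D.outList rep σ (k + 1) =
    D.outList rep σ k ++ if σ (rep (D.name k)) = 1 then [D.name k] else [] := by
  simp only [Data.outList, List.range_succ, List.map_append, List.filter_append, List.map_cons,
    List.map_nil]
  congr 1
  by_cases h : σ (rep (D.name k)) = 1 <;> simp [h]

theorem emitC_spec : ∃ C, ∀ (D : Data) (s : State), Has D s →
    Run emitC s (C * D.m) (fun s' => s'.output =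
      s.output ++ encodeList (D.outList (s.arrays aRep) (s.arrays aVal) D.n)) := by
  set body₁ : Cmd := .ite memT (.assign vR (.succ (.var vR))) .skip with hb₁
  set body₂ : Cmd := .ite memT (.emit tName) .skip with hb₂
  refine ⟨4 + (body₁.maxCost + 7) + (body₂.maxCost + 7), fun D s hs => ?_⟩
  set l := D.outList (s.arrays aRep) (s.arrays aVal) with hl
  have hT : ∀ s', Has D s' → s'.arrays = s.arrays →
      (memT.eval s' ↔ s.arrays aVal (s.arrays aRep (D.name (s'.vars vT))) = 1) := by
    intro s' H eA
    simp [memT, Test.eval, Expr.eval, H.name, eA]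
  refine ((Run.straight (Q := fun s' => s'.vars vR = 0) rfl (by simp [Cmd.run, Expr.eval])).seq
    (U := (body₁.maxCost + 7) * (D.n + 1) + (2 + (body₂.maxCost + 7) * (D.n + 1)))
    fun s₁ hf₁ hs₁ => ?_).mono ?_ fun _ _ h => h
  rotate_left
  · simp only [Data.m, Cmd.maxCost, Expr.cost]
    nlinarith [Nat.zero_le body₁.maxCost, Nat.zero_le body₂.maxCost]
  have H₁ := hs.frame hf₁ (by decide) (by decide)
  have eA₁ : s₁.arrays = s.arrays := funext fun B => hf₁.arr B (by simp [Cmd.wa])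
  have eO₁ : s₁.output = s.output := hf₁.out rfl
  refine ((forC_straight (I := fun k s' => s'.vars vR = (l k).length)
    rfl (by decide) (by decide) (by decide) (by simp [State.setVar_ne, hs₁, hl, Data.outList])
    ?_).mono (by rw [H₁.n]) fun s' _ h => h).seq fun s₂ hf₂ hs₂ => ?_
  · intro k s' hk hj hf hI
    have H := H₁.frame hf (by decide) (by decide)
    have eA : s'.arrays = s.arrays := by
      rw [← eA₁]; exact funext fun B => hf.arr B (by simp [forC, Cmd.wa])
    have hT' := hT s' H eA
    rw [hj] at hT'
    rw [State.setVar_ne _ _ (by decide), hl, Data.outList_succ, ← hl]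
    by_cases hc : memT.eval s'
    · simp [Cmd.run, hc, Expr.eval, hI, hT'.1 hc]
    · rw [hT'] at hc
      simp [Cmd.run, hT', hI, hc]
  have H₂ := H₁.frame hf₂ (by decide) (by decide)
  have eA₂ : s₂.arrays = s.arrays := by
    rw [← eA₁]; exact funext fun B => hf₂.arr B (by simp [forC, Cmd.wa])
  have eO₂ : s₂.output = s.output := by rw [hf₂.out rfl, eO₁]
  rw [H₁.n] at hs₂
  refine (Run.straight (p := .emit (.var vR))
    (Q := fun s' => s'.output = s.output ++ [(l D.n).length])
    rfl (by simp [Cmd.run, Expr.eval, hs₂, eO₂])).seq fun s₃ hf₃ hs₃ => ?_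
  have H₃ := H₂.frame hf₃ (by decide) (by decide)
  have eA₃ : s₃.arrays = s.arrays := by
    rw [← eA₂]; exact funext fun B => hf₃.arr B (by simp [Cmd.wa])
  refine (forC_straight (I := fun k s' => s'.output = s.output ++ (l D.n).length :: l k)
    rfl (by decide) (by decide) (by decide) (by simp [hs₃, hl, Data.outList]) ?_).mono
      (by rw [H₃.n]) fun s' _ h => ?_
  · intro k s' hk hj hf hI
    have H := H₃.frame hf (by decide) (by decide)
    have eA : s'.arrays = s.arrays := by
      rw [← eA₃]; exact funext fun B => hf.arr B (by simp [forC, Cmd.wa])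
    have hT' := hT s' H eA
    rw [hj] at hT'
    rw [State.setVar_output, hl, Data.outList_succ, ← hl]
    by_cases hc : memT.eval s'
    · simp [Cmd.run, hc, Expr.eval, hI, hT'.1 hc, H.name, hj]
    · rw [hT'] at hc
      simp [Cmd.run, hT', hI, hc]
  · rw [H₃.n] at h
    rw [h]
    rfl

/-! ### The stack of valuations -/

/-- The stack in memory holds the valuations `stk` (the top comes last), each as a block of `n`
values. -/
structure Stk (D : Data) (s : State) (stk : List (ℕ → ℕ)) : Prop where
  cnt : s.vars vCnt = stk.length
  sp : s.vars vSp = D.n * stk.length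
  val : ∀ b (hb : b < stk.length), ∀ i < D.n, s.arrays aStk (D.n * b + i) = stk[b] (D.name i)

theorem Stk.frame {D : Data} {s s' : State} {stk : List (ℕ → ℕ)} {p : Cmd} (h : Stk D s stk)
    (hf : Frame p s s') (hv : ∀ x ∈ [vCnt, vSp], x ∉ p.wv) (ha : aStk ∉ p.wa) : Stk D s' stk := by
  constructor
  · rw [hf.var _ (hv _ (by simp)), h.cnt]
  · rw [hf.var _ (hv _ (by simp)), h.sp]
  · rw [hf.arr _ ha]
    exact h.val

/-- Pushes the valuation in the array `aTmp`. -/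
def pushC : Cmd :=
  forC vT vN (.store aStk (.var vSp) (.get aTmp tName) ;; .assign vSp (.succ (.var vSp))) ;;
  .assign vCnt (.succ (.var vCnt))

theorem pushC_spec : ∃ C, ∀ (D : Data) (s : State) (stk : List (ℕ → ℕ)) (c : ℕ → ℕ), Has D s →
    Stk D s stk → (∀ i < D.n, s.arrays aTmp (D.name i) = c (D.name i)) →
    Run pushC s (C * D.m) (fun s' => Stk D s' (stk ++ [c])) := by
  set body : Cmd := (.store aStk (.var vSp) (.get aTmp tName) ;; .assign vSp (.succ (.var vSp)))
    with hb
  refine ⟨(body.maxCost + 7) + 3, fun D s stk c hs hstk hc => ?_⟩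
  refine ((forC_straight (I := fun k s' => s'.vars vSp = D.n * stk.length + k ∧
      (∀ b (hb : b < stk.length), ∀ i < D.n, s'.arrays aStk (D.n * b + i) = stk[b] (D.name i)) ∧
      ∀ i < k, s'.arrays aStk (D.n * stk.length + i) = c (D.name i))
    rfl (by decide) (by decide) (by decide) ?_ ?_).seq (U := 3) fun s₁ hf₁ hs₁ => ?_).mono ?_
      fun _ _ h => h
  · rw [State.setVar_ne _ _ (by decide)]
    exact ⟨by simp [hstk.sp], hstk.val, by simp⟩
  · rintro k s' hk hi hf ⟨hsp, hold, hnew⟩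
    rw [hs.n] at hk
    have H := hs.frame hf (by decide) (by decide)
    have eT : s'.arrays aTmp = s.arrays aTmp := hf.arr _ (by decide)
    have e1 : (body.run s').arrays aStk =
        Function.update (s'.arrays aStk) (D.n * stk.length + k) (c (D.name k)) := by
      simp [hb, Cmd.run, Expr.eval, hsp, H.name, hi, eT, hc k hk]
    have e2 : (body.run s').vars vSp = D.n * stk.length + (k + 1) := by
      simp [hb, Cmd.run, Expr.eval, hsp]; omega
    rw [State.setVar_ne _ _ (by decide), State.setVar_arrays, e1, e2]
    refine ⟨rfl, fun b hb i hi => ?_, fun i hi => ?_⟩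
    · have : D.n * b + D.n ≤ D.n * stk.length := by
        rw [← Nat.mul_succ]; exact Nat.mul_le_mul_left _ hb
      rw [Function.update_of_ne (by omega)]
      exact hold b hb i hi
    · rcases Nat.lt_succ_iff_lt_or_eq.1 hi with hi | rfl
      · rw [Function.update_of_ne (by omega)]
        exact hnew i hi
      · rw [Function.update_self]
  · obtain ⟨hsp, hold, hnew⟩ := hs₁
    rw [hs.n] at hsp hnew
    have ecnt : s₁.vars vCnt = stk.length := by rw [hf₁.var _ (by decide), hstk.cnt]
    refine Run.straight rfl ⟨?_, ?_, ?_⟩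
    · simp [Cmd.run, Expr.eval, ecnt]
    · simp [Cmd.run, hsp, Nat.mul_succ]
    · intro b hb i hi
      simp only [Cmd.run]
      rw [List.length_append, List.length_singleton] at hb
      rcases Nat.lt_succ_iff_lt_or_eq.1 hb with hb' | rfl
      · rw [List.getElem_append_left hb']
        exact hold b hb' i hi
      · simp [hnew i hi]
  · rw [hs.n]
    simp only [Data.m]
    nlinarith [Nat.zero_le body.maxCost]

/-- Pops a valuation into the array `aVal`. -/
def popC : Cmd :=
  .assign vCnt (.pred (.var vCnt)) ;;
  forC vT vN (.assign vSp (.pred (.var vSp))) ;;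
  .assign vW (.var vSp) ;;
  forC vT vN (.store aVal tName (.get aStk (.var vW)) ;; .assign vW (.succ (.var vW)))

theorem popC_spec : ∃ C, ∀ (D : Data) (s : State) (stk : List (ℕ → ℕ)) (σ : ℕ → ℕ), D.Ok → Has D s →
    Stk D s (stk ++ [σ]) →
    Run popC s (C * D.m) (fun s' => Stk D s' stk ∧
      ∀ i < D.n, s'.arrays aVal (D.name i) = σ (D.name i)) := by
  set body₁ : Cmd := .assign vSp (.pred (.var vSp)) with hb₁
  set body₂ : Cmd := (.store aVal tName (.get aStk (.var vW)) ;; .assign vW (.succ (.var vW)))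
    with hb₂
  refine ⟨3 + (body₁.maxCost + 7) + 2 + (body₂.maxCost + 7), fun D s stk σ hD hs hstk => ?_⟩
  have hlen : (stk ++ [σ]).length = stk.length + 1 := by simp
  have hcnt := hstk.cnt
  have hsp := hstk.sp
  rw [hlen] at hcnt hsp
  refine ((Run.straight (Q := fun s' => s'.vars vCnt = stk.length) rfl
    (by simp [Cmd.run, Expr.eval, hcnt])).seq
    (U := (body₁.maxCost + 7) * (D.n + 1) + (2 + (body₂.maxCost + 7) * (D.n + 1)))
    fun s₁ hf₁ hs₁ => ?_).mono ?_ fun _ _ h => h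
  rotate_left
  · simp only [Data.m, Cmd.maxCost, Expr.cost]
    nlinarith [Nat.zero_le body₁.maxCost, Nat.zero_le body₂.maxCost]
  have H₁ := hs.frame hf₁ (by decide) (by decide)
  refine ((forC_straight (I := fun k s' => s'.vars vSp + k = D.n * (stk.length + 1))
    rfl (by decide) (by decide) (by decide)
    (by rw [State.setVar_ne _ _ (by decide), hf₁.var _ (by decide), hsp]; rfl) ?_).mono
      (by rw [H₁.n]) fun s' _ h => h).seq fun s₂ hf₂ hs₂ => ?_
  · intro k s' hk hi hf hI
    rw [State.setVar_ne _ _ (by decide)]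
    have : k < D.n * (stk.length + 1) := lt_of_lt_of_le (by rwa [H₁.n] at hk)
      (Nat.le_mul_of_pos_right _ (Nat.succ_pos _))
    simp only [Cmd.run, Expr.eval, Function.update_self]
    omega
  have H₂ := H₁.frame hf₂ (by decide) (by decide)
  rw [H₁.n, Nat.mul_succ] at hs₂
  have hsp₂ : s₂.vars vSp = D.n * stk.length := by omega
  have hcnt₂ : s₂.vars vCnt = stk.length := by rw [hf₂.var _ (by decide), hs₁]
  have eS₂ : s₂.arrays aStk = s.arrays aStk := by
    rw [hf₂.arr _ (by decide), hf₁.arr _ (by decide)]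
  refine (Run.straight (Q := fun s' => s'.vars vW = D.n * stk.length) rfl
    (by simp [Cmd.run, Expr.eval, hsp₂])).seq fun s₃ hf₃ hs₃ => ?_
  have H₃ := H₂.frame hf₃ (by decide) (by decide)
  have eS₃ : s₃.arrays aStk = s.arrays aStk := by rw [hf₃.arr _ (by decide), eS₂]
  refine (forC_straight (I := fun k s' => s'.vars vW = D.n * stk.length + k ∧
      ∀ i < k, s'.arrays aVal (D.name i) = σ (D.name i))
    rfl (by decide) (by decide) (by decide) ?_ ?_).mono (by rw [H₃.n]) fun s' hf h => ?_
  · rw [State.setVar_ne _ _ (by decide)]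
    exact ⟨hs₃, by simp⟩
  · rintro k s' hk hi hf ⟨hw, hI⟩
    rw [H₃.n] at hk
    have H := H₃.frame hf (by decide) (by decide)
    have eS : s'.arrays aStk = s.arrays aStk := by rw [hf.arr _ (by decide), eS₃]
    have hv := hstk.val stk.length (by simp) k hk
    rw [List.getElem_concat_length rfl] at hv
    have e1 : (body₂.run s').arrays aVal =
        Function.update (s'.arrays aVal) (D.name k) (σ (D.name k)) := by
      simp [hb₂, Cmd.run, Expr.eval, H.name, hi, hw, eS, hv]
    have e2 : (body₂.run s').vars vW = D.n * stk.length + (k + 1) := by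
      simp [hb₂, Cmd.run, Expr.eval, hw]; omega
    rw [State.setVar_ne _ _ (by decide), State.setVar_arrays, e1, e2]
    refine ⟨rfl, fun i hi => ?_⟩
    by_cases h : D.name i = D.name k
    · rw [h, Function.update_self]
    · rw [Function.update_of_ne h]
      exact hI i (lt_of_le_of_ne (by omega) fun h' => h (h' ▸ rfl))
  · rw [H₃.n] at h
    refine ⟨⟨?_, ?_, ?_⟩, h.2⟩
    · rw [hf.var _ (by decide), hf₃.var _ (by decide), hcnt₂]
    · rw [hf.var _ (by decide), hf₃.var _ (by decide), hsp₂]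
    · intro b hb i hi
      rw [hf.arr _ (by decide), eS₃, hstk.val b (by rw [hlen]; omega) i hi,
        List.getElem_append_left hb]

end MinModels

namespace MinModels

/-! ### Processing one valuation -/

/-- The values of `σ` are `0`, `1` and `2`. -/
def Data.Three (D : Data) (σ : ℕ → ℕ) : Prop := ∀ i < D.n, σ (D.name i) ≤ 2

theorem Data.Three.child {D : Data} {σ : ℕ → ℕ} (h : D.Three σ) (z : ℕ) :
    D.Three (D.child σ z) := by
  intro i hi
  have := h i hi
  unfold Data.child
  split_ifs <;> omega

/-- The valuations `ch` are the branches of `σ`: there are at most as many of them as atoms that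
each of them decides, and together they cover the good extensions of `σ`. -/
def Branches (D : Data) (σ : ℕ → ℕ) (ch : List (ℕ → ℕ)) : Prop :=
  ∃ r, (∀ c ∈ ch, (D.free c).card ≤ r ∧ (D.Three σ → D.Three c)) ∧ ch.length + r ≤ (D.free σ).card ∧
    ∀ τ, D.Good τ → D.Ext σ τ → ∃ c ∈ ch, D.Ext c τ

/-- The output `outs` consists of sets described by good valuations, and contains those described by
good extensions of `σ`. -/
def Outs (D : Data) (rep σ : ℕ → ℕ) (outs : List (List ℕ)) : Prop :=
  (∀ l ∈ outs, ∃ τ, D.Good τ ∧ l = D.outList rep τ D.n) ∧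
    ∀ τ, D.Good τ → D.Ext σ τ → D.outList rep τ D.n ∈ outs

/-- Two valuations agree on the names. -/
def Data.Agree (D : Data) (σ σ' : ℕ → ℕ) : Prop := ∀ i < D.n, σ (D.name i) = σ' (D.name i)

section

variable {D : Data} {σ σ' : ℕ → ℕ}

theorem Data.Agree.free (h : D.Agree σ σ') : D.free σ = D.free σ' :=
  Finset.filter_congr fun i hi => by rw [h i (Finset.mem_range.1 hi)]

theorem Data.Agree.ext (h : D.Agree σ σ') {τ : ℕ → ℕ} (he : D.Ext σ' τ) : D.Ext σ τ := by
  intro i hi h0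
  rw [h i hi] at h0 ⊢
  exact he i hi h0

theorem Data.Agree.symm (h : D.Agree σ σ') : D.Agree σ' σ := fun i hi => (h i hi).symm

theorem Data.Agree.good (hD : D.Ok) (h : D.Agree σ σ') (hg : D.Good σ) : D.Good σ' := by
  have h1 : ∀ j < D.q, σ (D.x1 j) = σ' (D.x1 j) := fun j hj => by
    obtain ⟨i, hi, he⟩ := hD.mem1 j hj
    exact he ▸ h i hi
  have h2 : ∀ j < D.q, σ (D.x2 j) = σ' (D.x2 j) := fun j hj => by
    obtain ⟨i, hi, he⟩ := hD.mem2 j hj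
    exact he ▸ h i hi
  refine ⟨fun i hi => h i hi ▸ hg.total i hi, ?_, fun i hi h' => ?_⟩
  · rintro ⟨j, hj, g1, g2⟩
    exact hg.viol ⟨j, hj, h1 j hj ▸ g1, h2 j hj ▸ g2⟩
  · obtain ⟨j, hj, g1, g2, g3⟩ := hg.sup i hi (h i hi ▸ h')
    exact ⟨j, hj, g1, g2, by rwa [← h2 j hj]⟩

theorem Branches.congr (h : D.Agree σ σ') {ch : List (ℕ → ℕ)} (hb : Branches D σ' ch) :
    Branches D σ ch := by
  obtain ⟨r, h1, h2, h3⟩ := hb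
  refine ⟨r, fun c hc => ⟨(h1 c hc).1, fun h3 => (h1 c hc).2 fun i hi => h i hi ▸ h3 i hi⟩,
    h.free ▸ h2, fun τ hτ he => h3 τ hτ (h.symm.ext he)⟩

theorem Outs.congr {rep : ℕ → ℕ} (h : D.Agree σ σ') {outs : List (List ℕ)}
    (ho : Outs D rep σ' outs) : Outs D rep σ outs :=
  ⟨ho.1, fun τ hτ he => ho.2 τ hτ (h.symm.ext he)⟩

theorem Data.outList_congr {rep : ℕ → ℕ} (hrep : ∀ i < D.n, ∃ i' < D.n, D.name i' = rep (D.name i))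
    (h : D.Agree σ σ') : D.outList rep σ D.n = D.outList rep σ' D.n := by
  refine List.filter_congr fun a ha => ?_
  obtain ⟨i, hi, rfl⟩ := List.mem_map.1 ha
  obtain ⟨i', hi', he⟩ := hrep i (List.mem_range.1 hi)
  rw [← he, h i' hi']

end

/-- Sets `vF` to `x + 1` for some supported undecided atom `x`, and to `0` if there is none. -/
def forcedC : Cmd :=
  .assign vF (.const 0) ;; forC vI vN
    (.ite (.and (.eq (.get aVal iName) (.const 0)) (.not (.eq (.get aSup iName) (.const 0))))
      (.assign vF (.succ iName)) .skip)

theorem forcedC_spec : ∃ C, ∀ (D : Data) (s : State), Has D s →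
    Run forcedC s (C * D.m) (fun s' =>
      (s'.vars vF = 0 → ∀ i < D.n, s.arrays aVal (D.name i) = 0 → s.arrays aSup (D.name i) = 0) ∧
      (∀ x, s'.vars vF = x + 1 → D.IsFree (s.arrays aVal) x ∧ s.arrays aSup x ≠ 0)) := by
  set body : Cmd := (.ite (.and (.eq (.get aVal iName) (.const 0))
    (.not (.eq (.get aSup iName) (.const 0)))) (.assign vF (.succ iName)) .skip) with hb
  refine ⟨2 + (body.maxCost + 7), fun D s hs => ?_⟩
  refine ((Run.straight (Q := fun s' => s'.vars vF = 0) rfl (by simp [Cmd.run, Expr.eval])).seq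
    (U := (body.maxCost + 7) * (D.n + 1)) fun s₁ hf₁ hs₁ => ?_).mono ?_ fun _ _ h => h
  rotate_left
  · simp only [Data.m, Cmd.maxCost, Expr.cost]
    nlinarith [Nat.zero_le body.maxCost]
  have H₁ := hs.frame hf₁ (by decide) (by decide)
  have eA₁ : s₁.arrays = s.arrays := funext fun B => hf₁.arr B (by simp [Cmd.wa])
  refine (forC_straight (I := fun k s' =>
      (s'.vars vF = 0 → ∀ i < k, s.arrays aVal (D.name i) = 0 → s.arrays aSup (D.name i) = 0) ∧
      (∀ x, s'.vars vF = x + 1 → D.IsFree (s.arrays aVal) x ∧ s.arrays aSup x ≠ 0))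
    rfl (by decide) (by decide) (by decide) (by simp [State.setVar_ne, hs₁]) ?_).mono
      (by rw [H₁.n]) fun s' _ h => by rwa [H₁.n] at h
  rintro k s' hk hi hf ⟨hI, hI'⟩
  rw [H₁.n] at hk
  have H := H₁.frame hf (by decide) (by decide)
  have eA : s'.arrays = s.arrays := by
    rw [← eA₁]; exact funext fun B => hf.arr B (by simp [forC, Cmd.wa])
  rw [State.setVar_ne _ _ (by decide)]
  by_cases hc : s.arrays aVal (D.name k) = 0 ∧ ¬ s.arrays aSup (D.name k) = 0
  · have : (body.run s').vars vF = D.name k + 1 := by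
      simp [hb, Cmd.run, Test.eval, Expr.eval, eA, hi, hs.name, hc]
    rw [this]
    refine ⟨by simp, fun x hx => ?_⟩
    obtain rfl : D.name k = x := by omega
    exact ⟨⟨⟨k, hk, rfl⟩, hc.1⟩, hc.2⟩
  · have : body.run s' = s' := by
      simp only [hb, Cmd.run, Test.eval, Expr.eval, eA, hi, hs.name, hc, if_false]
    rw [this]
    refine ⟨fun h i hi h0 => ?_, hI'⟩
    rcases Nat.lt_succ_iff_lt_or_eq.1 hi with hi | rfl
    · exact hI h i hi h0
    · by_contra h1
      exact hc ⟨h0, h1⟩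

/-- Pushes the extension of the current valuation that makes the supported atom true. -/
def unitC : Cmd := copyC aTmp aVal ;; .store aTmp (.pred (.var vF)) (.const 1) ;; pushC

theorem unitC_spec : ∃ C, ∀ (D : Data) (s : State) (stk : List (ℕ → ℕ)) (x : ℕ), D.Ok → Has D s →
    Stk D s stk → s.vars vF = x + 1 → D.IsFree (s.arrays aVal) x → D.Sup (s.arrays aVal) x →
    Run unitC s (C * D.m)
      (fun s' => ∃ ch, Stk D s' (stk ++ ch) ∧ Branches D (s.arrays aVal) ch) := by
  obtain ⟨C₁, h₁⟩ := copyC_spec aTmp aVal (by decide) (by decide)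
  obtain ⟨C₂, h₂⟩ := pushC_spec
  refine ⟨C₁ + 4 + C₂, fun D s stk x hD hs hstk hx hfree hsup => ?_⟩
  set σ := s.arrays aVal with hσ
  have hm : 1 ≤ D.m := by simp [Data.m]
  refine ((h₁ D s hs).seq (U := 4 + C₂ * D.m) fun s₁ hf₁ hs₁ => ?_).mono (by nlinarith)
    fun _ _ h => h
  have H₁ := hs.frame hf₁ (by decide) (by decide)
  have S₁ := hstk.frame hf₁ (by decide) (by decide)
  have ex₁ : s₁.vars vF = x + 1 := by rw [hf₁.var _ (by decide), hx]
  refine (Run.straight (Q := fun s' => ∀ i < D.n, s'.arrays aTmp (D.name i) =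
    Function.update σ x 1 (D.name i)) rfl ?_).seq fun s₂ hf₂ hs₂ => ?_
  · intro i hi
    simp [Cmd.run, Expr.eval, ex₁, Function.update_apply, hs₁ i hi, hσ]
  have H₂ := H₁.frame hf₂ (by decide) (by decide)
  have S₂ := S₁.frame hf₂ (by decide) (by decide)
  refine (h₂ D s₂ stk _ H₂ S₂ hs₂).mono le_rfl fun s' _ hS => ⟨_, hS, ?_⟩
  have hlt : (D.free (Function.update σ x 1)).card < (D.free σ).card := by
    obtain ⟨⟨i, hi, rfl⟩, h0⟩ := hfree
    refine Finset.card_lt_card ⟨fun k hk => ?_, fun hsub => ?_⟩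
    · rw [Data.mem_free] at hk ⊢
      refine ⟨hk.1, ?_⟩
      by_cases he : D.name k = D.name i
      · rw [he, h0]
      · rw [← hk.2, Function.update_of_ne he]
    · have := (Data.mem_free.1 (hsub (Data.mem_free.2 ⟨hi, h0⟩))).2
      simp at this
  refine ⟨(D.free (Function.update σ x 1)).card, fun c hc => ?_, by simpa using (by omega), ?_⟩
  · rw [List.mem_singleton.1 hc]
    refine ⟨le_rfl, fun h3 i hi => ?_⟩
    rw [Function.update_apply]
    have := h3 i hi
    split_ifs <;> omega
  intro τ hτ he
  refine ⟨_, List.mem_singleton_self _, fun i hi h0 => ?_⟩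
  by_cases hix : D.name i = x
  · rw [hix, Function.update_self]
    exact hτ.true_of_sup hD he hsup
  · rw [Function.update_of_ne hix] at h0 ⊢
    exact he i hi h0

/-- Sets `vBz` to an undecided source with the fewest undecided neighbours. Each undecided atom
leads to a source, and the one whose child leaves the most atoms undecided is kept; `vBr` is one
more than this number. -/
def bestC : Cmd :=
  .assign vBr (.const 0) ;; forC vI vN (.ite (.eq (.get aVal iName) (.const 0))
    (.assign vZ iName ;; walkC ;; childC ;; countC aTmp vR ;;
      .ite (.lt (.var vBr) (.succ (.var vR)))
        (.assign vBr (.succ (.var vR)) ;; .assign vBz (.var vZ)) .skip) .skip)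

theorem bestC_spec : ∃ C, ∀ (D : Data) (s : State), D.Ok → Has D s →
    (D.free (s.arrays aVal)).Nonempty →
    Run bestC s (C * D.m * ((D.free (s.arrays aVal)).card + 1) ^ 2) (fun s' =>
      D.IsFree (s.arrays aVal) (s'.vars vBz) ∧ D.Source (s.arrays aVal) (s'.vars vBz) ∧
      ∀ z, D.IsFree (s.arrays aVal) z → D.Source (s.arrays aVal) z →
        (D.free (D.child (s.arrays aVal) z)).card ≤
          (D.free (D.child (s.arrays aVal) (s'.vars vBz))).card) := by
  obtain ⟨C₁, h₁⟩ := walkC_spec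
  obtain ⟨C₂, h₂⟩ := childC_spec
  obtain ⟨C₃, h₃⟩ := countC_spec aTmp vR (by decide) (by decide)
  set upd : Cmd := .ite (.lt (.var vBr) (.succ (.var vR)))
        (.assign vBr (.succ (.var vR)) ;; .assign vBz (.var vZ)) .skip with hupd
  refine ⟨C₁ + C₂ + C₃ + upd.maxCost + 20, fun D s hD hs hne => ?_⟩
  set σ := s.arrays aVal with hσ
  set u := (D.free σ).card with hu
  have hm : 1 ≤ D.m := by simp [Data.m]
  refine ((Run.straight (Q := fun s' => s'.vars vBr = 0) rfl (by simp [Cmd.run, Expr.eval])).seq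
    (U := 14 * (D.n + 1) +
      u * (3 + (C₁ * D.m * (u + 1) + (C₂ * D.m + (C₃ * D.m + upd.maxCost)))))
    fun s₁ hf₁ hs₁ => ?_).mono ?_ fun _ _ h => h
  rotate_left
  · have h1 : D.n + 1 ≤ D.m := by simp [Data.m]
    have h2 : u + 1 ≤ (u + 1) ^ 2 := by nlinarith
    have h3 : 1 ≤ (u + 1) ^ 2 := by nlinarith
    have h4 : D.m ≤ D.m * (u + 1) ^ 2 := by nlinarith
    have h5 : u * D.m ≤ D.m * (u + 1) ^ 2 := by nlinarith
    have h6 : u * (D.m * (u + 1)) ≤ D.m * (u + 1) ^ 2 := by nlinarith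
    have h7 : u ≤ D.m * (u + 1) ^ 2 := by nlinarith
    have h8 := Nat.mul_le_mul_left C₁ h6
    have h9 := Nat.mul_le_mul_left C₂ h5
    have h10 := Nat.mul_le_mul_left C₃ h5
    have h11 := Nat.mul_le_mul_left upd.maxCost h7
    simp only [Cmd.maxCost, Expr.cost]
    nlinarith
  have H₁ := hs.frame hf₁ (by decide) (by decide)
  have eA₁ : s₁.arrays = s.arrays := funext fun B => hf₁.arr B (by simp [Cmd.wa])
  refine (forC_guard (I := fun k s' =>
      (s'.vars vBr = 0 → ∀ i < k, σ (D.name i) ≠ 0) ∧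
      (s'.vars vBr ≠ 0 → D.IsFree σ (s'.vars vBz) ∧ D.Source σ (s'.vars vBz) ∧
        s'.vars vBr = (D.free (D.child σ (s'.vars vBz))).card + 1) ∧
      ∀ i < k, σ (D.name i) = 0 → D.Source σ (D.name i) →
        (D.free (D.child σ (D.name i))).card < s'.vars vBr)
    (D.free σ) (3 + (C₁ * D.m * (u + 1) + (C₂ * D.m + (C₃ * D.m + upd.maxCost))))
    (by decide) (by decide) (by decide) (by simp [State.setVar_ne, hs₁]) ?_ ?_).mono
      (by rw [H₁.n]; exact Nat.add_le_add_right (Nat.mul_le_mul_right _ (by decide)) _) ?_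
  · rintro k s' hk hi hf ⟨hI₁, hI₂, hI₃⟩ hg
    rw [H₁.n] at hk
    have H := H₁.frame hf (by decide) (by decide)
    have eV : s'.arrays aVal = σ := by rw [hf.arr _ (by decide), eA₁]
    simp only [Test.eval, Expr.eval, H.name, eV, hi] at hg
    refine ⟨Data.mem_free.2 ⟨hk, hg⟩, ?_⟩
    refine (Run.straight (Q := fun s'' => s''.vars vZ = D.name k) rfl
      (by simp [Cmd.run, Expr.eval, H.name, hi])).seq fun t₁ gf₁ gs₁ => ?_
    have G₁ := H.frame gf₁ (by decide) (by decide)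
    have eV₁ : t₁.arrays aVal = σ := by rw [gf₁.arr _ (by decide), eV]
    refine (h₁ D t₁ hD G₁ (by rw [eV₁, gs₁]; exact ⟨⟨k, hk, rfl⟩, hg⟩)).mono
      (by rw [eV₁]) (fun _ _ h => h) |>.seq fun t₂ gf₂ gs₂ => ?_
    rw [eV₁, gs₁] at gs₂
    obtain ⟨hzf, hzF, hzS, hzS'⟩ := gs₂
    have G₂ := G₁.frame gf₂ (by decide) (by decide)
    have eV₂ : t₂.arrays aVal = σ := by rw [gf₂.arr _ (by decide), eV₁]
    refine (h₂ D t₂ hD G₂).seq fun t₃ gf₃ gs₃ => ?_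
    have G₃ := G₂.frame gf₃ (by decide) (by decide)
    rw [eV₂] at gs₃
    have ez₃ : t₃.vars vZ = t₂.vars vZ := gf₃.var _ (by decide)
    refine (h₃ D t₃ G₃).seq fun t₄ gf₄ gs₄ => ?_
    rw [Data.Agree.free (σ' := D.child σ (t₂.vars vZ)) gs₃] at gs₄
    have ez₄ : t₄.vars vZ = t₂.vars vZ := by rw [gf₄.var _ (by decide), ez₃]
    have ebr : t₄.vars vBr = s'.vars vBr := by
      rw [gf₄.var _ (by decide), gf₃.var _ (by decide), gf₂.var _ (by decide),
        gf₁.var _ (by decide)]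
    have ebz : t₄.vars vBz = s'.vars vBz := by
      rw [gf₄.var _ (by decide), gf₃.var _ (by decide), gf₂.var _ (by decide),
        gf₁.var _ (by decide)]
    refine Run.straight rfl ?_
    rw [State.setVar_ne _ _ (by decide), State.setVar_ne _ _ (by decide)]
    have hlast : D.Source σ (D.name k) →
        (D.free (D.child σ (D.name k))).card < (D.free (D.child σ (t₂.vars vZ))).card + 1 := by
      intro h
      rw [hzS' h]
      exact Nat.lt_succ_self _
    by_cases hc : s'.vars vBr < (D.free (D.child σ (t₂.vars vZ))).card + 1
    · have e1 : (upd.run t₄).vars vBr = (D.free (D.child σ (t₂.vars vZ))).card + 1 := by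
        simp [hupd, Cmd.run, Test.eval, Expr.eval, ebr, gs₄, hc]
      have e2 : (upd.run t₄).vars vBz = t₂.vars vZ := by
        simp [hupd, Cmd.run, Test.eval, Expr.eval, ebr, gs₄, hc, ez₄]
      rw [e1, e2]
      refine ⟨by simp, fun _ => ⟨hzf, hzS, rfl⟩, fun i hi h0 hS => ?_⟩
      rcases Nat.lt_succ_iff_lt_or_eq.1 hi with hi | rfl
      · exact (hI₃ i hi h0 hS).trans hc
      · exact hlast hS
    · have e1 : upd.run t₄ = t₄ := by
        simp only [hupd, Cmd.run, Test.eval, Expr.eval, ebr, gs₄, hc, if_false]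
      rw [e1, ebr, ebz]
      refine ⟨fun h => by omega, hI₂, fun i hi h0 hS => ?_⟩
      rcases Nat.lt_succ_iff_lt_or_eq.1 hi with hi | rfl
      · exact hI₃ i hi h0 hS
      · exact lt_of_lt_of_le (hlast hS) (not_lt.1 hc)
  · rintro k s' hk hi hf ⟨hI₁, hI₂, hI₃⟩ hg
    have H := H₁.frame hf (by decide) (by decide)
    have eV : s'.arrays aVal = σ := by rw [hf.arr _ (by decide), eA₁]
    simp only [Test.eval, Expr.eval, H.name, eV, hi] at hg
    rw [State.setVar_ne _ _ (by decide), State.setVar_ne _ _ (by decide)]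
    refine ⟨fun h i hi => ?_, hI₂, fun i hi h0 => ?_⟩
    · rcases Nat.lt_succ_iff_lt_or_eq.1 hi with hi | rfl
      · exact hI₁ h i hi
      · exact hg
    · rcases Nat.lt_succ_iff_lt_or_eq.1 hi with hi | rfl
      · exact hI₃ i hi h0
      · exact absurd h0 hg
  · rintro s' - ⟨hI₁, hI₂, hI₃⟩
    rw [H₁.n] at hI₁ hI₃
    obtain ⟨i, hi⟩ := hne
    rw [Data.mem_free] at hi
    obtain ⟨g1, g2, g3⟩ := hI₂ fun h => hI₁ h i hi.1 hi.2
    refine ⟨g1, g2, ?_⟩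
    rintro _ ⟨⟨i, hi, rfl⟩, h0⟩ hS
    have := hI₃ i hi h0 hS
    omega

/-- Pushes a child of the current valuation for each undecided atom that the array `aNb` marks: one
that makes false a source from which the implications lead to this atom. -/
def expandC : Cmd := forC vI vN
  (.ite (.and (.eq (.get aVal iName) (.const 0)) (.not (.eq (.get aNb iName) (.const 0))))
    (.assign vZ iName ;; walkC ;; childC ;; pushC) .skip)

theorem expandC_spec : ∃ C, ∀ (D : Data) (s : State) (stk : List (ℕ → ℕ)) (x : ℕ), D.Ok → Has D s →
    Stk D s stk → (∀ i < D.n, s.arrays aNb (D.name i) = D.child (s.arrays aVal) x (D.name i)) →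
    D.IsFree (s.arrays aVal) x → D.Source (s.arrays aVal) x → ¬ D.Sup (s.arrays aVal) x →
    (∀ z, D.IsFree (s.arrays aVal) z → D.Source (s.arrays aVal) z →
        (D.free (D.child (s.arrays aVal) z)).card ≤ (D.free (D.child (s.arrays aVal) x)).card) →
    Run expandC s (C * D.m * ((D.free (s.arrays aVal)).card + 1) ^ 2)
      (fun s' => ∃ ch, Stk D s' (stk ++ ch) ∧ Branches D (s.arrays aVal) ch) := by
  obtain ⟨C₁, h₁⟩ := walkC_spec
  obtain ⟨C₂, h₂⟩ := childC_spec
  obtain ⟨C₃, h₃⟩ := pushC_spec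
  refine ⟨C₁ + C₂ + C₃ + 30, fun D s stk x hD hs hstk hnb hx hxS hxN hbest => ?_⟩
  set σ := s.arrays aVal with hσ
  set u := (D.free σ).card with hu
  -- The atoms at which to branch: `x` and its undecided neighbours.
  set B := (D.free σ).filter fun i => D.child σ x (D.name i) ≠ 0 with hB
  have hm : 1 ≤ D.m := by simp [Data.m]
  refine (forC_guard (I := fun k s' => ∃ ch : List (ℕ → ℕ), Stk D s' (stk ++ ch) ∧
      ch.length = (B.filter fun i => i < k).card ∧
      (∀ c ∈ ch, (D.free c).card ≤ (D.free (D.child σ x)).card ∧ (D.Three σ → D.Three c)) ∧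
      ∀ i < k, i ∈ B → ∀ τ, D.Good τ → D.Ext σ τ → τ (D.name i) = 2 → ∃ c ∈ ch, D.Ext c τ)
    (D.free σ) (3 + (C₁ * D.m * (u + 1) + (C₂ * D.m + C₃ * D.m)))
    (by decide) (by decide) (by decide) ?_ ?_ ?_).mono ?_ ?_
  · refine ⟨[], ?_, by simp, by simp, by simp⟩
    rw [List.append_nil]
    constructor
    · rw [State.setVar_ne _ _ (by decide), hstk.cnt]
    · rw [State.setVar_ne _ _ (by decide), hstk.sp]
    · exact hstk.val
  · rintro k s' hk hi hf ⟨ch, hI₁, hI₂, hI₃, hI₄⟩ hg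
    rw [hs.n] at hk
    have H := hs.frame hf (by decide) (by decide)
    have eV : s'.arrays aVal = σ := by rw [hf.arr _ (by decide)]
    have eN : s'.arrays aNb = s.arrays aNb := hf.arr _ (by decide)
    simp only [Test.eval, Expr.eval, H.name, eV, hi, eN, hnb k hk] at hg
    have hkB : k ∈ B := Finset.mem_filter.2 ⟨Data.mem_free.2 ⟨hk, hg.1⟩, hg.2⟩
    refine ⟨Data.mem_free.2 ⟨hk, hg.1⟩, ?_⟩
    refine (Run.straight (Q := fun s'' => s''.vars vZ = D.name k) rfl
      (by simp [Cmd.run, Expr.eval, H.name, hi])).seq fun t₁ gf₁ gs₁ => ?_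
    have G₁ := H.frame gf₁ (by decide) (by decide)
    have S₁ := hI₁.frame gf₁ (by decide) (by decide)
    have eV₁ : t₁.arrays aVal = σ := by rw [gf₁.arr _ (by decide), eV]
    refine (h₁ D t₁ hD G₁ (by rw [eV₁, gs₁]; exact ⟨⟨k, hk, rfl⟩, hg.1⟩)).mono
      (by rw [eV₁]) (fun _ _ h => h) |>.seq fun t₂ gf₂ gs₂ => ?_
    rw [eV₁, gs₁] at gs₂
    obtain ⟨hzf, hzF, hzS, -⟩ := gs₂
    have G₂ := G₁.frame gf₂ (by decide) (by decide)
    have S₂ := S₁.frame gf₂ (by decide) (by decide)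
    have eV₂ : t₂.arrays aVal = σ := by rw [gf₂.arr _ (by decide), eV₁]
    refine (h₂ D t₂ hD G₂).seq fun t₃ gf₃ gs₃ => ?_
    have G₃ := G₂.frame gf₃ (by decide) (by decide)
    have S₃ := S₂.frame gf₃ (by decide) (by decide)
    rw [eV₂] at gs₃
    refine (h₃ D t₃ _ _ G₃ S₃ gs₃).mono le_rfl fun t₄ gf₄ gs₄ => ?_
    refine ⟨ch ++ [D.child σ (t₂.vars vZ)], ?_, ?_, ?_, ?_⟩
    · rw [← List.append_assoc]
      constructor
      · rw [State.setVar_ne _ _ (by decide), gs₄.cnt]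
      · rw [State.setVar_ne _ _ (by decide), gs₄.sp]
      · exact gs₄.val
    · have : (B.filter fun i => i < k + 1) = insert k (B.filter fun i => i < k) := by
        ext i
        simp only [Finset.mem_filter, Finset.mem_insert, Nat.lt_succ_iff_lt_or_eq]
        constructor
        · rintro ⟨h, h' | rfl⟩
          · exact .inr ⟨h, h'⟩
          · exact .inl rfl
        · rintro (rfl | ⟨h, h'⟩)
          · exact ⟨hkB, .inr rfl⟩
          · exact ⟨h, .inl h'⟩
      rw [this, Finset.card_insert_of_notMem (by simp), ← hI₂]
      simp
    · intro c hc
      rcases List.mem_append.1 hc with hc | hc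
      · exact hI₃ c hc
      · rw [List.mem_singleton.1 hc]
        exact ⟨hbest _ hzf hzS, fun h => h.child _⟩
    · intro i hi hiB τ hτ he h2
      rcases Nat.lt_succ_iff_lt_or_eq.1 hi with hi | rfl
      · obtain ⟨c, hc, hce⟩ := hI₄ i hi hiB τ hτ he h2
        exact ⟨c, List.mem_append_left _ hc, hce⟩
      · exact ⟨_, List.mem_append_right _ (List.mem_singleton_self _),
          hτ.ext_child he (hzF τ hτ h2)⟩
  · rintro k s' hk hi hf ⟨ch, hI₁, hI₂, hI₃, hI₄⟩ hg
    rw [hs.n] at hk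
    have H := hs.frame hf (by decide) (by decide)
    have eV : s'.arrays aVal = σ := by rw [hf.arr _ (by decide)]
    have eN : s'.arrays aNb = s.arrays aNb := hf.arr _ (by decide)
    simp only [Test.eval, Expr.eval, H.name, eV, hi, eN, hnb k hk] at hg
    have hkB : k ∉ B := fun h => by
      rw [hB, Finset.mem_filter, Data.mem_free] at h
      exact hg ⟨h.1.2, h.2⟩
    refine ⟨ch, ?_, ?_, hI₃, fun i hi hiB => ?_⟩
    · constructor
      · rw [State.setVar_ne _ _ (by decide), hI₁.cnt]
      · rw [State.setVar_ne _ _ (by decide), hI₁.sp]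
      · exact hI₁.val
    · rw [hI₂]
      congr 1
      refine Finset.filter_congr fun i hi => ⟨fun h => by omega, fun h => ?_⟩
      exact lt_of_le_of_ne (by omega) fun h' => hkB (h' ▸ hi)
    · rcases Nat.lt_succ_iff_lt_or_eq.1 hi with hi | rfl
      · exact hI₄ i hi hiB
      · exact absurd hiB hkB
  · rw [hs.n]
    have h1 : D.n + 1 ≤ D.m := by simp [Data.m]
    have h2 : u + 1 ≤ (u + 1) ^ 2 := by nlinarith
    have h3 : 1 ≤ (u + 1) ^ 2 := by nlinarith
    have h4 : D.m ≤ D.m * (u + 1) ^ 2 := by nlinarith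
    have h5 : u * D.m ≤ D.m * (u + 1) ^ 2 := by nlinarith
    have h6 : u * (D.m * (u + 1)) ≤ D.m * (u + 1) ^ 2 := by nlinarith
    have h7 : u ≤ D.m * (u + 1) ^ 2 := by nlinarith
    have h8 := Nat.mul_le_mul_left C₁ h6
    have h9 := Nat.mul_le_mul_left C₂ h5
    have h10 := Nat.mul_le_mul_left C₃ h5
    simp only [Test.cost, Expr.cost]
    nlinarith
  · rintro s' - ⟨ch, hI₁, hI₂, hI₃, hI₄⟩
    rw [hs.n] at hI₂ hI₄
    refine ⟨ch, hI₁, (D.free (D.child σ x)).card, hI₃, ?_, fun τ hτ he => ?_⟩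
    · rw [hI₂, ← Data.card_branches σ x]
      exact Nat.add_le_add_right (Finset.card_le_card (Finset.filter_subset _ _)) _
    · obtain ⟨i, hi, h0, h1, h2⟩ := hτ.exists_false hD he hx.1 hx.2 hxS hxN
      exact hI₄ i hi (Finset.mem_filter.2 ⟨Data.mem_free.2 ⟨hi, h0⟩, h1⟩) τ hτ he h2

end MinModels

namespace MinModels

/-- Pushes the branches of an incomplete valuation. The child of the best source marks in `aNb` the
atoms at which to branch. -/
def branchC : Cmd :=
  bestC ;; .assign vZ (.var vBz) ;; childC ;; copyC aNb aTmp ;; expandC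

theorem branchC_spec : ∃ C, ∀ (D : Data) (s : State) (stk : List (ℕ → ℕ)), D.Ok → Has D s →
    Stk D s stk → (D.free (s.arrays aVal)).Nonempty →
    (∀ i < D.n, s.arrays aVal (D.name i) = 0 → ¬ D.Sup (s.arrays aVal) (D.name i)) →
    Run branchC s (C * D.m * ((D.free (s.arrays aVal)).card + 1) ^ 2)
      (fun s' => ∃ ch, Stk D s' (stk ++ ch) ∧ Branches D (s.arrays aVal) ch) := by
  obtain ⟨C₁, h₁⟩ := bestC_spec
  obtain ⟨C₂, h₂⟩ := childC_spec
  obtain ⟨C₃, h₃⟩ := copyC_spec aNb aTmp (by decide) (by decide)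
  obtain ⟨C₄, h₄⟩ := expandC_spec
  refine ⟨C₁ + 2 + C₂ + C₃ + C₄, fun D s stk hD hs hstk hne hns => ?_⟩
  set σ := s.arrays aVal with hσ
  set w := ((D.free σ).card + 1) ^ 2 with hw
  refine ((h₁ D s hD hs hne).seq (U := 2 + (C₂ * D.m + (C₃ * D.m + C₄ * D.m * w)))
    fun s₁ hf₁ hs₁ => ?_).mono ?_ fun _ _ h => h
  rotate_left
  · have hm : 1 ≤ D.m := by simp [Data.m]
    have hw1 : 1 ≤ w := Nat.one_le_pow _ _ (Nat.succ_pos _)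
    have h4 : D.m ≤ D.m * w := Nat.le_mul_of_pos_right _ hw1
    have h5 := Nat.mul_le_mul_left C₂ h4
    have h6 := Nat.mul_le_mul_left C₃ h4
    rw [← hσ, ← hw]
    nlinarith
  rw [← hσ] at hs₁
  obtain ⟨hfree, hS, hbest⟩ := hs₁
  have H₁ := hs.frame hf₁ (by decide) (by decide)
  have S₁ := hstk.frame hf₁ (by decide) (by decide)
  have eV₁ : s₁.arrays aVal = σ := by rw [hf₁.arr _ (by decide)]
  refine (Run.straight (Q := fun s' => s'.vars vZ = s₁.vars vBz) rfl
    (by simp [Cmd.run, Expr.eval])).seq fun s₂ hf₂ hs₂ => ?_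
  have H₂ := H₁.frame hf₂ (by decide) (by decide)
  have S₂ := S₁.frame hf₂ (by decide) (by decide)
  have eV₂ : s₂.arrays aVal = σ := by rw [hf₂.arr _ (by decide), eV₁]
  refine (h₂ D s₂ hD H₂).seq fun s₃ hf₃ hs₃ => ?_
  rw [eV₂, hs₂] at hs₃
  have H₃ := H₂.frame hf₃ (by decide) (by decide)
  have S₃ := S₂.frame hf₃ (by decide) (by decide)
  have eV₃ : s₃.arrays aVal = σ := by rw [hf₃.arr _ (by decide), eV₂]
  refine (h₃ D s₃ H₃).seq fun s₄ hf₄ hs₄ => ?_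
  have H₄ := H₃.frame hf₄ (by decide) (by decide)
  have S₄ := S₃.frame hf₄ (by decide) (by decide)
  have eV₄ : s₄.arrays aVal = σ := by rw [hf₄.arr _ (by decide), eV₃]
  have := h₄ D s₄ stk (s₁.vars vBz) hD H₄ S₄
  rw [eV₄] at this
  refine this (fun i hi => by rw [hs₄ i hi, hs₃ i hi]) hfree hS ?_ hbest
  obtain ⟨⟨i, hi, he⟩, h0⟩ := hfree
  exact he ▸ hns i hi (he ▸ h0)

/-- Outputs the set described by a complete valuation, if the valuation is good. -/
def leafC : Cmd := checkC ;; .ite (.eq (.var vBad) (.const 0)) emitC .skip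

theorem leafC_spec : ∃ C, ∀ (D : Data) (s : State), D.Ok → Has D s →
    (∀ i < D.n, ∃ i' < D.n, D.name i' = s.arrays aRep (D.name i)) →
    (∀ i < D.n, s.arrays aVal (D.name i) = 1 ∨ s.arrays aVal (D.name i) = 2) →
    (∀ i < D.n, (s.arrays aSup (D.name i) ≠ 0 ↔ D.Sup (s.arrays aVal) (D.name i))) →
    Run leafC s (C * D.m) (fun s' => ∃ outs : List (List ℕ),
      s'.output = s.output ++ outs.flatMap encodeList ∧
      Outs D (s.arrays aRep) (s.arrays aVal) outs) := by
  obtain ⟨C₁, h₁⟩ := checkC_spec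
  obtain ⟨C₂, h₂⟩ := emitC_spec
  refine ⟨C₁ + C₂ + 5, fun D s hD hs hrep htot hsup => ?_⟩
  have hm : 1 ≤ D.m := by simp [Data.m]
  refine ((h₁ D s hs).seq (U := 3 + (C₂ * D.m + 1) + 1) fun s₁ hf₁ hs₁ => ?_).mono (by nlinarith)
    fun _ _ h => h
  have H₁ := hs.frame hf₁ (by decide) (by decide)
  have eA₁ : s₁.arrays = s.arrays := funext fun B => hf₁.arr B (by simp [Cmd.wa, checkC, forC])
  have eO₁ : s₁.output = s.output := hf₁.out rfl
  have hgood : s₁.vars vBad = 0 ↔ D.Good (s.arrays aVal) := by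
    rw [hs₁]
    exact ⟨fun h => ⟨htot, h.1, fun i hi h1 => (hsup i hi).1 (h.2 i hi h1)⟩,
      fun h => ⟨h.viol, fun i hi h1 => (hsup i hi).2 (h.sup i hi h1)⟩⟩
  have hagree : ∀ τ, D.Ext (s.arrays aVal) τ → D.Agree (s.arrays aVal) τ := fun τ he i hi =>
    (he i hi (by rcases htot i hi with h | h <;> simp [h])).symm
  refine Run.ite (fun hb => ?_) (fun hb => ?_)
  · simp only [Test.eval, Expr.eval] at hb
    refine (h₂ D s₁ H₁).mono (by omega) fun s' _ hs' => 
      ⟨[D.outList (s.arrays aRep) (s.arrays aVal) D.n], ?_, ?_, ?_⟩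
    · rw [hs', eO₁, eA₁, List.flatMap_singleton]
    · intro l hl
      exact ⟨_, hgood.1 hb, List.mem_singleton.1 hl⟩
    · intro τ hτ he
      rw [List.mem_singleton]
      exact Data.outList_congr hrep (hagree τ he).symm
  · simp only [Test.eval, Expr.eval, hgood] at hb
    refine ⟨1, s₁, .skip s₁, by omega, [], by simp [eO₁], by simp, fun τ hτ he => ?_⟩
    exact absurd ((hagree τ he).symm.good hD hτ) hb

/-- One step of the search: it takes a valuation from the stack, and outputs its set if it is
complete and good, or else replaces it by its branches. -/
def nodeC : Cmd :=
  popC ;; supC ;; countC aVal vU ;; .ite (.eq (.var vU) (.const 0)) leafC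
    (forcedC ;; .ite (.eq (.var vF) (.const 0)) branchC unitC)

theorem nodeC_spec : ∃ C, ∀ (D : Data) (s : State) (stk : List (ℕ → ℕ)) (σ : ℕ → ℕ), D.Ok →
    Has D s → (∀ i < D.n, ∃ i' < D.n, D.name i' = s.arrays aRep (D.name i)) →
    D.Three σ →
    Stk D s (stk ++ [σ]) →
    Run nodeC s (C * D.m * ((D.free σ).card + 1) ^ 2) (fun s' => ∃ ch outs,
      Stk D s' (stk ++ ch) ∧ s'.output = s.output ++ outs.flatMap encodeList ∧
      (ch = [] ∧ Outs D (s.arrays aRep) σ outs ∨ outs = [] ∧ Branches D σ ch)) := by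
  obtain ⟨C₁, h₁⟩ := popC_spec
  obtain ⟨C₂, h₂⟩ := supC_spec
  obtain ⟨C₃, h₃⟩ := countC_spec aVal vU (by decide) (by decide)
  obtain ⟨C₄, h₄⟩ := leafC_spec
  obtain ⟨C₅, h₅⟩ := forcedC_spec
  obtain ⟨C₆, h₆⟩ := branchC_spec
  obtain ⟨C₇, h₇⟩ := unitC_spec
  refine ⟨C₁ + C₂ + C₃ + C₄ + C₅ + C₆ + C₇ + 8, fun D s stk σ hD hs hrep h3 hstk => ?_⟩
  set w := ((D.free σ).card + 1) ^ 2 with hw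
  refine ((h₁ D s stk σ hD hs hstk).seq (U := C₂ * D.m + (C₃ * D.m + (3 + (C₄ * D.m + (C₅ * D.m +
    (3 + (C₆ * D.m * w + C₇ * D.m) + 1))) + 1))) fun s₁ hf₁ hs₁ => ?_).mono ?_ fun _ _ h => h
  rotate_left
  · have hm : 1 ≤ D.m := by simp [Data.m]
    have hw1 : 1 ≤ w := Nat.one_le_pow _ _ (Nat.succ_pos _)
    have h : D.m ≤ D.m * w := Nat.le_mul_of_pos_right _ hw1
    have e1 := Nat.mul_le_mul_left C₁ h
    have e2 := Nat.mul_le_mul_left C₂ h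
    have e3 := Nat.mul_le_mul_left C₃ h
    have e4 := Nat.mul_le_mul_left C₄ h
    have e5 := Nat.mul_le_mul_left C₅ h
    have e7 := Nat.mul_le_mul_left C₇ h
    have : C₁ * (D.m * w) + C₂ * (D.m * w) + C₃ * (D.m * w) + C₄ * (D.m * w) + C₅ * (D.m * w) +
        C₆ * (D.m * w) + C₇ * (D.m * w) + 8 * (D.m * w) =
        (C₁ + C₂ + C₃ + C₄ + C₅ + C₆ + C₇ + 8) * D.m * w := by ring
    rw [mul_assoc C₆]
    omega
  obtain ⟨S₁, hval⟩ := hs₁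
  have H₁ := hs.frame hf₁ (by decide) (by decide)
  have eR₁ : s₁.arrays aRep = s.arrays aRep := hf₁.arr _ (by decide)
  have eO₁ : s₁.output = s.output := hf₁.out rfl
  set σ' := s₁.arrays aVal with hσ'
  have hagree : D.Agree σ σ' := fun i hi => (hval i hi).symm
  refine (h₂ D s₁ H₁).seq fun s₂ hf₂ hsup => ?_
  have H₂ := H₁.frame hf₂ (by decide) (by decide)
  have S₂ := S₁.frame hf₂ (by decide) (by decide)
  have eR₂ : s₂.arrays aRep = s.arrays aRep := by rw [hf₂.arr _ (by decide), eR₁]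
  have eV₂ : s₂.arrays aVal = σ' := hf₂.arr _ (by decide)
  have eO₂ : s₂.output = s.output := by rw [hf₂.out rfl, eO₁]
  refine (h₃ D s₂ H₂).seq fun s₃ hf₃ hcount => ?_
  have H₃ := H₂.frame hf₃ (by decide) (by decide)
  have S₃ := S₂.frame hf₃ (by decide) (by decide)
  have eR₃ : s₃.arrays aRep = s.arrays aRep := by rw [hf₃.arr _ (by decide), eR₂]
  have eV₃ : s₃.arrays aVal = σ' := by rw [hf₃.arr _ (by decide), eV₂]
  have eS₃ : s₃.arrays aSup = s₂.arrays aSup := hf₃.arr _ (by decide)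
  have eO₃ : s₃.output = s.output := by rw [hf₃.out rfl, eO₂]
  rw [← hσ'] at hsup
  rw [eV₂] at hcount
  refine Run.ite (fun hb => ?_) (fun hb => ?_) <;> simp only [Test.eval, Expr.eval, hcount] at hb
  · have htot : ∀ i < D.n, σ' (D.name i) = 1 ∨ σ' (D.name i) = 2 := by
      intro i hi
      have h0 : σ' (D.name i) ≠ 0 := fun h0 => by
        have := Data.mem_free.2 ⟨hi, h0⟩
        rw [Finset.card_eq_zero.1 hb] at this
        simp at this
      have := h3 i hi
      rw [← hval i hi] at this
      omega
    have := h₄ D s₃ hD H₃ (by rwa [eR₃]) (by rwa [eV₃]) (by rwa [eS₃, eV₃])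
    refine this.mono (by omega) ?_
    rintro s' hf' ⟨outs, ho, houts⟩
    rw [eR₃, eV₃] at houts
    refine ⟨[], outs, ?_, by rw [ho, eO₃], .inl ⟨rfl, houts.congr hagree⟩⟩
    rw [List.append_nil]
    exact S₃.frame hf' (by decide) (by decide)
  · refine ((h₅ D s₃ H₃).seq (U := 3 + (C₆ * D.m * w + C₇ * D.m) + 1) fun s₄ hf₄ hforced => ?_).mono
      (by omega) fun _ _ h => h
    have H₄ := H₃.frame hf₄ (by decide) (by decide)
    have S₄ := S₃.frame hf₄ (by decide) (by decide)
    have eV₄ : s₄.arrays aVal = σ' := by rw [hf₄.arr _ (by decide), eV₃]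
    have eO₄ : s₄.output = s.output := by rw [hf₄.out rfl, eO₃]
    rw [eV₃, eS₃] at hforced
    obtain ⟨hno, hyes⟩ := hforced
    refine Run.ite (fun hb' => ?_) (fun hb' => ?_) <;> simp only [Test.eval, Expr.eval] at hb'
    · have := h₆ D s₄ stk hD H₄ S₄ (by rw [eV₄]; exact Finset.card_ne_zero.1 hb) (by
        rw [eV₄]
        intro i hi h0 hs
        exact (hsup i hi).2 hs (hno hb' i hi h0))
      rw [eV₄, ← hagree.free, ← hw] at this
      refine this.mono (by omega) ?_
      rintro s' hf' ⟨ch, hS, hB⟩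
      exact ⟨ch, [], hS, by rw [hf'.out rfl, eO₄]; simp, .inr ⟨rfl, hB.congr hagree⟩⟩
    · obtain ⟨x, hx⟩ := Nat.exists_eq_succ_of_ne_zero hb'
      obtain ⟨hfree, hxs⟩ := hyes x hx
      have := h₇ D s₄ stk x hD H₄ S₄ hx (by rwa [eV₄]) (by
        rw [eV₄]
        obtain ⟨⟨i, hi, rfl⟩, -⟩ := hfree
        exact (hsup i hi).1 hxs)
      rw [eV₄] at this
      refine this.mono (by omega) ?_
      rintro s' hf' ⟨ch, hS, hB⟩
      exact ⟨ch, [], hS, by rw [hf'.out rfl, eO₄]; simp, .inr ⟨rfl, hB.congr hagree⟩⟩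

/-! ### The search -/

/-- The search for all good valuations. -/
def searchC : Cmd := .loop (.lt (.const 0) (.var vCnt)) nodeC

/-- The state of the search between two steps. -/
structure SearchInv (D : Data) (rep : ℕ → ℕ) (s : State) (stk : List (ℕ → ℕ)) : Prop where
  has : Has D s
  rep : s.arrays aRep = rep
  stk : Stk D s stk

/-- The loop of the search leads from `s` to `s'` in `t` steps. Stated by continuation, this permits
an induction over the search tree although the loop runs on until the stack is empty. -/
def SearchIter (s : State) (t : ℕ) (s' : State) : Prop :=
  ∀ t' s'', Exec searchC s' t' s'' → Exec searchC s (t + t') s''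

theorem SearchIter.refl (s : State) : SearchIter s 0 s := fun t' s'' h => by rwa [zero_add]

theorem SearchIter.trans {s s' s'' : State} {t t' : ℕ} (h : SearchIter s t s')
    (h' : SearchIter s' t' s'') : SearchIter s (t + t') s'' := fun u s₃ hu => by
  rw [add_assoc]
  exact h _ _ (h' _ _ hu)

/-- The time for exploring a search tree at whose root `u` atoms are undecided. -/
noncomputable def searchBound (K : ℝ) (u : ℕ) : ℝ := K * (root ^ u * weight u)

/-- The bound covers the work at a node and `d` subtrees, if the branches decide `d` atoms each. -/
theorem searchBound_step {K : ℝ} (hK : 0 ≤ K) {u r d : ℕ} (h : d + r ≤ u) (hd : 0 < d) :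
    K * ((u : ℝ) + 1) ^ 2 + d * searchBound K r ≤ searchBound K u := by
  obtain ⟨v, rfl⟩ : ∃ v, u = v + 1 := ⟨u - 1, by omega⟩
  have h1 : weight r ≤ weight v := weight_mono (by omega)
  have h2 : (d : ℝ) * root ^ r ≤ root ^ (v + 1) := by
    have hr1 : (1 : ℝ) ≤ root := (lt_trans (by norm_num) lt_root).le
    calc (d : ℝ) * root ^ r ≤ root ^ d * root ^ r :=
          mul_le_mul_of_nonneg_right (natCast_le_root_pow d) (pow_nonneg root_pos.le _)
      _ = root ^ (d + r) := (pow_add _ _ _).symm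
      _ ≤ root ^ (v + 1) := pow_le_pow_right₀ hr1 h
  have h3 : (d : ℝ) * (root ^ r * weight r) ≤ root ^ (v + 1) * weight v := by
    rw [← mul_assoc]
    exact mul_le_mul h2 h1 (weight_nonneg _) (pow_nonneg root_pos.le _)
  unfold searchBound
  rw [weight_succ]
  push_cast
  have h4 := mul_le_mul_of_nonneg_left h3 hK
  nlinarith

/-- Exploring the search tree of the top valuation `σ` removes it from the stack and outputs all
sets described by good extensions of `σ`. -/
theorem search_tree : ∃ C : ℕ, ∀ (D : Data) (rep : ℕ → ℕ), D.Ok →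
    (∀ i < D.n, ∃ i' < D.n, D.name i' = rep (D.name i)) →
    ∀ (u : ℕ) (s : State) (stk : List (ℕ → ℕ)) (σ : ℕ → ℕ), (D.free σ).card ≤ u → D.Three σ →
      SearchInv D rep s (stk ++ [σ]) →
      ∃ (t : ℕ) (s' : State) (outs : List (List ℕ)), SearchIter s t s' ∧ SearchInv D rep s' stk ∧
        s'.output = s.output ++ outs.flatMap encodeList ∧ Outs D rep σ outs ∧
        (t : ℝ) ≤ searchBound (C * D.m) u := by
  obtain ⟨C₀, hC⟩ := nodeC_spec
  refine ⟨C₀ + 4, fun D rep hD hrep => ?_⟩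
  set K : ℝ := ((C₀ + 4 : ℕ) : ℝ) * D.m with hK
  have hK0 : 0 ≤ K := by positivity
  have hm : 1 ≤ D.m := by simp [Data.m]
  intro u
  induction u using Nat.strong_induction_on with
  | _ u ih =>
  intro s stk σ hu h3 hinv
  obtain ⟨t, s₁, he, ht, ch, outs, hstk, hout, hres⟩ :=
    hC D s stk σ hD hinv.has (by rwa [hinv.rep]) h3 hinv.stk
  have hf := he.frame
  have hinv₁ : SearchInv D rep s₁ (stk ++ ch) :=
    ⟨hinv.has.frame hf (by decide) (by decide), by rw [hf.arr _ (by decide), hinv.rep], hstk⟩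
  have hiter : SearchIter s (t + 4) s₁ := by
    intro t' s'' h
    have := Exec.loop_true (b := .lt (.const 0) (.var vCnt)) ?_ he h
    · have e : t + 4 + t' = (Test.lt (.const 0) (.var vCnt)).cost + t + t' + 1 := by
        simp only [Test.cost, Expr.cost]; omega
      rw [e]
      exact this
    · simp [Test.eval, Expr.eval, hinv.stk.cnt]
  have htu : ((t + 4 : ℕ) : ℝ) ≤ K * ((u : ℝ) + 1) ^ 2 := by
    have h1 : t + 4 ≤ (C₀ + 4) * D.m * (u + 1) ^ 2 := by
      have h2 : ((D.free σ).card + 1) ^ 2 ≤ (u + 1) ^ 2 := Nat.pow_le_pow_left (by omega) 2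
      have h3 := Nat.mul_le_mul_left (C₀ * D.m) h2
      have h4 : 1 ≤ D.m * (u + 1) ^ 2 := Nat.mul_pos hm (by positivity)
      nlinarith
    calc ((t + 4 : ℕ) : ℝ) ≤ (((C₀ + 4) * D.m * (u + 1) ^ 2 : ℕ) : ℝ) := by exact_mod_cast h1
      _ = K * ((u : ℝ) + 1) ^ 2 := by rw [hK]; push_cast; ring
  rcases hres with ⟨rfl, houts⟩ | ⟨rfl, r, hch, hlen, hcov⟩
  · rw [List.append_nil] at hinv₁
    rw [hinv.rep] at houts
    refine ⟨t + 4, s₁, outs, hiter, hinv₁, hout, houts, htu.trans ?_⟩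
    exact mul_le_mul_of_nonneg_left (sq_le_root_pow u) hK0
  · -- The branches are explored one after the other, from the top of the stack.
    have key : ∀ (cs : List (ℕ → ℕ)) (s₁ : State), (∀ c ∈ cs, c ∈ ch) →
        SearchInv D rep s₁ (stk ++ cs) → ∃ (t : ℕ) (s' : State) (outs : List (List ℕ)),
          SearchIter s₁ t s' ∧ SearchInv D rep s' stk ∧
          s'.output = s₁.output ++ outs.flatMap encodeList ∧
          (∀ l ∈ outs, ∃ τ, D.Good τ ∧ l = D.outList rep τ D.n) ∧
          (∀ c ∈ cs, ∀ τ, D.Good τ → D.Ext c τ → D.outList rep τ D.n ∈ outs) ∧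
          (t : ℝ) ≤ cs.length * searchBound K r := by
      intro cs
      induction cs using List.reverseRecOn with
      | nil =>
        intro s₁ _ h
        rw [List.append_nil] at h
        exact ⟨0, s₁, [], .refl s₁, h, by simp, by simp, by simp, by simp⟩
      | append_singleton cs c ihcs =>
        intro s₁ hcs h
        rw [← List.append_assoc] at h
        have hc : c ∈ ch := hcs c (by simp)
        have hpos : 0 < ch.length := List.length_pos_of_mem hc
        obtain ⟨t₁, s₂, o₁, hi₁, hv₁, ho₁, hO₁, ht₁⟩ :=
          ih r (by omega) s₁ (stk ++ cs) c (hch c hc).1 ((hch c hc).2 h3) h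
        obtain ⟨t₂, s₃, o₂, hi₂, hv₂, ho₂, hs₂, hc₂, ht₂⟩ :=
          ihcs s₂ (fun c' hc' => hcs c' (by simp [hc'])) hv₁
        refine ⟨t₁ + t₂, s₃, o₁ ++ o₂, hi₁.trans hi₂, hv₂, ?_, ?_, ?_, ?_⟩
        · rw [ho₂, ho₁, List.flatMap_append, List.append_assoc]
        · intro l hl
          rcases List.mem_append.1 hl with hl | hl
          · exact hO₁.1 l hl
          · exact hs₂ l hl
        · intro c' hc' τ hτ he
          rcases List.mem_append.1 hc' with hc' | hc'
          · exact List.mem_append_right _ (hc₂ c' hc' τ hτ he)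
          · rw [List.mem_singleton.1 hc'] at he
            exact List.mem_append_left _ (hO₁.2 τ hτ he)
        · rw [List.length_append, List.length_singleton]
          push_cast
          linarith
    obtain ⟨t', s', outs, hi', hv', ho', hs', hc', ht'⟩ := key ch s₁ (fun _ h => h) hinv₁
    refine ⟨t + 4 + t', s', outs, hiter.trans hi', hv', ?_, ⟨hs', fun τ hτ he => ?_⟩, ?_⟩
    · rw [ho', hout]
      simp
    · obtain ⟨c, hc, hce⟩ := hcov τ hτ he
      exact hc' c hc τ hτ hce
    · rcases Nat.eq_zero_or_pos ch.length with h0 | hpos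
      · rw [h0] at ht'
        push_cast at ht' htu ⊢
        have := mul_le_mul_of_nonneg_left (sq_le_root_pow u) hK0
        unfold searchBound
        linarith
      · have := searchBound_step hK0 (hlen.trans hu) hpos
        push_cast at htu ⊢
        linarith

end MinModels

namespace MinModels

/-! ### Collapsing strongly connected components -/

/-- There is a pair of a head atom and a body atom, for which `f` gives `a` and `g` gives `b`. With
the atoms of the pairs for `f` and `g`, this is an implication, forwards or backwards. -/
def Data.Step (D : Data) (f g : ℕ → ℕ) (a b : ℕ) : Prop :=
  ∃ j < D.q, D.k1 j = 3 ∧ D.k2 j = 1 ∧ f j = a ∧ g j = b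

/-- Marks in the array `A` the atoms to which an implication leads from a marked atom; implications
lead from the atoms in the array `S` to those in the array `T`. -/
def markScan (A S T : ℕ) : Cmd := forC vJ vQ
  (.ite (.and (.and (.eq jK1 (.const 3)) (.eq jK2 (.const 1)))
      (.not (.eq (.get A (.get S (.var vJ))) (.const 0))))
    (.store A (.get T (.var vJ)) (.const 1)) .skip)

/-- Marks in the array `A` the atoms to which the implications lead from the atom `vZ`. -/
def markC (A S T : ℕ) : Cmd :=
  forC vT vN (.store A tName (.const 0)) ;; .store A (.var vZ) (.const 1) ;;
    forC vT vN (markScan A S T)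

theorem markScan_spec (A S T : ℕ) (hA : ∀ B ∈ [aName, aK1, aX1, aK2, aX2], B ≠ A)
    (hS : S ∈ [aX1, aX2]) (hT : T ∈ [aX1, aX2]) :
    ∃ C, ∀ (D : Data) (s : State) (x : ℕ), Has D s →
    (∀ a, s.arrays A a ≠ 0 → Relation.ReflTransGen (D.Step (s.arrays S) (s.arrays T)) x a) →
    Run (markScan A S T) s (C * D.m) (fun s' =>
      (∀ a, s.arrays A a ≠ 0 → s'.arrays A a ≠ 0) ∧
      (∀ a, s'.arrays A a ≠ 0 →
        Relation.ReflTransGen (D.Step (s.arrays S) (s.arrays T)) x a) ∧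
      (∀ a b, D.Step (s.arrays S) (s.arrays T) a b → s.arrays A a ≠ 0 → s'.arrays A b ≠ 0) ∧
      ((∀ a b, D.Step (s.arrays S) (s.arrays T) a b → s.arrays A a ≠ 0 → s.arrays A b ≠ 0) →
        ∀ a, s'.arrays A a ≠ 0 → s.arrays A a ≠ 0)) := by
  have hSA : S ≠ A := hA S (by fin_cases hS <;> simp)
  have hTA : T ≠ A := hA T (by fin_cases hT <;> simp)
  set body : Cmd := (.ite (.and (.and (.eq jK1 (.const 3)) (.eq jK2 (.const 1)))
      (.not (.eq (.get A (.get S (.var vJ))) (.const 0))))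
    (.store A (.get T (.var vJ)) (.const 1)) .skip) with hb
  refine ⟨body.maxCost + 7, fun D s x hs hsound => ?_⟩
  set f := s.arrays S with hf
  set g := s.arrays T with hg
  refine (forC_straight (i := vJ) (b := vQ) (body := body) (I := fun k s' =>
      (∀ a, s.arrays A a ≠ 0 → s'.arrays A a ≠ 0) ∧
      (∀ a, s'.arrays A a ≠ 0 → Relation.ReflTransGen (D.Step f g) x a) ∧
      (∀ j < k, D.k1 j = 3 → D.k2 j = 1 → s.arrays A (f j) ≠ 0 → s'.arrays A (g j) ≠ 0) ∧
      ((∀ a b, D.Step f g a b → s.arrays A a ≠ 0 → s.arrays A b ≠ 0) →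
        ∀ a, s'.arrays A a ≠ 0 → s.arrays A a ≠ 0))
    rfl (by simp [hb, Cmd.wv]) (by simp [hb, Cmd.wv]) (by decide) ?_ ?_).mono
      (Nat.mul_le_mul_left _ (by simp only [hs.q, Data.m]; omega)) ?_
  · exact ⟨fun a h => h, hsound, by simp, fun _ _ h => h⟩
  · rintro k s' hk hj hfr ⟨hI₁, hI₂, hI₃, hI₄⟩
    rw [hs.q] at hk
    have H := hs.frame hfr (by simp [forC, Cmd.wv, hb]) (by simpa [forC, Cmd.wa, hb] using hA)
    have ef : s'.arrays S = f := hfr.arr S (by simpa [forC, Cmd.wa, hb] using hSA)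
    have eg : s'.arrays T = g := hfr.arr T (by simpa [forC, Cmd.wa, hb] using hTA)
    rw [State.setVar_arrays]
    by_cases hc : (D.k1 k = 3 ∧ D.k2 k = 1) ∧ ¬ s'.arrays A (f k) = 0
    · have : (body.run s').arrays A = Function.update (s'.arrays A) (g k) 1 := by
        simp [hb, Cmd.run, Test.eval, Expr.eval, H.k1, H.k2, hj, ef, eg, hc]
      rw [this]
      obtain ⟨⟨h1, h2⟩, h3⟩ := hc
      have hstep : D.Step f g (f k) (g k) := ⟨k, hk, h1, h2, rfl, rfl⟩
      have hup : ∀ a, s'.arrays A a ≠ 0 → Function.update (s'.arrays A) (g k) 1 a ≠ 0 := by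
        intro a ha
        rw [Function.update_apply]
        split_ifs <;> simp [ha]
      refine ⟨fun a ha => hup a (hI₁ a ha), fun a ha => ?_, fun j hj' g1 g2 g3 => ?_,
        fun hcl a ha => ?_⟩
      · by_cases hag : a = g k
        · exact hag ▸ (hI₂ _ h3).tail hstep
        · rw [Function.update_of_ne hag] at ha
          exact hI₂ a ha
      · rcases Nat.lt_succ_iff_lt_or_eq.1 hj' with hj' | rfl
        · exact hup _ (hI₃ j hj' g1 g2 g3)
        · simp
      · by_cases hag : a = g k
        · exact hag ▸ hcl _ _ hstep (hI₄ hcl _ h3)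
        · rw [Function.update_of_ne hag] at ha
          exact hI₄ hcl a ha
    · have : body.run s' = s' := by
        simp only [hb, Cmd.run, Test.eval, Expr.eval, H.k1, H.k2, hj, ef, eg, hc, if_false]
      rw [this]
      refine ⟨hI₁, hI₂, fun j hj' g1 g2 g3 => ?_, hI₄⟩
      rcases Nat.lt_succ_iff_lt_or_eq.1 hj' with hj' | rfl
      · exact hI₃ j hj' g1 g2 g3
      · exact absurd ⟨⟨g1, g2⟩, hI₁ _ g3⟩ hc
  · rintro s' - ⟨hI₁, hI₂, hI₃, hI₄⟩
    rw [hs.q] at hI₃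
    refine ⟨hI₁, hI₂, ?_, hI₄⟩
    rintro a b ⟨j, hj, h1, h2, rfl, rfl⟩ ha
    exact hI₃ j hj h1 h2 ha

theorem markC_spec (A S T : ℕ) (hA : ∀ B ∈ [aName, aK1, aX1, aK2, aX2], B ≠ A)
    (hS : S ∈ [aX1, aX2]) (hT : T ∈ [aX1, aX2]) :
    ∃ C, ∀ (D : Data) (s : State), Has D s → (∀ a, s.arrays A a ≠ 0 → ∃ i < D.n, D.name i = a) →
    (∃ i < D.n, D.name i = s.vars vZ) → (∀ j < D.q, ∃ i < D.n, D.name i = s.arrays T j) →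
    Run (markC A S T) s (C * D.m * (D.n + 1)) (fun s' => ∀ a, s'.arrays A a ≠ 0 ↔
      Relation.ReflTransGen (D.Step (s.arrays S) (s.arrays T)) (s.vars vZ) a) := by
  classical
  obtain ⟨C, hC⟩ := markScan_spec A S T hA hS hT
  have hSA : S ≠ A := hA S (by fin_cases hS <;> simp)
  have hTA : T ≠ A := hA T (by fin_cases hT <;> simp)
  set body : Cmd := .store A tName (.const 0) with hb
  refine ⟨(body.maxCost + 7) + 3 + 6 + (C + 7), fun D s hs hdom hx hTm => ?_⟩
  set f := s.arrays S with hf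
  set g := s.arrays T with hg
  set x := s.vars vZ with hxd
  refine ((forC_straight (i := vT) (b := vN) (body := body) (I := fun k s' =>
      ∀ a, s'.arrays A a ≠ 0 → ∃ i < D.n, k ≤ i ∧ D.name i = a)
    rfl (by simp [hb, Cmd.wv]) (by simp [hb, Cmd.wv]) (by decide) (by simpa using hdom) ?_).seq
    (U := 3 + (6 + D.n * (C * D.m + 7))) fun s₁ hf₁ hs₁ => ?_).mono ?_ fun _ _ h => h
  · intro k s' hk hi hfr hI a
    have H := hs.frame hfr (by simp [forC, Cmd.wv, hb]) (by simpa [forC, Cmd.wa, hb] using hA)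
    have : (body.run s').arrays A = Function.update (s'.arrays A) (D.name k) 0 := by
      simp [hb, Cmd.run, Expr.eval, H.name, hi]
    rw [State.setVar_arrays, this, Function.update_apply]
    split_ifs with h
    · simp
    · intro ha
      obtain ⟨i, hi, hki, he⟩ := hI a ha
      refine ⟨i, hi, lt_of_le_of_ne hki fun h' => h ?_, he⟩
      rw [← he, h']
  · have H₁ := hs.frame hf₁ (by simp [forC, Cmd.wv, hb]) (by simpa [forC, Cmd.wa, hb] using hA)
    have ex₁ : s₁.vars vZ = x := hf₁.var _ (by simp [forC, Cmd.wv, hb])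
    have ef₁ : s₁.arrays S = f := hf₁.arr S (by simpa [forC, Cmd.wa, hb] using hSA)
    have eg₁ : s₁.arrays T = g := hf₁.arr T (by simpa [forC, Cmd.wa, hb] using hTA)
    have hz₁ : ∀ a, s₁.arrays A a = 0 := by
      intro a
      by_contra h
      obtain ⟨i, hi, hni, -⟩ := hs₁ a h
      rw [hs.n] at hni
      omega
    refine (Run.straight (Q := fun s' => ∀ a, s'.arrays A a ≠ 0 ↔ a = x) rfl ?_).seq
      fun s₂ hf₂ hs₂ => ?_
    · intro a
      simp only [Cmd.run, Expr.eval, Function.update_self, ex₁, Function.update_apply, hz₁]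
      split_ifs with h <;> simp [h]
    have H₂ := H₁.frame hf₂ (by simp [Cmd.wv]) (by simpa [Cmd.wa] using hA)
    have ef₂ : s₂.arrays S = f := by rw [hf₂.arr S (by simpa [Cmd.wa] using hSA), ef₁]
    have eg₂ : s₂.arrays T = g := by rw [hf₂.arr T (by simpa [Cmd.wa] using hTA), eg₁]
    -- After `k` rounds the marked set is closed or has more than `k` elements.
    set marked : State → Finset ℕ := fun s' =>
      (Finset.range D.n).filter fun i => s'.arrays A (D.name i) ≠ 0 with hmarked
    have hname : ∀ a, Relation.ReflTransGen (D.Step f g) x a → ∃ i < D.n, D.name i = a := by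
      intro a ha
      rcases Relation.ReflTransGen.cases_tail ha with rfl | ⟨b, -, j, hj, -, -, -, rfl⟩
      · exact hx
      · exact hTm j hj
    refine (forC_spec (I := fun k s' =>
        (∀ a, s'.arrays A a ≠ 0 → Relation.ReflTransGen (D.Step f g) x a) ∧
        s'.arrays A x ≠ 0 ∧
        ((∀ a b, D.Step f g a b → s'.arrays A a ≠ 0 → s'.arrays A b ≠ 0) ∨
          k + 1 ≤ (marked s').card))
      (fun _ => C * D.m) (by simp [markScan, forC, Cmd.wv]) (by simp [markScan, forC, Cmd.wv])
      (by decide) ?_ ?_).mono ?_ ?_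
    · refine ⟨fun a ha => ((hs₂ a).1 ha) ▸ .refl, (hs₂ x).2 rfl, .inr ?_⟩
      obtain ⟨i, hi, he⟩ := hx
      refine Finset.card_pos.2 ⟨i, Finset.mem_filter.2 ⟨Finset.mem_range.2 hi, ?_⟩⟩
      exact (hs₂ _).2 he
    · rintro k s' hk hi hfr ⟨hI₁, hI₂, hI₃⟩
      have H := H₂.frame hfr (by simp [forC, markScan, Cmd.wv])
        (by simpa [forC, markScan, Cmd.wa] using hA)
      have ef : s'.arrays S = f := by
        rw [hfr.arr S (by simpa [forC, markScan, Cmd.wa] using hSA), ef₂]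
      have eg : s'.arrays T = g := by
        rw [hfr.arr T (by simpa [forC, markScan, Cmd.wa] using hTA), eg₂]
      have := hC D s' x H (by rwa [ef, eg])
      rw [ef, eg] at this
      refine this.mono le_rfl ?_
      rintro s'' - ⟨g1, g2, g3, g4⟩
      refine ⟨g2, g1 _ hI₂, ?_⟩
      rw [State.setVar_arrays]
      have hsub : marked s' ⊆ marked s'' := fun i hi => by
        rw [hmarked, Finset.mem_filter] at hi ⊢
        exact ⟨hi.1, g1 _ hi.2⟩
      rcases hI₃ with hcl | hcard
      · exact .inl fun a b hab ha => g1 _ (hcl a b hab (g4 hcl a ha))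
      · by_cases heq : marked s'' ⊆ marked s'
        · refine .inl fun a b hab ha => g3 a b hab ?_
          obtain ⟨i, hi, rfl⟩ := hname a (g2 a ha)
          exact (Finset.mem_filter.1 (heq (Finset.mem_filter.2 ⟨Finset.mem_range.2 hi, ha⟩))).2
        · have : (marked s').card < (marked s'').card := Finset.card_lt_card ⟨hsub, heq⟩
          exact .inr (show k + 1 + 1 ≤ (marked s'').card by omega)
    · rw [H₂.n, Finset.sum_const, Finset.card_range, smul_eq_mul]
    · rintro s' - ⟨hI₁, hI₂, hI₃⟩ a
      have hcl : ∀ a b, D.Step f g a b → s'.arrays A a ≠ 0 → s'.arrays A b ≠ 0 := by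
        refine hI₃.resolve_right fun h => ?_
        rw [H₂.n] at h
        have := Finset.card_filter_le (Finset.range D.n) fun i => s'.arrays A (D.name i) ≠ 0
        rw [Finset.card_range] at this
        have h' : D.n + 1 ≤ ((Finset.range D.n).filter
          fun i => s'.arrays A (D.name i) ≠ 0).card := h
        omega
      refine ⟨hI₁ a, fun ha => ?_⟩
      induction ha with
      | refl => exact hI₂
      | tail _ h ih => exact hcl _ _ h ih
  · rw [hs.n]
    have hm : D.n + 1 ≤ D.m := by simp [Data.m]
    have h1 : D.m ≤ D.m * (D.n + 1) := Nat.le_mul_of_pos_right _ (Nat.succ_pos _)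
    have h2 := Nat.mul_le_mul_left (body.maxCost + 7) (hm.trans h1)
    have h3 : D.n * (C * D.m + 7) ≤ (C + 7) * (D.m * (D.n + 1)) := by nlinarith
    have h4 : 1 ≤ D.m * (D.n + 1) := by omega
    nlinarith

/-- Sets the array `aRep` to a choice of representatives of the strongly connected components. Each
atom in turn is made the representative of its component, so that the last one prevails. -/
def repC : Cmd := forC vI vN
  (.assign vZ iName ;; markC aF aX2 aX1 ;; markC aB aX1 aX2 ;;
    forC vT vN (.ite (.and (.not (.eq (.get aF tName) (.const 0)))
      (.not (.eq (.get aB tName) (.const 0)))) (.store aRep tName (.var vZ)) .skip))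

theorem repC_spec : ∃ C, ∀ (D : Data) (s : State), Has D s →
    (∀ i < D.n, ∀ j < D.n, D.name i = D.name j → i = j) →
    (∀ j < D.q, ∃ i < D.n, D.name i = D.x1 j) → (∀ j < D.q, ∃ i < D.n, D.name i = D.x2 j) →
    (∀ a, s.arrays aF a = 0) → (∀ a, s.arrays aB a = 0) →
    Run repC s (C * D.m * (D.n + 1) ^ 2) (fun s' =>
      (∀ i < D.n, ∃ i' < D.n, D.name i' = s'.arrays aRep (D.name i) ∧
        Relation.ReflTransGen (D.Step D.x2 D.x1) (D.name i) (D.name i') ∧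
        Relation.ReflTransGen (D.Step D.x2 D.x1) (D.name i') (D.name i)) ∧
      ∀ i < D.n, ∀ i' < D.n, Relation.ReflTransGen (D.Step D.x2 D.x1) (D.name i) (D.name i') →
        Relation.ReflTransGen (D.Step D.x2 D.x1) (D.name i') (D.name i) →
        s'.arrays aRep (D.name i) = s'.arrays aRep (D.name i')) := by
  obtain ⟨C₁, h₁⟩ := markC_spec aF aX2 aX1 (by decide) (by decide) (by decide)
  obtain ⟨C₂, h₂⟩ := markC_spec aB aX1 aX2 (by decide) (by decide) (by decide)
  set body : Cmd := (.ite (.and (.not (.eq (.get aF tName) (.const 0)))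
      (.not (.eq (.get aB tName) (.const 0)))) (.store aRep tName (.var vZ)) .skip) with hb
  refine ⟨C₁ + C₂ + (body.maxCost + 7) + 16, fun D s hs hinj hm1 hm2 hF0 hB0 => ?_⟩
  set R := Relation.ReflTransGen (D.Step D.x2 D.x1) with hR
  set SC : ℕ → ℕ → Prop := fun a b => R a b ∧ R b a with hSC
  have hstep : ∀ a b, Relation.ReflTransGen (D.Step D.x1 D.x2) a b ↔ R b a := by
    intro a b
    rw [hR, ← Relation.reflTransGen_swap]
    have : D.Step D.x1 D.x2 = Function.swap (D.Step D.x2 D.x1) := by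
      ext a b
      exact ⟨fun ⟨j, hj, h1, h2, h3, h4⟩ => ⟨j, hj, h1, h2, h4, h3⟩,
        fun ⟨j, hj, h1, h2, h3, h4⟩ => ⟨j, hj, h1, h2, h4, h3⟩⟩
    rw [this]
  have hRname : ∀ a b, (∃ i < D.n, D.name i = a) → R a b → ∃ i < D.n, D.name i = b := by
    intro a b ha hab
    rcases Relation.ReflTransGen.cases_tail hab with rfl | ⟨c, -, j, hj, -, -, -, rfl⟩
    · exact ha
    · exact hm1 j hj
  have hRname' : ∀ a b, (∃ i < D.n, D.name i = b) → R a b → ∃ i < D.n, D.name i = a := by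
    intro a b hb hab
    rcases Relation.ReflTransGen.cases_head hab with rfl | ⟨c, ⟨j, hj, -, -, rfl, -⟩, -⟩
    · exact hb
    · exact hm2 j hj
  refine (forC_spec (I := fun k s' =>
      (∀ a, s'.arrays aF a ≠ 0 → ∃ i < D.n, D.name i = a) ∧
      (∀ a, s'.arrays aB a ≠ 0 → ∃ i < D.n, D.name i = a) ∧
      ∀ i' < D.n, (∀ i < k, ¬ SC (D.name i) (D.name i')) ∨
        ∃ i < D.n, i < k ∧ s'.arrays aRep (D.name i') = D.name i ∧ SC (D.name i) (D.name i') ∧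
          ∀ i₂ < k, SC (D.name i₂) (D.name i') → i₂ ≤ i)
    (fun _ => 3 + (C₁ * D.m * (D.n + 1) + (C₂ * D.m * (D.n + 1) + (body.maxCost + 7) * (D.n + 1))))
    (by decide) (by decide) (by decide) ?_ ?_).mono ?_ ?_
  · exact ⟨by simp [hF0], by simp [hB0], fun i' _ => .inl (by simp)⟩
  · rintro k s' hk hi hfr ⟨hI₁, hI₂, hI₃⟩
    rw [hs.n] at hk
    have H := hs.frame hfr (by decide) (by decide)
    refine (Run.straight (Q := fun s'' => s''.vars vZ = D.name k) rfl
      (by simp [Cmd.run, Expr.eval, H.name, hi])).seq fun t₁ gf₁ gs₁ => ?_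
    have G₁ := H.frame gf₁ (by decide) (by decide)
    have := h₁ D t₁ G₁ (by rw [gf₁.arr _ (by decide)]; exact hI₁)
      (by rw [gs₁]; exact ⟨k, hk, rfl⟩) (by rw [G₁.x1]; exact hm1)
    rw [G₁.x1, G₁.x2, gs₁] at this
    refine this.seq fun t₂ gf₂ gs₂ => ?_
    have G₂ := G₁.frame gf₂ (by decide) (by decide)
    have ez₂ : t₂.vars vZ = D.name k := by rw [gf₂.var _ (by decide), gs₁]
    have := h₂ D t₂ G₂ (by rw [gf₂.arr _ (by decide), gf₁.arr _ (by decide)]; exact hI₂)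
      (by rw [ez₂]; exact ⟨k, hk, rfl⟩) (by rw [G₂.x2]; exact hm2)
    rw [G₂.x1, G₂.x2, ez₂] at this
    refine this.seq fun t₃ gf₃ gs₃ => ?_
    have G₃ := G₂.frame gf₃ (by decide) (by decide)
    have ez₃ : t₃.vars vZ = D.name k := by rw [gf₃.var _ (by decide), ez₂]
    have hF₃ : ∀ a, t₃.arrays aF a ≠ 0 ↔ R (D.name k) a := by
      rw [gf₃.arr _ (by decide)]; exact gs₂
    have hB₃ : ∀ a, t₃.arrays aB a ≠ 0 ↔ R a (D.name k) := fun a => by rw [gs₃, hstep]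
    have hR₃ : t₃.arrays aRep = s'.arrays aRep := by
      rw [gf₃.arr _ (by decide), gf₂.arr _ (by decide), gf₁.arr _ (by decide)]
    refine (forC_straight (i := vT) (b := vN) (body := body) (I := fun k' s'' => ∀ i' < D.n,
        (i' < k' ∧ SC (D.name k) (D.name i') → s''.arrays aRep (D.name i') = D.name k) ∧
        (¬ SC (D.name k) (D.name i') →
          s''.arrays aRep (D.name i') = s'.arrays aRep (D.name i')))
      rfl (by decide) (by decide) (by decide) (by simp [hR₃]) ?_).mono (by rw [G₃.n])
        fun t₄ gf₄ gs₄ => ?_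
    · intro k' s'' hk' hi' hfr' hJ i' hin'
      rw [G₃.n] at hk'
      have G := G₃.frame hfr' (by decide) (by decide)
      have eF : s''.arrays aF = t₃.arrays aF := hfr'.arr _ (by decide)
      have eB : s''.arrays aB = t₃.arrays aB := hfr'.arr _ (by decide)
      have ez : s''.vars vZ = D.name k := by rw [hfr'.var _ (by decide), ez₃]
      rw [State.setVar_arrays]
      by_cases hc : SC (D.name k) (D.name k')
      · have hc' := (hF₃ (D.name k')).2 hc.1
        have hc'' := (hB₃ (D.name k')).2 hc.2
        have : (body.run s'').arrays aRep =
            Function.update (s''.arrays aRep) (D.name k') (D.name k) := by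
          simp [hb, Cmd.run, Test.eval, Expr.eval, G.name, hi', eF, eB, hc', hc'', ez]
        rw [this, Function.update_apply]
        split_ifs with h
        · exact ⟨fun _ => rfl, fun hn => absurd (h ▸ hc) hn⟩
        · refine ⟨fun h' => (hJ i' hin').1 ⟨?_, h'.2⟩, (hJ i' hin').2⟩
          exact lt_of_le_of_ne (by omega) fun h'' => h (h'' ▸ rfl)
      · have hc' : ¬ (¬ t₃.arrays aF (D.name k') = 0 ∧ ¬ t₃.arrays aB (D.name k') = 0) :=
          fun h => hc ⟨(hF₃ _).1 h.1, (hB₃ _).1 h.2⟩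
        have : body.run s'' = s'' := by
          simp only [hb, Cmd.run, Test.eval, Expr.eval, G.name, hi', eF, eB, hc', if_false]
        rw [this]
        refine ⟨fun h' => (hJ i' hin').1 ⟨?_, h'.2⟩, (hJ i' hin').2⟩
        refine lt_of_le_of_ne (by omega) fun h'' => hc ?_
        exact h'' ▸ h'.2
    · rw [State.setVar_arrays]
      refine ⟨fun a ha => ?_, fun a ha => ?_, fun i' hi' => ?_⟩
      · rw [gf₄.arr _ (by decide), hF₃] at ha
        exact hRname _ _ ⟨k, hk, rfl⟩ ha
      · rw [gf₄.arr _ (by decide), hB₃] at ha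
        exact hRname' _ _ ⟨k, hk, rfl⟩ ha
      · rw [G₃.n] at gs₄
        by_cases hc : SC (D.name k) (D.name i')
        · exact .inr ⟨k, hk, by omega, (gs₄ i' hi').1 ⟨hi', hc⟩, hc, fun i₂ h _ => by omega⟩
        · rcases hI₃ i' hi' with h | ⟨i, hin, hik, he, hsc, hmax⟩
          · refine .inl fun i hi => ?_
            rcases Nat.lt_succ_iff_lt_or_eq.1 hi with hi | rfl
            · exact h i hi
            · exact hc
          · refine .inr ⟨i, hin, by omega, by rw [(gs₄ i' hi').2 hc, he], hsc, fun i₂ h₂ hs₂ => ?_⟩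
            rcases Nat.lt_succ_iff_lt_or_eq.1 h₂ with h₂ | rfl
            · exact hmax i₂ h₂ hs₂
            · exact absurd hs₂ hc
  · rw [hs.n, Finset.sum_const, Finset.card_range, smul_eq_mul]
    have hm : D.n + 1 ≤ D.m := by simp [Data.m]
    set w := D.m * (D.n + 1) ^ 2 with hw
    have h1 : D.n * (D.m * (D.n + 1)) ≤ w := by
      have : w = D.n * (D.m * (D.n + 1)) + D.m * (D.n + 1) := by rw [hw]; ring
      omega
    have h2 : D.n * (D.n + 1) ≤ w := le_trans (Nat.mul_le_mul_left _ (by nlinarith)) h1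
    have h3 : D.n + 1 ≤ w := by
      have : w = (D.n + 1) * (D.m * (D.n + 1)) := by rw [hw]; ring
      rw [this]
      exact Nat.le_mul_of_pos_right _ (Nat.mul_pos (by omega) (by omega))
    have e1 := Nat.mul_le_mul_left C₁ h1
    have e2 := Nat.mul_le_mul_left C₂ h1
    have e3 := Nat.mul_le_mul_left (body.maxCost + 7) h2
    have e4 : (C₁ + C₂ + (body.maxCost + 7) + 16) * D.m * (D.n + 1) ^ 2 =
      C₁ * w + C₂ * w + (body.maxCost + 7) * w + 16 * w := by rw [hw]; ring
    rw [e4]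
    nlinarith
  · rintro s' - ⟨-, -, hI⟩
    rw [hs.n] at hI
    have hI' : ∀ i' < D.n, ∃ i < D.n, s'.arrays aRep (D.name i') = D.name i ∧
        SC (D.name i) (D.name i') ∧ ∀ i₂ < D.n, SC (D.name i₂) (D.name i') → i₂ ≤ i := by
      intro i' hi'
      rcases hI i' hi' with h | ⟨i, hi, -, h⟩
      · exact absurd ⟨.refl, .refl⟩ (h i' hi')
      · exact ⟨i, hi, h⟩
    refine ⟨fun i hi => ?_, fun i hi i' hi' h h' => ?_⟩
    · obtain ⟨i', hi', he, hsc, -⟩ := hI' i hi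
      exact ⟨i', hi', he.symm, hsc.2, hsc.1⟩
    · obtain ⟨k, hk, he, hsc, hmax⟩ := hI' i hi
      obtain ⟨k', hk', he', hsc', hmax'⟩ := hI' i' hi'
      have h1 := hmax' k hk ⟨hsc.1.trans h, h'.trans hsc.2⟩
      have h2 := hmax k' hk' ⟨hsc'.1.trans h', h.trans hsc'.2⟩
      obtain rfl : k = k' := by omega
      rw [he, he']

end MinModels

namespace MinModels

/-- Replaces the atoms of the pairs by their representatives. -/
def substC : Cmd := forC vJ vQ
  (.store aX1 (.var vJ) (.get aRep jX1) ;; .store aX2 (.var vJ) (.get aRep jX2))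

theorem substC_spec : ∃ C, ∀ (D : Data) (s : State), Has D s →
    Run substC s (C * D.m) (fun s' => ∀ j < D.q,
      s'.arrays aX1 j = s.arrays aRep (D.x1 j) ∧ s'.arrays aX2 j = s.arrays aRep (D.x2 j)) := by
  refine ⟨_, fun D s hs => (forC_straight (I := fun k s' => ∀ j < D.q,
      (j < k → s'.arrays aX1 j = s.arrays aRep (D.x1 j) ∧
        s'.arrays aX2 j = s.arrays aRep (D.x2 j)) ∧
      (k ≤ j → s'.arrays aX1 j = D.x1 j ∧ s'.arrays aX2 j = D.x2 j))
    rfl (by decide) (by decide) (by decide) (by simp [hs.x1, hs.x2]) ?_).mono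
      (Nat.mul_le_mul_left _ (by simp only [hs.q, Data.m]; omega)) fun s' _ h j hj => ?_⟩
  · intro k s' hk hi hf hI j hj
    rw [hs.q] at hk
    have eR : s'.arrays aRep = s.arrays aRep := hf.arr _ (by decide)
    obtain ⟨e1, e2⟩ := (hI k hk).2 le_rfl
    obtain ⟨I1, I2⟩ := hI j hj
    have h1 : ((Cmd.store aX1 (.var vJ) (.get aRep jX1) ;;
        .store aX2 (.var vJ) (.get aRep jX2)).run s').arrays aX1 =
        Function.update (s'.arrays aX1) k (s.arrays aRep (D.x1 k)) := by
      simp [Cmd.run, Expr.eval, hi, eR, e1]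
    have h2 : ((Cmd.store aX1 (.var vJ) (.get aRep jX1) ;;
        .store aX2 (.var vJ) (.get aRep jX2)).run s').arrays aX2 =
        Function.update (s'.arrays aX2) k (s.arrays aRep (D.x2 k)) := by
      simp [Cmd.run, Expr.eval, hi, eR, e2]
    rw [State.setVar_arrays, h1, h2, Function.update_apply, Function.update_apply]
    split_ifs with h
    · subst h
      exact ⟨fun _ => ⟨rfl, rfl⟩, fun h => by omega⟩
    · exact ⟨fun h' => I1 (by omega), fun h' => I2 (by omega)⟩
  · rw [hs.q] at h
    exact (h j hj).1 hj

/-- Stores in `aTmp` the valuation in which exactly the representatives are undecided. -/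
def initC : Cmd := forC vT vN
  (.ite (.eq (.get aRep tName) tName) (.store aTmp tName (.const 0)) (.store aTmp tName (.const 2)))

/-- The valuation in which exactly the representatives are undecided. -/
def initVal (rep : ℕ → ℕ) (a : ℕ) : ℕ := if rep a = a then 0 else 2

theorem initC_spec : ∃ C, ∀ (D : Data) (s : State), Has D s →
    Run initC s (C * D.m) (fun s' => ∀ i < D.n,
      s'.arrays aTmp (D.name i) = initVal (s.arrays aRep) (D.name i)) := by
  set body : Cmd := .ite (.eq (.get aRep tName) tName) (.store aTmp tName (.const 0))
    (.store aTmp tName (.const 2)) with hb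
  refine ⟨body.maxCost + 7, fun D s hs => (forC_straight (i := vT) (b := vN) (body := body)
    (I := fun k s' => ∀ i < k, s'.arrays aTmp (D.name i) = initVal (s.arrays aRep) (D.name i))
    rfl (by decide) (by decide) (by decide) (by simp) ?_).mono
      (Nat.mul_le_mul_left _ (by simp only [hs.n, Data.m]; omega))
      fun s' _ h => by rwa [hs.n] at h⟩
  intro k s' hk hi hf hI i hik
  have H := hs.frame hf (by decide) (by decide)
  have eR : s'.arrays aRep = s.arrays aRep := hf.arr _ (by decide)
  have : (body.run s').arrays aTmp =
      Function.update (s'.arrays aTmp) (D.name k) (initVal (s.arrays aRep) (D.name k)) := by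
    by_cases hc : s.arrays aRep (D.name k) = D.name k <;>
      simp [hb, Cmd.run, Test.eval, Expr.eval, H.name, hi, eR, hc, initVal]
  rw [State.setVar_arrays, this]
  by_cases h : D.name i = D.name k
  · rw [h, Function.update_self]
  · rw [Function.update_of_ne h]
    exact hI i (lt_of_le_of_ne (by omega) fun h' => h (h' ▸ rfl))

/-- The instance held by the memory. -/
def State.data (s : State) : Data where
  n := s.vars vN
  q := s.vars vQ
  name := s.arrays aName
  k1 := s.arrays aK1
  x1 := s.arrays aX1
  k2 := s.arrays aK2
  x2 := s.arrays aX2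

theorem State.has_data (s : State) : Has s.data s := ⟨rfl, rfl, rfl, rfl, rfl, rfl, rfl⟩

/-- The data `D` represent the clauses `L`, with their own atoms. -/
structure Parsed (D : Data) (L : List (List (ℕ × ℕ))) : Prop where
  inj : ∀ i < D.n, ∀ j < D.n, D.name i = D.name j → i = j
  names : ∀ a, a ∈ clauseAtoms L ↔ ∃ i < D.n, D.name i = a
  pairs : ∀ l l', Pairs L l l' ↔
    ∃ j < D.q, D.k1 j = l.1 ∧ D.x1 j = l.2 ∧ D.k2 j = l'.1 ∧ D.x2 j = l'.2

theorem Parsed.reach {D : Data} {L : List (List (ℕ × ℕ))} (h : Parsed D L) :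
    Relation.ReflTransGen (D.Step D.x2 D.x1) = Reach L := by
  have : D.Step D.x2 D.x1 = fun a c => Pairs L (3, c) (1, a) := by
    ext a c
    rw [h.pairs]
    exact ⟨fun ⟨j, hj, h1, h2, h3, h4⟩ => ⟨j, hj, h1, h4, h2, h3⟩,
      fun ⟨j, hj, h1, h2, h3, h4⟩ => ⟨j, hj, h1, h3, h4, h2⟩⟩
  rw [this]
  rfl

theorem Parsed.mem {D : Data} {L : List (List (ℕ × ℕ))} (h : Parsed D L) {j : ℕ} (hj : j < D.q) :
    Pairs L (D.k1 j, D.x1 j) (D.k2 j, D.x2 j) := (h.pairs _ _).2 ⟨j, hj, rfl, rfl, rfl, rfl⟩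

theorem Parsed.represents {D D' : Data} {L : List (List (ℕ × ℕ))} (h : Parsed D L) (hL : IsTwo L)
    {rep : ℕ → ℕ} (en : D'.n = D.n) (eq : D'.q = D.q) (ename : D'.name = D.name)
    (ek1 : D'.k1 = D.k1) (ek2 : D'.k2 = D.k2)
    (ex : ∀ j < D.q, D'.x1 j = rep (D.x1 j) ∧ D'.x2 j = rep (D.x2 j))
    (hrep : ∀ i < D.n, ∃ i' < D.n, D.name i' = rep (D.name i) ∧
      Relation.ReflTransGen (D.Step D.x2 D.x1) (D.name i) (D.name i') ∧
      Relation.ReflTransGen (D.Step D.x2 D.x1) (D.name i') (D.name i))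
    (hrep' : ∀ i < D.n, ∀ i' < D.n,
      Relation.ReflTransGen (D.Step D.x2 D.x1) (D.name i) (D.name i') →
      Relation.ReflTransGen (D.Step D.x2 D.x1) (D.name i') (D.name i) →
      rep (D.name i) = rep (D.name i')) : Represents D' rep L := by
  rw [h.reach] at hrep hrep'
  refine ⟨hL, ?_, ?_, ?_, ?_, ?_, ?_, ?_⟩
  · rw [en, ename]; exact h.inj
  · rw [en, ename]; exact h.names
  · intro l l' hp
    obtain ⟨j, hj, h1, h2, h3, h4⟩ := (h.pairs l l').1 hp
    rw [eq, ek1, ek2]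
    exact ⟨j, hj, h1, by rw [(ex j hj).1, h2], h3, by rw [(ex j hj).2, h4]⟩
  · intro j hj
    rw [eq] at hj
    rw [ek1, ek2, (ex j hj).1, (ex j hj).2]
    exact ⟨_, _, h.mem hj, rfl, rfl, rfl, rfl⟩
  · intro a ha
    obtain ⟨i, hi, rfl⟩ := (h.names a).1 ha
    obtain ⟨i', hi', he, -⟩ := hrep i hi
    exact (h.names _).2 ⟨i', hi', he⟩
  · intro a ha
    obtain ⟨i, hi, rfl⟩ := (h.names a).1 ha
    obtain ⟨i', hi', he, h1, h2⟩ := hrep i hi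
    exact ⟨he ▸ h1, he ▸ h2⟩
  · intro a ha b hb hab hba
    obtain ⟨i, hi, rfl⟩ := (h.names a).1 ha
    obtain ⟨i', hi', rfl⟩ := (h.names b).1 hb
    exact hrep' i hi i' hi' hab hba

/-- The computation of all answer sets of the clauses in memory. -/
def solveC : Cmd := repC ;; substC ;; initC ;; pushC ;; searchC

/-- The computation outputs each answer set, in time `O(m * root ^ n)`. Collapsing the components
takes polynomial time, which `root ^ n` dominates. -/
theorem solveC_spec : ∃ C : ℝ, 0 ≤ C ∧ ∀ (D : Data) (L : List (List (ℕ × ℕ))) (s : State), Has D s →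
    Parsed D L → IsTwo L → s.vars vCnt = 0 → s.vars vSp = 0 →
    (∀ a, s.arrays aF a = 0) → (∀ a, s.arrays aB a = 0) →
    ∃ (t : ℕ) (s' : State) (outs : List (List ℕ)), Exec solveC s t s' ∧
      s'.output = s.output ++ outs.flatMap encodeList ∧ (∀ l ∈ outs, l.Nodup) ∧
      (∀ M, IsAns L M ↔ ∃ l ∈ outs, l.toFinset = M) ∧ (t : ℝ) ≤ C * D.m * root ^ D.n := by
  obtain ⟨C₁, h₁⟩ := repC_spec
  obtain ⟨C₂, h₂⟩ := substC_spec
  obtain ⟨C₃, h₃⟩ := initC_spec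
  obtain ⟨C₄, h₄⟩ := pushC_spec
  obtain ⟨C₅, h₅⟩ := search_tree
  obtain ⟨S, hS0, hS⟩ := exists_weight_le
  refine ⟨(C₁ + C₂ + C₃ + C₄ + C₅ + 4 : ℕ) * S, by positivity,
    fun D L s hs hp hL hcnt hsp hF hB => ?_⟩
  obtain ⟨t₁, s₁, x₁, b₁, hrep, hrep'⟩ := h₁ D s hs hp.inj
    (fun j hj => (hp.names _).1 (hp.mem hj).atom) (fun j hj => (hp.names _).1 (hp.mem hj).symm.atom)
    hF hB
  have hf₁ := x₁.frame
  have H₁ := hs.frame hf₁ (by decide) (by decide)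
  set rep := s₁.arrays aRep with hrepd
  obtain ⟨t₂, s₂, x₂, b₂, hsub⟩ := h₂ D s₁ H₁
  have hf₂ := x₂.frame
  set D' := s₂.data with hD'
  have H₂ : Has D' s₂ := s₂.has_data
  have en : D'.n = D.n := by rw [← H₁.n]; exact hf₂.var _ (by decide)
  have eq : D'.q = D.q := by rw [← H₁.q]; exact hf₂.var _ (by decide)
  have ename : D'.name = D.name := by rw [← H₁.name]; exact hf₂.arr _ (by decide)
  have ek1 : D'.k1 = D.k1 := by rw [← H₁.k1]; exact hf₂.arr _ (by decide)
  have ek2 : D'.k2 = D.k2 := by rw [← H₁.k2]; exact hf₂.arr _ (by decide)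
  have em : D'.m = D.m := by simp only [Data.m, en, eq]
  have hR := hp.represents hL en eq ename ek1 ek2 hsub hrep hrep'
  have hok := hR.ok
  have eR₂ : s₂.arrays aRep = rep := hf₂.arr _ (by decide)
  obtain ⟨t₃, s₃, x₃, b₃, hinit⟩ := h₃ D' s₂ H₂
  rw [eR₂] at hinit
  have hf₃ := x₃.frame
  have H₃ := H₂.frame hf₃ (by decide) (by decide)
  have hstk : Stk D' s₃ [] := by
    refine ⟨?_, ?_, by simp⟩
    · rw [hf₃.var _ (by decide), hf₂.var _ (by decide), hf₁.var _ (by decide), hcnt]; rfl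
    · rw [hf₃.var _ (by decide), hf₂.var _ (by decide), hf₁.var _ (by decide), hsp]; rfl
  obtain ⟨t₄, s₄, x₄, b₄, hstk₄⟩ := h₄ D' s₃ [] (initVal rep) H₃ hstk hinit
  have hf₄ := x₄.frame
  have H₄ := H₃.frame hf₄ (by decide) (by decide)
  have eR₄ : s₄.arrays aRep = rep := by rw [hf₄.arr _ (by decide), hf₃.arr _ (by decide), eR₂]
  have eO₄ : s₄.output = s.output := by
    rw [hf₄.out rfl, hf₃.out rfl, hf₂.out rfl, hf₁.out rfl]
  have hrepn : ∀ i < D'.n, ∃ i' < D'.n, D'.name i' = rep (D'.name i) := by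
    rw [en, ename]
    intro i hi
    obtain ⟨i', hi', he, -⟩ := hrep i hi
    exact ⟨i', hi', he⟩
  obtain ⟨t₅, s₅, outs, hit, hinv, hout, houts, b₅⟩ := h₅ D' rep hok hrepn D'.n s₄ [] (initVal rep)
    ((Finset.card_filter_le _ _).trans (by simp))
    (fun i _ => by unfold initVal; split_ifs <;> omega) ⟨H₄, eR₄, hstk₄⟩
  have x₅ : Exec searchC s₄ (t₅ + 4) s₅ := by
    refine hit _ _ (Exec.loop_false ?_)
    simp [Test.eval, Expr.eval, hinv.stk.cnt]
  have hmem : ∀ τ a, a ∈ (D'.outList rep τ D'.n).toFinset ↔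
      a ∈ clauseAtoms L ∧ τ (rep a) = 1 := by
    intro τ a
    rw [hR.names]
    simp [Data.outList]
  refine ⟨_, s₅, outs, .seq x₁ (.seq x₂ (.seq x₃ (.seq x₄ x₅))), by rw [hout, eO₄], ?_, ?_, ?_⟩
  · intro l hl
    obtain ⟨τ, -, rfl⟩ := houts.1 l hl
    refine List.Nodup.filter _ ?_
    refine (List.nodup_map_iff_inj_on List.nodup_range).2 fun i hi j hj => ?_
    exact hR.inj i (List.mem_range.1 hi) j (List.mem_range.1 hj)
  · intro M
    constructor
    · intro hM
      obtain ⟨τ, hτ, hτ2, hτM⟩ := hR.good_of_isAns hM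
      refine ⟨_, houts.2 τ hτ fun i hi h0 => ?_, ?_⟩
      · have hne : rep (D'.name i) ≠ D'.name i := fun h => h0 (by simp [initVal, h])
        rw [hτ2 _ ((hR.names _).2 ⟨i, hi, rfl⟩) hne]
        simp [initVal, hne]
      · ext a
        rw [hmem]
        exact ⟨fun h => (hτM a h.1).1 h.2, fun h => ⟨hM.subset h, (hτM a (hM.subset h)).2 h⟩⟩
    · rintro ⟨l, hl, rfl⟩
      obtain ⟨τ, hτ, rfl⟩ := houts.1 l hl
      exact hR.isAns_of_good hτ fun a => hmem τ a
  · rw [em] at b₃ b₄ b₅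
    rw [en] at b₅
    have hm : 1 ≤ D.m := by simp [Data.m]
    set w := D.m * (D.n + 1) ^ 2 with hw
    have hw1 : D.m ≤ w := Nat.le_mul_of_pos_right _ (by positivity)
    have b1 : t₁ ≤ C₁ * w := by rw [hw, ← mul_assoc]; exact b₁
    have b2 : t₂ ≤ C₂ * w := b₂.trans (Nat.mul_le_mul_left _ hw1)
    have b3 : t₃ ≤ C₃ * w := b₃.trans (Nat.mul_le_mul_left _ hw1)
    have b4 : t₄ ≤ C₄ * w := b₄.trans (Nat.mul_le_mul_left _ hw1)
    have b' : t₁ + (t₂ + (t₃ + (t₄ + 4))) ≤ (C₁ + C₂ + C₃ + C₄ + 4) * w := by nlinarith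
    have b'' : ((t₁ + (t₂ + (t₃ + (t₄ + 4))) : ℕ) : ℝ) ≤ (C₁ + C₂ + C₃ + C₄ + 4 : ℕ) * (w : ℝ) := by
      exact_mod_cast b'
    have hwr : (w : ℝ) ≤ D.m * (root ^ D.n * S) := by
      rw [hw]
      push_cast
      refine mul_le_mul_of_nonneg_left ((sq_le_root_pow D.n).trans ?_) (by positivity)
      exact mul_le_mul_of_nonneg_left (hS _) (pow_nonneg root_pos.le _)
    have b6 : searchBound (C₅ * D.m) D.n ≤ C₅ * (D.m * (root ^ D.n * S)) := by
      unfold searchBound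
      rw [mul_assoc]
      refine mul_le_mul_of_nonneg_left (mul_le_mul_of_nonneg_left ?_ (by positivity))
        (by positivity)
      exact mul_le_mul_of_nonneg_left (hS _) (pow_nonneg root_pos.le _)
    have b7 := mul_le_mul_of_nonneg_left hwr (Nat.cast_nonneg (α := ℝ) (C₁ + C₂ + C₃ + C₄ + 4))
    push_cast at b'' b7 ⊢
    nlinarith

end MinModels

namespace MinModels

/-! ### Reading the input -/

theorem mem_clauseAtoms {L : List (List (ℕ × ℕ))} {a : ℕ} :
    a ∈ clauseAtoms L ↔ ∃ c ∈ L, ∃ l ∈ c, l.2 = a := by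
  simp only [clauseAtoms, List.mem_toFinset, List.mem_map, List.mem_flatten]
  exact ⟨fun ⟨l, ⟨c, hc, hl⟩, h⟩ => ⟨c, hc, l, hl, h⟩, fun ⟨c, hc, l, hl, h⟩ => ⟨l, ⟨c, hc, hl⟩, h⟩⟩

/-- The state of the reader: `cs` are the clauses already stored, `buf` are the literals of the
current clause read so far, and `rest` is the unread part of the input. Of the literals in `buf`,
only the first one and the last one are held in registers. -/
structure Reading (cs : List (List (ℕ × ℕ))) (buf : List (ℕ × ℕ)) (rest : List ℕ) (s : State) :
    Prop where
  input : ∀ i, s.arrays aIn (s.vars vPos + i) = rest.getD i 0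
  len : s.vars vLen = buf.length
  q : s.vars vQ = 2 * cs.length
  inj : ∀ i < s.vars vN, ∀ j < s.vars vN, s.arrays aName i = s.arrays aName j → i = j
  seen : ∀ a, s.arrays aSeen a ≠ 0 ↔ a ∈ clauseAtoms (buf :: cs)
  names : ∀ a, a ∈ clauseAtoms (buf :: cs) ↔ ∃ i < s.vars vN, s.arrays aName i = a
  pairs : ∀ l l', Pairs cs l l' ↔ ∃ j < s.vars vQ, s.arrays aK1 j = l.1 ∧ s.arrays aX1 j = l.2 ∧
    s.arrays aK2 j = l'.1 ∧ s.arrays aX2 j = l'.2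
  head : ∀ l ∈ buf.head?, s.vars rK1 = l.1 ∧ s.vars rX1 = l.2
  last : ∀ l ∈ buf.getLast?, s.vars rK2 = l.1 ∧ s.vars rX2 = l.2

theorem Reading.frame {cs : List (List (ℕ × ℕ))} {buf : List (ℕ × ℕ)} {rest : List ℕ}
    {s s' : State} {p : Cmd} (h : Reading cs buf rest s) (hf : Frame p s s')
    (hv : ∀ x ∈ [vN, vQ, vPos, vLen, rK1, rX1, rK2, rX2], x ∉ p.wv)
    (ha : ∀ A ∈ [aIn, aSeen, aName, aK1, aX1, aK2, aX2], A ∉ p.wa) : Reading cs buf rest s' := by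
  simp only [List.mem_cons, List.not_mem_nil, or_false, forall_eq_or_imp, forall_eq] at hv ha
  obtain ⟨v1, v2, v3, v4, v5, v6, v7, v8⟩ := hv
  obtain ⟨a1, a2, a3, a4, a5, a6, a7⟩ := ha
  have hv := fun x (hx : x ∉ p.wv) => hf.var x hx
  have ha := fun A (hA : A ∉ p.wa) => hf.arr A hA
  constructor
  · rw [ha _ a1, hv _ v3]; exact h.input
  · rw [hv _ v4]; exact h.len
  · rw [hv _ v2]; exact h.q
  · rw [hv _ v1, ha _ a3]; exact h.inj
  · rw [ha _ a2]; exact h.seen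
  · rw [hv _ v1, ha _ a3]; exact h.names
  · rw [hv _ v2, ha _ a4, ha _ a5, ha _ a6, ha _ a7]; exact h.pairs
  · rw [hv _ v5, hv _ v6]; exact h.head
  · rw [hv _ v7, hv _ v8]; exact h.last

/-- Reads an atom, and adds the literal of kind `vKind` with this atom to the current clause. -/
def litC : Cmd :=
  .ite (.eq (.var vLen) (.const 0)) (.assign rK1 (.var vKind) ;; .assign rX1 inNext) .skip ;;
  .assign rK2 (.var vKind) ;; .assign rX2 inNext ;;
  .ite (.eq (.get aSeen (.var rX2)) (.const 0))
    (.store aSeen (.var rX2) (.const 1) ;; .store aName (.var vN) (.var rX2) ;;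
      .assign vN (.succ (.var vN))) .skip ;;
  .assign vLen (.succ (.var vLen)) ;; .assign vPos (.succ (.var vPos))

theorem litC_spec {cs : List (List (ℕ × ℕ))} {buf : List (ℕ × ℕ)} {a : ℕ} {rest : List ℕ}
    {s : State} (h : Reading cs buf (a :: rest) s) :
    Run litC s litC.maxCost (Reading cs (buf ++ [(s.vars vKind, a)]) rest) := by
  have ha : s.arrays aIn (s.vars vPos) = a := by simpa using h.input 0
  have hi : ∀ i, s.arrays aIn (s.vars vPos + 1 + i) = rest.getD i 0 := fun i => by
    have := h.input (i + 1)
    rw [add_assoc, add_comm 1 i, this]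
    simp
  have hat : ∀ b, b ∈ clauseAtoms ((buf ++ [(s.vars vKind, a)]) :: cs) ↔
      b ∈ clauseAtoms (buf :: cs) ∨ b = a := by
    intro b
    simp only [mem_clauseAtoms, List.mem_cons, exists_eq_or_imp, List.mem_append,
      List.not_mem_nil, or_false]
    constructor
    · rintro (⟨l, hl | rfl, h⟩ | h)
      · exact .inl (.inl ⟨l, hl, h⟩)
      · exact .inr h.symm
      · exact .inl (.inr h)
    · rintro ((⟨l, hl, h⟩ | h) | rfl)
      · exact .inl ⟨l, .inl hl, h⟩
      · exact .inr h
      · exact .inl ⟨_, .inr rfl, rfl⟩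
  have hseen := h.seen a
  have hnames := h.names
  have hlast : ∀ (t : State), t.vars rK2 = s.vars vKind → t.vars rX2 = a →
      ∀ l ∈ (buf ++ [(s.vars vKind, a)]).getLast?, t.vars rK2 = l.1 ∧ t.vars rX2 = l.2 := by
    intro t h1 h2 l hl
    simp at hl
    subst hl
    exact ⟨h1, h2⟩
  have hhead : ∀ (t : State),
      (buf = [] → t.vars rK1 = s.vars vKind ∧ t.vars rX1 = a) →
      (buf ≠ [] → t.vars rK1 = s.vars rK1 ∧ t.vars rX1 = s.vars rX1) →
      ∀ l ∈ (buf ++ [(s.vars vKind, a)]).head?, t.vars rK1 = l.1 ∧ t.vars rX1 = l.2 := by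
    intro t h1 h2 l hl
    rcases buf with _ | ⟨b, buf⟩
    · simp at hl
      subst hl
      exact h1 rfl
    · obtain ⟨e1, e2⟩ := h2 (by simp)
      rw [e1, e2]
      exact h.head l (by simpa using hl)
  have hemp : s.vars vLen = 0 ↔ buf = [] := by rw [h.len]; exact List.length_eq_zero_iff
  refine Run.straight rfl ?_
  set t := litC.run s with ht
  have ev : t.vars vPos = s.vars vPos + 1 ∧ t.vars vLen = s.vars vLen + 1 ∧ t.vars vQ = s.vars vQ ∧
      t.vars rK2 = s.vars vKind ∧ t.vars rX2 = a ∧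
      (∀ A ∈ [aIn, aK1, aX1, aK2, aX2], t.arrays A = s.arrays A) ∧
      (buf = [] → t.vars rK1 = s.vars vKind ∧ t.vars rX1 = a) ∧
      (buf ≠ [] → t.vars rK1 = s.vars rK1 ∧ t.vars rX1 = s.vars rX1) := by
    by_cases hb : buf = [] <;> by_cases hc : s.arrays aSeen a = 0 <;>
      simp [ht, litC, Cmd.run, Test.eval, Expr.eval, hemp, hb, ha, hc]
  obtain ⟨v1, v2, v3, v4, v5, v6, v7, v8⟩ := ev
  simp only [List.mem_cons, List.not_mem_nil, or_false, forall_eq_or_imp, forall_eq] at v6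
  obtain ⟨w1, w2, w3, w4, w5⟩ := v6
  by_cases hc : s.arrays aSeen a = 0
  · have hnew : ∀ i < s.vars vN, s.arrays aName i ≠ a := fun i hi he =>
      hseen.2 ((hnames a).2 ⟨i, hi, he⟩) hc
    have e1 : t.vars vN = s.vars vN + 1 ∧
        t.arrays aSeen = Function.update (s.arrays aSeen) a 1 ∧
        t.arrays aName = Function.update (s.arrays aName) (s.vars vN) a := by
      by_cases hb : buf = [] <;>
        simp [ht, litC, Cmd.run, Test.eval, Expr.eval, hemp, hb, ha, hc]
    obtain ⟨e1, e2, e3⟩ := e1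
    have e4 : ∀ i < s.vars vN, Function.update (s.arrays aName) (s.vars vN) a i =
        s.arrays aName i := fun i hi => Function.update_of_ne hi.ne _ _
    refine ⟨?_, by simp [v2, h.len], by rw [v3, h.q], ?_, ?_, ?_, ?_, hhead t v7 v8,
      hlast t v4 v5⟩
    · rw [w1, v1]; exact hi
    · rw [e1, e3]
      intro i hi j hj
      rcases Nat.lt_succ_iff_lt_or_eq.1 hi with hi | rfl <;>
        rcases Nat.lt_succ_iff_lt_or_eq.1 hj with hj | rfl
      · rw [e4 i hi, e4 j hj]; exact h.inj i hi j hj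
      · rw [e4 i hi, Function.update_self]; exact fun h => absurd h (hnew i hi)
      · rw [e4 j hj, Function.update_self]; exact fun h => absurd h.symm (hnew j hj)
      · exact fun _ => rfl
    · intro b
      rw [e2, hat, Function.update_apply]
      by_cases hb : b = a
      · simp [hb]
      · simp [hb, h.seen b]
    · intro b
      rw [hat, hnames, e1, e3, exists_lt_succ, Function.update_self, eq_comm (a := a)]
      refine or_congr_left (exists_congr fun i => and_congr_right fun hi => ?_)
      rw [e4 i hi]
    · rw [v3, w2, w3, w4, w5]; exact h.pairs
  · have e1 : t.vars vN = s.vars vN ∧ t.arrays aSeen = s.arrays aSeen ∧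
        t.arrays aName = s.arrays aName := by
      by_cases hb : buf = [] <;>
        simp [ht, litC, Cmd.run, Test.eval, Expr.eval, hemp, hb, ha, hc]
    obtain ⟨e1, e2, e3⟩ := e1
    have hold : ∀ b, b ∈ clauseAtoms (buf :: cs) ∨ b = a ↔ b ∈ clauseAtoms (buf :: cs) :=
      fun b => ⟨fun h => h.elim id fun h => h ▸ hseen.1 hc, .inl⟩
    refine ⟨?_, by simp [v2, h.len], by rw [v3, h.q], by rw [e1, e3]; exact h.inj, ?_, ?_, ?_,
      hhead t v7 v8, hlast t v4 v5⟩
    · rw [w1, v1]; exact hi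
    · intro b
      rw [e2, hat, hold, h.seen]
    · intro b
      rw [hat, hold, hnames, e1, e3]
    · rw [v3, w2, w3, w4, w5]; exact h.pairs

/-- Reads a list: its length, then as many items, each by means of `body`. -/
def listC (body : Cmd) : Cmd :=
  .assign vSize inNext ;; .assign vPos (.succ (.var vPos)) ;; forC vRead vSize body

theorem listC_spec {Y : Type*} {enc : Y → List ℕ} {lit : Y → ℕ × ℕ} {body : Cmd} {T : ℕ}
    (h1 : vRead ∉ body.wv) (h2 : vSize ∉ body.wv)
    (hbody : ∀ cs buf y rest s, Reading cs buf (enc y ++ rest) s →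
      Run body s T (Reading cs (buf ++ [lit y]) rest))
    {cs : List (List (ℕ × ℕ))} {buf : List (ℕ × ℕ)} {ys : List Y} (hys : ys.length ≤ 2)
    {rest : List ℕ} {s : State} (h : Reading cs buf (ys.length :: (ys.flatMap enc ++ rest)) s) :
    Run (listC body) s (2 * T + 26) (Reading cs (buf ++ ys.map lit) rest) := by
  have hn : s.arrays aIn (s.vars vPos) = ys.length := by simpa using h.input 0
  have hi : ∀ i, s.arrays aIn (s.vars vPos + 1 + i) = (ys.flatMap enc ++ rest).getD i 0 :=
    fun i => by
      have := h.input (i + 1)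
      rw [add_assoc, add_comm 1 i, this]
      simp
  refine ((Run.straight (p := .assign vSize inNext) (Q := fun s' => s'.vars vSize = ys.length) rfl
    (by simp [Cmd.run, Expr.eval, hn])).seq (U := 3 + (6 + 2 * (T + 7))) fun s₁ f₁ e₁ => ?_).mono
      (by simp [Cmd.maxCost, Expr.cost]; omega) fun _ _ h => h
  have H₁ := h.frame f₁ (by decide) (by decide)
  refine (Run.straight (p := .assign vPos (.succ (.var vPos)))
    (Q := fun s' => s'.vars vSize = ys.length ∧
      Reading cs buf (ys.flatMap enc ++ rest) s') rfl ?_).seq fun s₂ f₂ ⟨e₂, H₂⟩ => ?_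
  · refine ⟨by simpa [Cmd.run] using e₁, ?_⟩
    have hi₁ : ∀ i, s₁.arrays aIn (s₁.vars vPos + 1 + i) = (ys.flatMap enc ++ rest).getD i 0 := by
      rw [f₁.arr _ (by decide), f₁.var _ (by decide)]
      exact hi
    exact ⟨by simpa [Cmd.run, Expr.eval] using hi₁, by simpa [Cmd.run] using H₁.len,
      by simpa [Cmd.run] using H₁.q, by simpa [Cmd.run] using H₁.inj,
      by simpa [Cmd.run] using H₁.seen, by simpa [Cmd.run] using H₁.names,
      by simpa [Cmd.run] using H₁.pairs, by simpa [Cmd.run] using H₁.head,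
      by simpa [Cmd.run] using H₁.last⟩
  · have hset : ∀ {buf rest k s'}, Reading cs buf rest s' →
        Reading cs buf rest (State.setVar s' vRead k) := fun {buf rest k s'} h =>
      h.frame (p := .assign vRead (.const k)) (Exec.assign vRead (.const k) s').frame
        (by simp [Cmd.wv]) (by simp [Cmd.wa])
    refine (forC_spec (I := fun k => Reading cs (buf ++ (ys.take k).map lit)
      ((ys.drop k).flatMap enc ++ rest)) (fun _ => T) h1 h2 (by decide) ?_ ?_).mono ?_ ?_
    · simpa using hset H₂
    · intro k s' hk _ _ hR
      rw [e₂] at hk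
      rw [List.drop_eq_getElem_cons hk, List.flatMap_cons, List.append_assoc] at hR
      refine (hbody _ _ _ _ _ hR).mono le_rfl fun s'' _ h' => hset ?_
      rw [List.take_succ_eq_append_getElem hk, List.map_append, ← List.append_assoc]
      exact h'
    · rw [e₂, Finset.sum_const, Finset.card_range, smul_eq_mul]
      have := Nat.mul_le_mul_right (T + 7) hys
      omega
    · intro s' _ h'
      simpa [e₂] using h'

/-- Stores the current clause as two ordered pairs; an empty clause stops the reader. -/
def clauseC : Cmd :=
  .ite (.eq (.var vLen) (.const 0)) (.assign vOk (.const 0))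
    (.store aK1 (.var vQ) (.var rK1) ;; .store aX1 (.var vQ) (.var rX1) ;;
      .store aK2 (.var vQ) (.var rK2) ;; .store aX2 (.var vQ) (.var rX2) ;;
      .assign vQ (.succ (.var vQ)) ;;
      .store aK1 (.var vQ) (.var rK2) ;; .store aX1 (.var vQ) (.var rX2) ;;
      .store aK2 (.var vQ) (.var rK1) ;; .store aX2 (.var vQ) (.var rX1) ;;
      .assign vQ (.succ (.var vQ)) ;; .assign vLen (.const 0))

theorem clauseC_spec {cs : List (List (ℕ × ℕ))} {c : List (ℕ × ℕ)} (hc : c ≠ [])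
    (hc2 : c.length ≤ 2) {rest : List ℕ} {s : State} (h : Reading cs c rest s) :
    Run clauseC s clauseC.maxCost (fun s' => Reading (cs ++ [c]) [] rest s' ∧
      s'.vars vOk = s.vars vOk) := by
  have hne : s.vars vLen ≠ 0 := by rw [h.len]; simpa using hc
  refine Run.straight rfl ?_
  set t := clauseC.run s with ht
  set q := s.vars vQ with hq
  obtain ⟨l₁, hl₁⟩ : ∃ l, l ∈ c.head? := ⟨c.head hc, by simp [List.head?_eq_some_head hc]⟩
  obtain ⟨l₂, hl₂⟩ : ∃ l, l ∈ c.getLast? := ⟨c.getLast hc,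
    by simp [List.getLast?_eq_some_getLast hc]⟩
  obtain ⟨g1, g2⟩ := h.head l₁ hl₁
  obtain ⟨g3, g4⟩ := h.last l₂ hl₂
  have ev : t.vars vPos = s.vars vPos ∧ t.vars vLen = 0 ∧ t.vars vQ = q + 2 ∧
      t.vars vN = s.vars vN ∧
      t.vars vOk = s.vars vOk ∧
      t.arrays aIn = s.arrays aIn ∧ t.arrays aSeen = s.arrays aSeen ∧
      t.arrays aName = s.arrays aName ∧
      t.arrays aK1 = Function.update (Function.update (s.arrays aK1) q l₁.1) (q + 1) l₂.1 ∧
      t.arrays aX1 = Function.update (Function.update (s.arrays aX1) q l₁.2) (q + 1) l₂.2 ∧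
      t.arrays aK2 = Function.update (Function.update (s.arrays aK2) q l₂.1) (q + 1) l₁.1 ∧
      t.arrays aX2 = Function.update (Function.update (s.arrays aX2) q l₂.2) (q + 1) l₁.2 := by
    simp [ht, clauseC, Cmd.run, Test.eval, Expr.eval, hne, g1, g2, g3, g4, hq]
  obtain ⟨v1, v2, v3, v4, v5, w1, w2, w3, w4, w5, w6, w7⟩ := ev
  have hat : ∀ a, a ∈ clauseAtoms ([] :: (cs ++ [c])) ↔ a ∈ clauseAtoms (c :: cs) := by
    intro a
    simp only [mem_clauseAtoms, List.mem_cons, List.mem_append, List.not_mem_nil, or_false]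
    constructor
    · rintro ⟨d, rfl | hd | rfl, l, hl, h⟩
      · simp at hl
      · exact ⟨d, .inr hd, l, hl, h⟩
      · exact ⟨d, .inl rfl, l, hl, h⟩
    · rintro ⟨d, rfl | hd, l, hl, h⟩
      · exact ⟨d, .inr (.inr rfl), l, hl, h⟩
      · exact ⟨d, .inr (.inl hd), l, hl, h⟩
  have hpc : ∀ l l', (c = [l] ∧ l = l' ∨ c = [l, l'] ∨ c = [l', l]) ↔
      (l₁ = l ∧ l₂ = l') ∨ (l₂ = l ∧ l₁ = l') := by
    intro l l'
    match c, hc, hc2 with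
    | [x], _, _ =>
      simp at hl₁ hl₂
      subst hl₁ hl₂
      simp
      rintro rfl
      rfl
    | [x, y], _, _ =>
      simp at hl₁ hl₂
      subst hl₁ hl₂
      simp
      tauto
  refine ⟨⟨?_, by simp [v2], by simp [v3, hq, h.q]; ring, ?_, ?_, ?_, ?_, by simp, by simp⟩, v5⟩
  · rw [w1, v1]; exact h.input
  · rw [v4, w3]; exact h.inj
  · intro a; rw [hat, w2]; exact h.seen a
  · intro a; rw [hat, w3, v4]; exact h.names a
  · intro l l'
    have : Pairs (cs ++ [c]) l l' ↔
        Pairs cs l l' ∨ (c = [l] ∧ l = l' ∨ c = [l, l'] ∨ c = [l', l]) := by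
      unfold Pairs
      constructor
      · rintro ⟨d, hd, h⟩
        rcases List.mem_append.1 hd with hd | hd
        · exact .inl ⟨d, hd, h⟩
        · rw [List.mem_singleton] at hd
          exact .inr (hd ▸ h)
      · rintro (⟨d, hd, h⟩ | h)
        · exact ⟨d, by simp [hd], h⟩
        · exact ⟨c, by simp, h⟩
    rw [this, hpc, h.pairs, v3, exists_lt_succ, exists_lt_succ, w4, w5, w6, w7, or_assoc]
    refine or_congr (exists_congr fun j => and_congr_right fun hj => ?_) (or_congr ?_ ?_)
    · have n1 : j ≠ q := hj.ne
      have n2 : j ≠ q + 1 := by omega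
      simp only [Function.update_of_ne n1, Function.update_of_ne n2]
    · simp [Prod.ext_iff, and_assoc]
    · simp [Prod.ext_iff, and_assoc]

/-- The program `rc` reads one item: it turns the code `enc x` into the literals `lits x`. -/
structure IsReader {X : Type} (rc : Cmd) (enc : X → List ℕ) (lits : X → List (ℕ × ℕ)) : Prop where
  wv : ∀ x ∈ [vCnt, vSp, vAll, vDone, vOk], x ∉ rc.wv
  wa : ∀ A ∈ [aF, aB], A ∉ rc.wa
  silent : rc.silent = true
  spec : ∃ T, ∀ x cs rest s, (lits x).length ≤ 2 → Reading cs [] (enc x ++ rest) s →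
    Run rc s T (Reading cs (lits x) rest)

/-- Reads and stores items until all are read or an empty clause is found. -/
def itemsC (rc : Cmd) : Cmd :=
  .loop (.and (.lt (.var vDone) (.var vAll)) (.eq (.var vOk) (.const 1)))
    (rc ;; clauseC ;; .assign vDone (.succ (.var vDone)))

/-- Each item but an empty clause has a literal that pays for reading it. -/
theorem itemsC_spec {X : Type} {rc : Cmd} {enc : X → List ℕ} {lits : X → List (ℕ × ℕ)}
    (hrc : IsReader rc enc lits) : ∃ C, ∀ (xs : List X) (cs : List (List (ℕ × ℕ))) (s : State),
    (∀ x ∈ xs, (lits x).length ≤ 2) → Reading cs [] (xs.flatMap enc) s →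
    s.vars vDone + xs.length = s.vars vAll → s.vars vOk = 1 →
    Run (itemsC rc) s (C * ((xs.map fun x => (lits x).length).sum + 1)) (fun s' =>
      (s'.vars vOk = 1 ∧ Reading (cs ++ xs.map lits) [] [] s' ∧ ∀ x ∈ xs, lits x ≠ []) ∨
      (s'.vars vOk = 0 ∧ ∃ x ∈ xs, lits x = [])) := by
  obtain ⟨T, hT⟩ := hrc.spec
  refine ⟨T + clauseC.maxCost + 30, fun xs => ?_⟩
  induction xs with
  | nil =>
    intro cs s _ hR hd hok
    refine ⟨_, s, .loop_false ?_, ?_, .inl ⟨hok, by simpa using hR, by simp⟩⟩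
    · simp only [List.length_nil, add_zero] at hd
      simp [Test.eval, Expr.eval, hd]
    · simp only [Test.cost, Expr.cost, List.map_nil, List.sum_nil]
      omega
  | cons x xs ih =>
    intro cs s hlen hR hd hok
    rw [List.flatMap_cons] at hR
    have htest : Test.eval s (.and (.lt (.var vDone) (.var vAll)) (.eq (.var vOk) (.const 1))) := by
      simp only [List.length_cons] at hd
      exact ⟨show s.vars vDone < s.vars vAll by omega, hok⟩
    obtain ⟨t₁, s₁, x₁, b₁, hR₁⟩ := hT x cs _ s (hlen x (by simp)) hR
    have f₁ := x₁.frame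
    have d₁ : s₁.vars vDone = s.vars vDone := f₁.var _ (hrc.wv _ (by simp))
    have a₁ : s₁.vars vAll = s.vars vAll := f₁.var _ (hrc.wv _ (by simp))
    have o₁ : s₁.vars vOk = 1 := (f₁.var _ (hrc.wv _ (by simp))).trans hok
    by_cases hx : lits x = []
    · obtain ⟨t₂, s₂, x₂, b₂, hok₂⟩ := Run.straight
        (p := clauseC ;; .assign vDone (.succ (.var vDone)))
        (s := s₁) (Q := fun s' => s'.vars vOk = 0) rfl (by
          have : s₁.vars vLen = 0 := by rw [hR₁.len, hx]; rfl
          simp [clauseC, Cmd.run, Test.eval, Expr.eval, this])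
      refine ⟨_, s₂, .loop_true htest (.seq x₁ x₂) (.loop_false ?_), ?_,
        .inr ⟨hok₂, x, by simp, hx⟩⟩
      · simp [Test.eval, Expr.eval, hok₂]
      · simp only [Test.cost, Expr.cost, Cmd.maxCost] at b₂ ⊢
        refine le_trans ?_ (Nat.le_mul_of_pos_right _ (Nat.succ_pos _))
        omega
    · obtain ⟨t₂, s₂, x₂, b₂, hR₂, o₂⟩ := clauseC_spec hx (hlen x (by simp)) hR₁
      have f₂ := x₂.frame
      obtain ⟨t₃, s₃, x₃, b₃, e₃⟩ := Run.straight (p := .assign vDone (.succ (.var vDone)))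
        (s := s₂) (Q := fun s' => s'.vars vDone = s.vars vDone + 1) rfl (by
          simp [Cmd.run, Expr.eval, f₂.var vDone (by decide), d₁])
      have f₃ := x₃.frame
      have hR₃ := hR₂.frame f₃ (by decide) (by decide)
      obtain ⟨t₄, s₄, x₄, b₄, hQ⟩ := ih (cs ++ [lits x]) s₃ (fun y hy => hlen y (by simp [hy])) hR₃
        (by
          rw [e₃, f₃.var vAll (by decide), f₂.var vAll (by decide), a₁, ← hd, List.length_cons]
          ring)
        (by rw [f₃.var vOk (by decide), o₂, o₁])
      refine ⟨_, s₄, .loop_true htest (.seq x₁ (.seq x₂ x₃)) x₄, ?_, ?_⟩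
      · have hpos : 0 < (lits x).length := List.length_pos_iff.2 hx
        simp only [Test.cost, Expr.cost, Cmd.maxCost, List.map_cons, List.sum_cons] at b₃ b₄ ⊢
        nlinarith [Nat.zero_le (T + clauseC.maxCost)]
      · rcases hQ with ⟨h1, h2, h3⟩ | ⟨h1, y, hy, h2⟩
        · refine .inl ⟨h1, by simpa using h2, ?_⟩
          simpa using ⟨hx, h3⟩
        · exact .inr ⟨h1, y, by simp [hy], h2⟩

/-- Reads a list of items with `rc` and computes the answer sets of the resulting clauses. There are
none if some clause is empty. -/
def solver (rc : Cmd) : Cmd :=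
  (.assign vAll inNext ;; .assign vPos (.const 1) ;; .assign vOk (.const 1)) ;; itemsC rc ;;
    .ite (.eq (.var vOk) (.const 1)) solveC .skip

theorem Reading.parsed {cs : List (List (ℕ × ℕ))} {rest : List ℕ} {s : State}
    (h : Reading cs [] rest s) : Parsed s.data cs where
  inj := h.inj
  names a := by
    change a ∈ clauseAtoms cs ↔ ∃ i < s.vars vN, s.arrays aName i = a
    rw [← h.names]
    simp [mem_clauseAtoms]
  pairs := h.pairs

theorem length_clause_le_sum {X : Type} {lits : X → List (ℕ × ℕ)} {xs : List X}
    (h : ∀ x ∈ xs, lits x ≠ []) : xs.length ≤ (xs.map fun x => (lits x).length).sum := by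
  induction xs with
  | nil => simp
  | cons x xs ih =>
    have := List.length_pos_iff.2 (h x (by simp))
    have := ih fun y hy => h y (by simp [hy])
    simp only [List.length_cons, List.map_cons, List.sum_cons]
    omega

theorem card_clauseAtoms_le {X : Type} (lits : X → List (ℕ × ℕ)) (xs : List X) :
    (clauseAtoms (xs.map lits)).card ≤ (xs.map fun x => (lits x).length).sum := by
  refine (List.toFinset_card_le _).trans ?_
  simp [List.length_flatten, Function.comp_def]

theorem Parsed.n_eq {D : Data} {L : List (List (ℕ × ℕ))} (h : Parsed D L) :
    D.n = (clauseAtoms L).card := by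
  have : clauseAtoms L = (Finset.range D.n).image D.name := by
    ext a
    simp [h.names]
  rw [this, Finset.card_image_of_injOn, Finset.card_range]
  intro i hi j hj
  exact h.inj i (by simpa using hi) j (by simpa using hj)

/-- The solver is correct and runs in the required time, whatever the code of the clauses is. -/
theorem solver_computes {X : Type} {rc : Cmd} {enc : X → List ℕ} {lits : X → List (ℕ × ℕ)}
    (hrc : IsReader rc enc lits)
    (hkind : ∀ x, ∀ l ∈ lits x, l.1 = 1 ∨ l.1 = 2 ∨ l.1 = 3) :
    ∃ C : ℝ, ∀ xs : List X, (∀ x ∈ xs, (lits x).length ≤ 2) →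
      ∃ t, Computes (solver rc) (xs.length :: xs.flatMap enc) (IsAns (xs.map lits)) t ∧
        (t : ℝ) ≤ C * (max 1 (xs.map fun x => (lits x).length).sum : ℕ) *
          (3 : ℝ) ^ (((clauseAtoms (xs.map lits)).card : ℝ) / 3) := by
  obtain ⟨C₁, h₁⟩ := itemsC_spec hrc
  obtain ⟨C₂, hC₂, h₂⟩ := solveC_spec
  refine ⟨2 * C₁ + 30 + 4 * C₂, fun xs hxs => ?_⟩
  set N := (xs.map fun x => (lits x).length).sum with hN
  set m := max 1 N with hm
  set L := xs.map lits with hL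
  set s₀ := State.init (xs.length :: xs.flatMap enc) with hs₀
  obtain ⟨t₁, s₁, x₁, b₁, hR₁, e₁, d₁, o₁, c₁, p₁, F₁, B₁, q₁⟩ := Run.straight (s := s₀)
    (p := .assign vAll inNext ;; .assign vPos (.const 1) ;; .assign vOk (.const 1))
    (Q := fun s => Reading [] [] (xs.flatMap enc) s ∧ s.vars vAll = xs.length ∧ s.vars vDone = 0 ∧
      s.vars vOk = 1 ∧ s.vars vCnt = 0 ∧ s.vars vSp = 0 ∧ (∀ a, s.arrays aF a = 0) ∧
      (∀ a, s.arrays aB a = 0) ∧ s.output = []) rfl (by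
      refine ⟨⟨fun i => ?_, ?_, ?_, ?_, ?_, ?_, ?_, by simp, by simp⟩, ?_⟩ <;>
        simp [Cmd.run, Expr.eval, hs₀, State.init, mem_clauseAtoms, Pairs, add_comm])
  obtain ⟨t₂, s₂, x₂, b₂, hQ⟩ := h₁ xs [] s₁ hxs hR₁ (by rw [d₁, e₁, zero_add]) o₁
  have f₂ := x₂.frame
  have fv : ∀ x ∈ [vCnt, vSp], s₂.vars x = s₁.vars x := by
    intro x hx
    refine f₂.var x ?_
    have : x ∉ rc.wv := hrc.wv x (by fin_cases hx <;> simp)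
    simp only [itemsC, Cmd.wv, List.mem_append, not_or]
    exact ⟨this, by fin_cases hx <;> decide, by fin_cases hx <;> decide⟩
  have fa : ∀ A ∈ [aF, aB], s₂.arrays A = s₁.arrays A := by
    intro A hA
    refine f₂.arr A ?_
    have : A ∉ rc.wa := hrc.wa A hA
    simp only [itemsC, Cmd.wa, List.mem_append, not_or]
    exact ⟨this, by fin_cases hA <;> decide, by simp⟩
  have fo : s₂.output = [] := by
    rw [f₂.out (by simp [itemsC, Cmd.silent, hrc.silent, clauseC]), q₁]
  have hroot : (1 : ℝ) ≤ root ^ (clauseAtoms L).card := by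
    exact one_le_pow₀ (by have := lt_root; linarith)
  have hm1 : 1 ≤ m := le_max_left _ _
  have hNm : N ≤ m := le_max_right _ _
  have b₁' : t₁ ≤ 12 := b₁.trans (by simp [Cmd.maxCost, Expr.cost])
  have b₂' : t₂ ≤ 2 * C₁ * m := b₂.trans (by nlinarith [Nat.zero_le C₁])
  have hsmall : ((t₁ + t₂ + 8 : ℕ) : ℝ) ≤ (2 * C₁ + 30) * m * root ^ (clauseAtoms L).card := by
    have : ((t₁ + t₂ + 8 : ℕ) : ℝ) ≤ (2 * C₁ + 30) * m := by
      have : t₁ + t₂ + 8 ≤ (2 * C₁ + 30) * m := by nlinarith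
      exact_mod_cast this
    exact this.trans (le_mul_of_one_le_right (by positivity) hroot)
  push_cast at hsmall
  rw [rpow_div_three]
  rcases hQ with ⟨hok, hR, hne⟩ | ⟨hok, x, hx, hx0⟩
  · rw [List.nil_append] at hR
    have hP := hR.parsed
    have hn : s₂.data.n = (clauseAtoms L).card := hP.n_eq
    have hq : s₂.data.q = 2 * xs.length := by
      have := hR.q
      rwa [List.length_map] at this
    obtain ⟨t₃, s₃, outs, x₃, hout, hnd, hans, b₃⟩ := h₂ s₂.data L s₂ s₂.has_data hP
      (by
        intro c hc
        obtain ⟨x, hx, rfl⟩ := List.mem_map.1 hc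
        exact ⟨hne x hx, hxs x hx, hkind x⟩)
      (by rw [fv _ (by simp), c₁]) (by rw [fv _ (by simp), p₁])
      (by rw [fa _ (by simp)]; exact F₁) (by rw [fa _ (by simp)]; exact B₁)
    refine ⟨_, ⟨s₃, outs, .seq x₁ (.seq x₂ (.ite_true hok x₃)), by rw [hout, fo]; rfl, hnd, hans⟩,
      ?_⟩
    have hDm : s₂.data.m ≤ 4 * m := by
      have h1 : xs.length ≤ N := length_clause_le_sum hne
      have h2 : (clauseAtoms L).card ≤ N := card_clauseAtoms_le lits xs
      simp only [Data.m, hq, hn]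
      omega
    have hDm' : (s₂.data.m : ℝ) ≤ 4 * m := by exact_mod_cast hDm
    rw [hn] at b₃
    have : C₂ * s₂.data.m * root ^ (clauseAtoms L).card ≤
        C₂ * (4 * m) * root ^ (clauseAtoms L).card := by gcongr
    simp only [Test.cost, Expr.cost]
    push_cast
    linarith
  · refine ⟨_, ⟨s₂, [], .seq x₁ (.seq x₂ (.ite_false ?_ (.skip _))), by rw [fo]; rfl, by simp,
      fun M => ?_⟩, ?_⟩
    · simp [Test.eval, Expr.eval, hok]
    · refine ⟨fun h => ?_, fun h => by simp at h⟩
      obtain ⟨l, hl, -⟩ := h.1 [] (List.mem_map.2 ⟨x, hx, hx0⟩)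
      simp at hl
    · simp only [Test.cost, Expr.cost]
      have : 0 ≤ C₂ * (4 * m) * root ^ (clauseAtoms L).card := by positivity
      push_cast
      linarith

end MinModels

namespace MinModels

/-! ### Theories and programs as input -/

/-- The literals of a program clause, in the common form. -/
def Rule.lits (r : Rule) : List (ℕ × ℕ) :=
  r.head.map (Prod.mk 3) ++ r.pos.map (Prod.mk 1) ++ r.neg.map (Prod.mk 2)

/-- A literal of a theory, in the common form: a positive literal becomes a head atom and a negative
one a body atom. -/
def Literal.lit (l : Literal) : ℕ × ℕ := (if l.positive then 3 else 1, l.atom)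

theorem Rule.length_lits (r : Rule) : r.lits.length = r.length := by
  simp [Rule.lits, Rule.length]; ring

theorem Rule.kind_lits (r : Rule) : ∀ l ∈ r.lits, l.1 = 1 ∨ l.1 = 2 ∨ l.1 = 3 := by
  intro l hl
  simp only [Rule.lits, List.mem_append, List.mem_map] at hl
  rcases hl with (⟨a, -, rfl⟩ | ⟨a, -, rfl⟩) | ⟨a, -, rfl⟩ <;> simp

theorem clauseAtoms_program (P : Program) : clauseAtoms (P.map Rule.lits) = P.atoms := by
  ext a
  simp only [mem_clauseAtoms, Program.atoms, List.mem_toFinset, List.mem_flatMap, List.mem_map,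
    exists_exists_and_eq_and]
  refine exists_congr fun r => and_congr_right fun _ => ?_
  simp only [Rule.lits, List.mem_append, List.mem_map, or_and_right, exists_or,
    exists_exists_and_eq_and, exists_eq_right]

theorem red_program (P : Program) (M N : Finset ℕ) :
    Red (P.map Rule.lits) M N ↔ (P.reduct M).IsModel N := by
  simp only [Red, List.forall_mem_map, Program.IsModel, Program.reduct, List.mem_filter,
    decide_eq_true_eq, and_imp, List.not_mem_nil, IsEmpty.forall_iff, implies_true, forall_const]
  refine forall_congr' fun r => imp_congr_right fun _ => ?_
  simp only [Rule.lits, List.mem_append, List.mem_map, or_and_right, exists_or,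
    exists_exists_and_eq_and, LitIn]
  simp
  constructor
  · rintro ((h | ⟨a, ha, hn⟩) | ⟨b, hb, hm⟩) h1 h2
    · exact h
    · exact absurd (h2 a ha) hn
    · exact absurd hm (h1 b hb)
  · intro h
    by_contra! hc
    obtain ⟨⟨h1, h2⟩, h3⟩ := hc
    obtain ⟨c, hc, hcN⟩ := h h3 h2
    exact h1 c hc hcN

theorem isAns_program (P : Program) : IsAns (P.map Rule.lits) = P.IsAnswerSet := by
  ext M
  simp only [IsAns, Program.IsAnswerSet, red_program]

/-- The models of a reduct with single heads are closed under intersection, so that a minimal model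
is the least one. -/
theorem isStableModel_iff {P : Program} (hP : P.IsNormal 2) (M : Finset ℕ) :
    P.IsStableModel M ↔ P.IsAnswerSet M := by
  constructor
  · rintro ⟨h1, h2⟩
    exact ⟨h1, fun N hN h => hN.2 (h2 h)⟩
  · rintro ⟨h1, h2⟩
    refine ⟨h1, fun N hN => ?_⟩
    have hinter : (P.reduct M).IsModel (M ∩ N) := by
      intro r hr hpos hneg
      have hr1 : r.head.length = 1 := by
        simp only [Program.reduct, List.mem_map, List.mem_filter] at hr
        obtain ⟨r', ⟨hr', -⟩, rfl⟩ := hr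
        exact (hP r' hr').1
      have hneg' : r.neg = [] := by
        simp only [Program.reduct, List.mem_map, List.mem_filter] at hr
        obtain ⟨r', -, rfl⟩ := hr
        rfl
      obtain ⟨a, ha⟩ := List.length_eq_one_iff.1 hr1
      obtain ⟨c, hc, hcM⟩ := h1 r hr (fun a ha => (Finset.mem_inter.1 (hpos a ha)).1)
        (by simp [hneg'])
      obtain ⟨d, hd, hdN⟩ := hN r hr (fun a ha => (Finset.mem_inter.1 (hpos a ha)).2)
        (by simp [hneg'])
      rw [ha, List.mem_singleton] at hc hd
      subst hc hd
      exact ⟨_, by simp [ha], Finset.mem_inter.2 ⟨hcM, hdN⟩⟩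
    by_contra hMN
    refine h2 (M ∩ N) ⟨Finset.inter_subset_left, fun h => hMN fun a ha => ?_⟩ hinter
    exact (Finset.mem_inter.1 (h ha)).2

theorem clauseAtoms_theory (T : Theory) :
    clauseAtoms (T.map (List.map Literal.lit)) = T.atoms := by
  ext a
  simp only [mem_clauseAtoms, Theory.atoms, List.mem_toFinset, List.mem_map, List.mem_flatten,
    exists_exists_and_eq_and, Literal.lit]
  exact ⟨fun ⟨c, hc, l, hl, h⟩ => ⟨l, ⟨c, hc, hl⟩, h⟩, fun ⟨l, ⟨c, hc, hl⟩, h⟩ => ⟨c, hc, l, hl, h⟩⟩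

theorem red_theory (T : Theory) (M N : Finset ℕ) :
    Red (T.map (List.map Literal.lit)) M N ↔ ∀ c ∈ T, ∃ l ∈ c, l.Holds N := by
  unfold Red
  rw [List.forall_mem_map]
  refine forall_congr' fun c => imp_congr_right fun _ => ?_
  simp only [List.mem_map, exists_exists_and_eq_and]
  refine exists_congr fun l => and_congr_right fun _ => ?_
  rcases l with ⟨_ | _, a⟩ <;> simp [LitIn, Literal.lit, Literal.Holds]

theorem isAns_theory (T : Theory) :
    IsAns (T.map (List.map Literal.lit)) = T.IsMinimalModel := by
  ext M
  constructor
  · intro h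
    refine ⟨⟨clauseAtoms_theory T ▸ h.subset, (red_theory T M M).1 h.1⟩, fun N hN hm => ?_⟩
    exact h.2 N hN ((red_theory T M N).2 hm.2)
  · rintro ⟨⟨h1, h2⟩, h3⟩
    refine ⟨(red_theory T M M).2 h2, fun N hN hr => ?_⟩
    exact h3 N hN ⟨hN.1.trans h1, (red_theory T M N).1 hr⟩

/-- Reads a program clause. -/
def ruleC : Cmd :=
  listC (.assign vKind (.const 3) ;; litC) ;; listC (.assign vKind (.const 1) ;; litC) ;;
    listC (.assign vKind (.const 2) ;; litC)

/-- Reads a clause of a theory. -/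
def theoryClauseC : Cmd :=
  listC (.ite (.eq inNext (.const 0)) (.assign vKind (.const 1)) (.assign vKind (.const 3)) ;;
    .assign vPos (.succ (.var vPos)) ;; litC)

theorem Reading.setPos {cs : List (List (ℕ × ℕ))} {buf : List (ℕ × ℕ)} {x : ℕ} {rest : List ℕ}
    {s : State} (h : Reading cs buf (x :: rest) s) :
    Reading cs buf rest (s.setVar vPos (s.vars vPos + 1)) where
  input i := by
    have := h.input (i + 1)
    rw [State.setVar_self, State.setVar_arrays, add_assoc, add_comm 1 i, this]
    simp
  len := h.len
  q := h.q
  inj := h.inj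
  seen := h.seen
  names := h.names
  pairs := h.pairs
  head := h.head
  last := h.last

theorem listC_atoms_spec (κ : ℕ) {cs : List (List (ℕ × ℕ))} {buf : List (ℕ × ℕ)} {as : List ℕ}
    (has : as.length ≤ 2) {rest : List ℕ} {s : State}
    (h : Reading cs buf (encodeList as ++ rest) s) :
    Run (listC (.assign vKind (.const κ) ;; litC)) s (2 * (2 + litC.maxCost) + 26)
      (Reading cs (buf ++ as.map (Prod.mk κ)) rest) := by
  refine listC_spec (enc := fun a => [a]) (by simp [Cmd.wv, litC]) (by simp [Cmd.wv, litC]) ?_ has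
    (by simpa [encodeList] using h)
  intro cs buf a rest s h
  refine (Run.straight (p := .assign vKind (.const κ)) (Q := fun s' => s'.vars vKind = κ) rfl
    (by simp [Cmd.run, Expr.eval])).seq fun s' f e => ?_
  rw [← e]
  exact litC_spec (h.frame f (by simp [Cmd.wv]) (by simp [Cmd.wa]))

theorem ruleC_isReader : IsReader ruleC
    (fun r => encodeList r.head ++ encodeList r.pos ++ encodeList r.neg) Rule.lits where
  wv := by decide
  wa := by decide
  silent := rfl
  spec := by
    set T := 2 * (2 + litC.maxCost) + 26
    refine ⟨T + (T + T), fun r cs rest s hlen h => ?_⟩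
    rw [Rule.length_lits, Rule.length] at hlen
    rw [List.append_assoc, List.append_assoc] at h
    refine (listC_atoms_spec 3 (by omega) h).seq fun s₁ _ h₁ => ?_
    refine (listC_atoms_spec 1 (by omega) h₁).seq fun s₂ _ h₂ => ?_
    exact (listC_atoms_spec 2 (by omega) h₂).mono le_rfl fun _ _ h => h

theorem theoryClauseC_isReader : IsReader theoryClauseC
    (fun c => c.length :: c.flatMap encodeLiteral) (List.map Literal.lit) where
  wv := by decide
  wa := by decide
  silent := rfl
  spec := by
    refine ⟨2 * (13 + litC.maxCost) + 26, fun c cs rest s hlen h => ?_⟩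
    rw [List.length_map] at hlen
    refine (listC_spec (lit := Literal.lit) (enc := encodeLiteral) (by decide) (by decide) ?_ hlen
      (by simpa using h)).mono le_rfl fun _ _ h => h
    intro cs buf l rest s h
    have h0 : s.arrays aIn (s.vars vPos) = if l.positive then 1 else 0 := by
      simpa [encodeLiteral] using h.input 0
    refine ((Run.straight
      (p := .ite (.eq inNext (.const 0)) (.assign vKind (.const 1)) (.assign vKind (.const 3)))
      (Q := fun s' => s'.vars vKind = l.lit.1) rfl ?_).seq
      (U := 3 + litC.maxCost) fun s₁ f₁ e₁ => ?_).mono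
      (by simp [Cmd.maxCost, Expr.cost, Test.cost]; omega) fun _ _ h => h
    · by_cases hl : l.positive = true <;>
        simp [Cmd.run, Test.eval, Expr.eval, h0, hl, Literal.lit]
    · have h₁ := h.frame f₁ (by decide) (by decide)
      refine (Run.straight (p := .assign vPos (.succ (.var vPos)))
        (Q := fun s' => s' = s₁.setVar vPos (s₁.vars vPos + 1)) rfl
        (by simp [Cmd.run, Expr.eval, State.setVar])).seq fun s₂ f₂ e₂ => ?_
      subst e₂
      have := litC_spec (cs := cs) (buf := buf) (a := l.atom) (rest := rest) h₁.setPos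
      rw [State.setVar_ne _ _ (by decide), e₁] at this
      exact this

end MinModels

theorem mainTheorem4 :
    -- minimal models of 2-CNF theories
    (∃ (p : MinModels.Cmd) (C : ℝ), ∀ T : MinModels.Theory, T.IsCNF 2 →
      ∃ t : ℕ, MinModels.Computes p (MinModels.encodeTheory T) T.IsMinimalModel t ∧
        (t : ℝ) ≤ C * (max 1 T.size : ℕ) * (3 : ℝ) ^ ((T.atoms.card : ℝ) / 3)) ∧
    -- stable models of (normal) 2-programs
    (∃ (p : MinModels.Cmd) (C : ℝ), ∀ P : MinModels.Program, P.IsNormal 2 →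
      ∃ t : ℕ, MinModels.Computes p (MinModels.encodeProgram P) P.IsStableModel t ∧
        (t : ℝ) ≤ C * (max 1 P.size : ℕ) * (3 : ℝ) ^ ((P.atoms.card : ℝ) / 3)) ∧
    -- answer sets of disjunctive 2-programs
    (∃ (p : MinModels.Cmd) (C : ℝ), ∀ P : MinModels.Program, P.IsDisjunctive 2 →
      ∃ t : ℕ, MinModels.Computes p (MinModels.encodeProgram P) P.IsAnswerSet t ∧
        (t : ℝ) ≤ C * (max 1 P.size : ℕ) * (3 : ℝ) ^ ((P.atoms.card : ℝ) / 3)) ∧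
    -- the bound is the function `m * 1.4422..^n`
    ((∀ n : ℕ, (3 : ℝ) ^ ((n : ℝ) / 3) = ((3 : ℝ) ^ ((1 : ℝ) / 3)) ^ n) ∧
      (1.4422 : ℝ) < (3 : ℝ) ^ ((1 : ℝ) / 3) ∧ (3 : ℝ) ^ ((1 : ℝ) / 3) < 1.4423) := by

  obtain ⟨C₁, h₁⟩ := MinModels.solver_computes MinModels.theoryClauseC_isReader fun c l hl => by
    obtain ⟨l', -, rfl⟩ := List.mem_map.1 hl
    rcases l' with ⟨_ | _, a⟩ <;> simp [MinModels.Literal.lit]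
  obtain ⟨C₂, h₂⟩ := MinModels.solver_computes MinModels.ruleC_isReader MinModels.Rule.kind_lits
  have h₂' : ∀ P : MinModels.Program, P.IsDisjunctive 2 →
      ∃ t : ℕ, MinModels.Computes (MinModels.solver MinModels.ruleC) (MinModels.encodeProgram P)
        P.IsAnswerSet t ∧
        (t : ℝ) ≤ C₂ * (max 1 P.size : ℕ) * (3 : ℝ) ^ ((P.atoms.card : ℝ) / 3) := by
    intro P hP
    have := h₂ P fun r hr => (MinModels.Rule.length_lits r).trans_le (hP r hr)
    simp only [MinModels.isAns_program, MinModels.clauseAtoms_program,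
      MinModels.Rule.length_lits] at this
    exact this
  refine ⟨⟨MinModels.solver MinModels.theoryClauseC, C₁, fun T hT => ?_⟩,
    ⟨MinModels.solver MinModels.ruleC, C₂, fun P hP => ?_⟩, ⟨_, C₂, h₂'⟩,
    MinModels.rpow_div_three, MinModels.lt_root, MinModels.root_lt⟩
  · have := h₁ T fun c hc => by simpa using hT.2 c hc
    simp only [MinModels.isAns_theory, MinModels.clauseAtoms_theory, List.length_map] at this
    exact this
  · have : P.IsStableModel = P.IsAnswerSet :=
      funext fun M => propext (MinModels.isStableModel_iff hP M)
    rw [this]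
    exact h₂' P fun r hr => (hP r hr).2
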